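/- Let $d\in\mathbb N$, let $\omega(x)=e^{-|x|^2}$ on $\mathbb R^d$, let $L^2_\omega$ be the space of measurable $u:\mathbb R^d\to\mathbb R$ with $\|u\|_{L^2_\omega}^2=\int |u|^2\omega\,dx<\infty$ (with inner product $\langle f,g\rangle=\int fg\,\omega\,dx$), and let $H^1_\omega$ be the space of $u\in L^2_\omega$ whose weak partial derivatives lie in $L^2_\omega$, with norm $\|u\|_{H^1_\omega}^2=\|u\|_{L^2_\omega}^2+\sum_i\|\partial_i u\|_{L^2_\omega}^2$. Put $\|(u,v)\|^2=\|u\|_{H^1_\omega}^2+\|v\|_{L^2_\omega}^2$ on $H^1_\omega\times L^2_\omega$. For $\mathbf n\in\mathbb N^d$ let $\psi_{\mathbf n}(x)=c_{\mathbf n}\prod_{j}H_{n_j}(x_j)$, where $H_n(x)=(-1)^ne^{x^2}\frac{d^n}{dx^n}e^{-x^2}$ and $c_{\mathbf n}>0$ is such that $\|\psi_{\mathbf n}\|_{L^2_\omega}=1$; these are eigenfunctions of $-(\Delta-2x\cdot\nabla)$ with eigenvalues $\rho_{\mathbf n}=2|\mathbf n|$. Let $e^{t\mathcal X}$ be the free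 evolution on $H^1_\omega\times L^2_\omega$ with $\mathcal X(u,v)=(v,\Delta u-2x\cdot\nabla u)$, that is, $e^{t\mathcal X}(u,v)=(m(t),\partial_t m(t))$ with $$m(t)=\sum_{\mathbf n}\Big(\langle u,\psi_{\mathbf n}\rangle\cos(\sqrt{\rho_{\mathbf n}}\,t)+\langle v,\psi_{\mathbf n}\rangle\tfrac{\sin(\sqrt{\rho_{\mathbf n}}\,t)}{\sqrt{\rho_{\mathbf n}}}\Big)\psi_{\mathbf n},\quad \partial_t m(t)=\sum_{\mathbf n}\Big(-\sqrt{\rho_{\mathbf n}}\langle u,\psi_{\mathbf n}\rangle\sin(\sqrt{\rho_{\mathbf n}}\,t)+\langle v,\psi_{\mathbf n}\rangle\cos(\sqrt{\rho_{\mathbf n}}\,t)\Big)\psi_{\mathbf n},$$ where $\sin(\sqrt\rho\,t)/\sqrt\rho$ means $t$ for $\rho=0$. Let $\sigma:\mathbb R\to\mathbb R$ be Lipschitz with $\sigma(0)=0$. For $T>0$ and $\theta\in L^\infty(\mathbb R^d\times[0,T])$, a mild solution of $$\partial_t^2 m-\Delta m+2x\cdot\nabla m+\theta m=\sigma(m),\qquad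 m(0)=m_0,\quad \partial_t m(0)=\tilde m_0,$$ is a function $M=(m,\partial_t m)\in C([0,T];H^1_\omega\times L^2_\omega)$ such that for all $t\in[0,T]$ $$M(t)=e^{t\mathcal X}(m_0,\tilde m_0)+\int_0^t e^{(t-s)\mathcal X}\big(0,\,-\theta(\cdot,s)m(s)+\sigma(m(s))\big)\,ds .$$ Let $(m_0,\tilde m_0)\in H^1_\omega\times\big(L^2_\omega\cap L^p_{\mathrm{loc}}(\mathbb R^d)\big)$ for some $p>2$, and assume that either $m_0\neq0$ and $m_0$ is a finite linear combination of the $\psi_{\mathbf n}$, or $m_0=0$, $\tilde m_0\ne0$ and $\tilde m_0$ is a finite linear combination of the $\psi_{\mathbf n}$. Then for every $(m_T,\tilde m_T)\in H^1_\omega\times L^2_\omega$ and all $\varepsilon,T>0$ there exists a control $\theta\in L^\infty(\mathbb R^d\times[0,T])$ such that the above problem has a unique mild solution $(m,\partial_t m)\in C([0,T];H^1_\omega\times L^2_\omega)$ and it satisfies $$\big\|(m(\cdot,T),\partial_t m(\cdot,T))-(m_T,\tilde m_T)\big\|_{H^1_\omega\times L^2_\omega}<\varepsilon .$$ -/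

import Mathlib

open MeasureTheory Set Filter Topology
open scoped ENNReal NNReal ContDiff

noncomputable section

namespace GaussianWave

/-- The Gaussian measure `e^{-|x|²} dx` on `ℝ^d`. -/
def gaussW (d : ℕ) : Measure (EuclideanSpace ℝ (Fin d)) :=
  volume.withDensity fun x => ENNReal.ofReal (Real.exp (-‖x‖ ^ 2))

/-- The weighted space `L²_ω(ℝ^d)` with weight `ω(x) = e^{-|x|²}`. -/
abbrev L2w (d : ℕ) : Type := Lp ℝ 2 (gaussW d)

/-- `g` is the weak partial derivative `∂_i u` on `ℝ^d` (with respect to Lebesgue measure). -/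
def HasWeakPartial {d : ℕ} (i : Fin d) (u g : EuclideanSpace ℝ (Fin d) → ℝ) : Prop :=
  ∀ φ : EuclideanSpace ℝ (Fin d) → ℝ, ContDiff ℝ ∞ φ → HasCompactSupport φ →
    ∫ x, u x * fderiv ℝ φ x (EuclideanSpace.single i 1) = - ∫ x, g x * φ x

lemma measurable_dens (d : ℕ) : Measurable fun x : EuclideanSpace ℝ (Fin d) =>
    ENNReal.ofReal (Real.exp (-‖x‖ ^ 2)) := by fun_prop

lemma volume_ac_gaussW (d : ℕ) :
    (volume : Measure (EuclideanSpace ℝ (Fin d))) ≪ gaussW d := by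
  refine withDensity_absolutelyContinuous' (measurable_dens d).aemeasurable ?_
  exact ae_of_all _ fun x => by simpa using Real.exp_pos _

instance gaussW_locallyFinite (d : ℕ) : IsLocallyFiniteMeasure (gaussW d) := by
  refine Measure.isLocallyFiniteMeasure_of_le (μ := volume) ?_
  calc gaussW d ≤ volume.withDensity 1 := by
        refine withDensity_mono (ae_of_all _ fun x => ?_)
        simp only [Pi.one_apply, ENNReal.ofReal_le_one, Real.exp_le_one_iff]
        nlinarith [sq_nonneg ‖x‖]
    _ = volume := withDensity_one

lemma memLp_mul_exp {d : ℕ} {ψ : EuclideanSpace ℝ (Fin d) → ℝ} (hc : Continuous ψ)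
    (hs : HasCompactSupport ψ) :
    MemLp (fun x => ψ x * Real.exp (‖x‖ ^ 2)) 2 (gaussW d) := by
  refine Continuous.memLp_of_hasCompactSupport (by fun_prop) ?_
  exact hs.mul_right

lemma integral_gaussW {d : ℕ} (g : EuclideanSpace ℝ (Fin d) → ℝ) :
    ∫ x, g x ∂(gaussW d) = ∫ x, Real.exp (-‖x‖ ^ 2) * g x := by
  unfold gaussW
  rw [integral_withDensity_eq_integral_toReal_smul (measurable_dens d)
    (ae_of_all _ fun x => ENNReal.ofReal_lt_top)]
  simp only [smul_eq_mul, ENNReal.toReal_ofReal (Real.exp_pos _).le]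

lemma integral_eq_inner {d : ℕ} {ψ : EuclideanSpace ℝ (Fin d) → ℝ} (hc : Continuous ψ)
    (hs : HasCompactSupport ψ) (f : L2w d) :
    ∫ x, f x * ψ x = inner ℝ ((memLp_mul_exp hc hs).toLp _) f := by
  rw [L2.inner_def]
  have h1 : ∫ x, inner ℝ ((memLp_mul_exp hc hs).toLp _ x) (f x) ∂(gaussW d)
      = ∫ x, f x * (ψ x * Real.exp (‖x‖ ^ 2)) ∂(gaussW d) := by
    refine integral_congr_ae ?_
    filter_upwards [(memLp_mul_exp hc hs).coeFn_toLp] with x hx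
    rw [hx]; simp
  rw [h1, integral_gaussW]
  refine integral_congr_ae (ae_of_all _ fun x => ?_)
  have h2 : Real.exp (-‖x‖ ^ 2) * Real.exp (‖x‖ ^ 2) = 1 := by
    rw [← Real.exp_add]; simp
  beta_reduce
  linear_combination (-(f x * ψ x)) * h2

lemma continuous_testDeriv {d : ℕ} {φ : EuclideanSpace ℝ (Fin d) → ℝ} (hφ : ContDiff ℝ ∞ φ)
    (v : EuclideanSpace ℝ (Fin d)) : Continuous fun x => fderiv ℝ φ x v :=
  (hφ.continuous_fderiv (by simp)).clm_apply continuous_const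

lemma compactSupport_testDeriv {d : ℕ} {φ : EuclideanSpace ℝ (Fin d) → ℝ}
    (hs : HasCompactSupport φ) (v : EuclideanSpace ℝ (Fin d)) :
    HasCompactSupport fun x => fderiv ℝ φ x v := hs.fderiv_apply (𝕜 := ℝ) v

lemma hasWeakPartial_iff {d : ℕ} (i : Fin d) (u g : L2w d) :
    HasWeakPartial i u g ↔ ∀ (φ : EuclideanSpace ℝ (Fin d) → ℝ) (hφ : ContDiff ℝ ∞ φ)
      (hs : HasCompactSupport φ),
      inner ℝ ((memLp_mul_exp (continuous_testDeriv hφ (EuclideanSpace.single i 1))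
        (compactSupport_testDeriv hs (EuclideanSpace.single i 1))).toLp _) u
      = - inner ℝ ((memLp_mul_exp hφ.continuous hs).toLp _) g := by
  unfold HasWeakPartial
  refine forall_congr' fun φ => forall_congr' fun hφ => forall_congr' fun hs => ?_
  rw [integral_eq_inner (continuous_testDeriv hφ _) (compactSupport_testDeriv hs _),
    integral_eq_inner hφ.continuous hs]

/-- The weighted Sobolev space `H¹_ω(ℝ^d)`: pairs `(u, ∇u)` with `u ∈ L²_ω` and all weak partial
derivatives in `L²_ω`. The weak gradient is determined by `u`, and the norm inherited from the
ambient Hilbert space is `(‖u‖² + ∑ i, ‖∂_i u‖²)^{1/2}`. -/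
def H1w (d : ℕ) : Submodule ℝ (WithLp 2 (L2w d × PiLp 2 fun _ : Fin d => L2w d)) where
  carrier := {U | ∀ i, HasWeakPartial i U.fst (U.snd i)}
  add_mem' {U V} hU hV i := by
    simp only [mem_ofPred_eq, hasWeakPartial_iff] at hU hV
    rw [hasWeakPartial_iff]
    intro φ hφ hs
    simp only [WithLp.add_fst, WithLp.add_snd, PiLp.add_apply, inner_add_right,
      hU i φ hφ hs, hV i φ hφ hs]
    ring
  zero_mem' i := by
    rw [hasWeakPartial_iff]
    intro φ hφ hs
    simp
  smul_mem' c U hU i := by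
    simp only [mem_ofPred_eq, hasWeakPartial_iff] at hU
    rw [hasWeakPartial_iff]
    intro φ hφ hs
    simp only [WithLp.smul_fst, WithLp.smul_snd, PiLp.smul_apply, inner_smul_right,
      hU i φ hφ hs]
    ring

/-- The underlying function in `L²_ω` of an element of `H¹_ω`. -/
def toL2 {d : ℕ} (u : H1w d) : L2w d := u.1.fst

lemma isClosed_H1w (d : ℕ) : IsClosed (H1w d : Set (WithLp 2 (L2w d × PiLp 2 fun _ : Fin d => L2w d))) := by
  have : (H1w d : Set (WithLp 2 (L2w d × PiLp 2 fun _ : Fin d => L2w d)))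
      = {U | ∀ i, HasWeakPartial i U.fst (U.snd i)} := rfl
  rw [this]
  simp only [hasWeakPartial_iff, ofPred_forall]
  refine isClosed_iInter fun i => isClosed_iInter fun φ => isClosed_iInter fun hφ =>
    isClosed_iInter fun hs => isClosed_eq ?_ ?_
  · exact continuous_const.inner (WithLp.prod_continuous_ofLp 2 _ _).fst
  · exact (continuous_const.inner
      ((PiLp.continuous_apply 2 _ i).comp (WithLp.prod_continuous_ofLp 2 _ _).snd)).neg

instance H1w_completeSpace (d : ℕ) : CompleteSpace (H1w d) := (isClosed_H1w d).completeSpace_coe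

/-- The state space `H¹_ω × L²_ω` with norm `(‖u‖²_{H¹_ω} + ‖v‖²_{L²_ω})^{1/2}`. -/
abbrev State (d : ℕ) : Type := WithLp 2 (H1w d × L2w d)

/-- The Hermite polynomial `H_n(x) = (-1)^n e^{x²} (d/dx)^n e^{-x²}`. -/
def hermiteH (n : ℕ) (x : ℝ) : ℝ :=
  (-1) ^ n * Real.exp (x ^ 2) * iteratedDeriv n (fun y => Real.exp (-y ^ 2)) x

/-- The polynomials underlying `hermiteH`. -/
def hermitePoly : ℕ → Polynomial ℝ
  | 0 => 1
  | n + 1 => 2 * Polynomial.X * hermitePoly n - Polynomial.derivative (hermitePoly n)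

lemma iteratedDeriv_gauss (n : ℕ) : iteratedDeriv n (fun y : ℝ => Real.exp (-y ^ 2)) =
    fun x => (-1) ^ n * ((hermitePoly n).eval x * Real.exp (-x ^ 2)) := by
  induction n with
  | zero => ext x; simp [hermitePoly]
  | succ n ih =>
    rw [iteratedDeriv_succ, ih]
    ext x
    have h1 : HasDerivAt (fun y : ℝ => Real.exp (-y ^ 2)) (Real.exp (-x ^ 2) * (-(2 * x))) x := by
      have := ((hasDerivAt_pow 2 x).neg).exp
      simpa using this
    have := ((((hermitePoly n).hasDerivAt x).mul h1).const_mul ((-1 : ℝ) ^ n)).deriv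
    refine this.trans ?_
    simp only [hermitePoly, Polynomial.eval_sub, Polynomial.eval_mul, Polynomial.eval_X,
      Polynomial.eval_ofNat]
    ring

lemma hermiteH_eq (n : ℕ) (x : ℝ) : hermiteH n x = (hermitePoly n).eval x := by
  have h2 : Real.exp (x ^ 2) * Real.exp (-x ^ 2) = 1 := by
    rw [← Real.exp_add]; simp
  have h3 : ((-1 : ℝ) ^ n) * (-1) ^ n = 1 := by rw [← mul_pow]; simp
  rw [hermiteH, iteratedDeriv_gauss]
  linear_combination ((hermitePoly n).eval x * ((-1 : ℝ) ^ n) * (-1) ^ n) * h2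
    + (hermitePoly n).eval x * h3

/-- The function `x ↦ ∏ j, p_j(x_j)` on `ℝ^d`. -/
def prodPoly {d : ℕ} (p : Fin d → Polynomial ℝ) (x : EuclideanSpace ℝ (Fin d)) : ℝ :=
  ∏ j, (p j).eval (x j)

lemma continuous_prodPoly {d : ℕ} (p : Fin d → Polynomial ℝ) : Continuous (prodPoly p) := by
  unfold prodPoly
  exact continuous_finsetProd _ fun j _ => (p j).continuous.comp (by fun_prop)

lemma integrable_poly_gauss (p : Polynomial ℝ) :
    Integrable fun x : ℝ => p.eval x * Real.exp (-x ^ 2) := by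
  induction p using Polynomial.induction_on' with
  | add p q hp hq => exact (hp.add hq).congr (ae_of_all _ fun x => by simp [add_mul])
  | monomial n a =>
    have h := integrable_rpow_mul_exp_neg_mul_sq (b := 1) one_pos (s := n)
      (by have : (0 : ℝ) ≤ n := n.cast_nonneg
          linarith)
    simp only [Real.rpow_natCast, neg_mul, one_mul] at h
    simpa [mul_assoc] using h.const_mul a

lemma memLp_prodPoly {d : ℕ} (p : Fin d → Polynomial ℝ) : MemLp (prodPoly p) 2 (gaussW d) := by
  rw [memLp_two_iff_integrable_sq (continuous_prodPoly p).aestronglyMeasurable, gaussW,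
    integrable_withDensity_iff_integrable_smul' (measurable_dens d)
      (ae_of_all _ fun x => ENNReal.ofReal_lt_top)]
  have h := Integrable.fintype_prod (μ := fun _ : Fin d => (volume : Measure ℝ))
    (f := fun j x => (p j * p j).eval x * Real.exp (-x ^ 2))
    fun j => integrable_poly_gauss (p j * p j)
  have h' := (PiLp.volume_preserving_ofLp (Fin d)).integrable_comp_of_integrable h
  refine h'.congr (ae_of_all _ fun x => ?_)
  beta_reduce
  rw [ENNReal.toReal_ofReal (Real.exp_pos _).le]
  simp only [Function.comp, Finset.prod_mul_distrib, Polynomial.eval_mul, smul_eq_mul, prodPoly,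
    EuclideanSpace.norm_sq_eq, Real.norm_eq_abs,
    sq_abs, ← Finset.sum_neg_distrib, Real.exp_sum]
  ring

lemma hasFDerivAt_prodPoly {d : ℕ} (p : Fin d → Polynomial ℝ) (x : EuclideanSpace ℝ (Fin d)) :
    HasFDerivAt (prodPoly p) (∑ i, (∏ j ∈ Finset.univ.erase i, (p j).eval (x j)) •
      ((p i).derivative.eval (x i) • (EuclideanSpace.proj i : _ →L[ℝ] ℝ))) x := by
  unfold prodPoly
  refine HasFDerivAt.finsetProd fun i _ => ?_
  exact ((p i).hasDerivAt (x i)).comp_hasFDerivAt x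
    ((EuclideanSpace.proj i : EuclideanSpace ℝ (Fin d) →L[ℝ] ℝ).hasFDerivAt)

lemma fderiv_prodPoly {d : ℕ} (p : Fin d → Polynomial ℝ) (i : Fin d)
    (x : EuclideanSpace ℝ (Fin d)) :
    fderiv ℝ (prodPoly p) x (EuclideanSpace.single i 1)
      = prodPoly (Function.update p i (p i).derivative) x := by
  rw [(hasFDerivAt_prodPoly p x).fderiv, sum_apply,
    Finset.sum_eq_single i]
  · rw [prodPoly, ← Finset.mul_prod_erase _ _ (Finset.mem_univ i)]
    have h1 : (EuclideanSpace.proj i : EuclideanSpace ℝ (Fin d) →L[ℝ] ℝ)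
        (EuclideanSpace.single i 1) = 1 := by simp
    simp only [smul_apply, h1, smul_eq_mul, mul_one, Function.update_self]
    rw [mul_comm]
    congr 1
    refine Finset.prod_congr rfl fun j hj => ?_
    rw [Function.update_of_ne (Finset.ne_of_mem_erase hj)]
  · intro j _ hj
    simp [hj]
  · simp

lemma hasWeakPartial_prodPoly {d : ℕ} (p : Fin d → Polynomial ℝ) (i : Fin d) :
    HasWeakPartial i ((memLp_prodPoly p).toLp _)
      ((memLp_prodPoly (Function.update p i (p i).derivative)).toLp _) := by
  intro φ hφ hs
  have e1 := (volume_ac_gaussW d).ae_le (memLp_prodPoly p).coeFn_toLp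
  have e2 := (volume_ac_gaussW d).ae_le
    (memLp_prodPoly (Function.update p i (p i).derivative)).coeFn_toLp
  have hc := continuous_testDeriv hφ (EuclideanSpace.single i 1)
  have hcs := compactSupport_testDeriv hs (EuclideanSpace.single i 1)
  have h := integral_mul_fderiv_eq_neg_fderiv_mul_of_integrable (𝕜 := ℝ)
    (μ := (volume : Measure (EuclideanSpace ℝ (Fin d))))
    (f := prodPoly p) (g := φ) (v := EuclideanSpace.single i 1) ?_ ?_ ?_
    (fun x _ => (hasFDerivAt_prodPoly p x).differentiableAt)
    (fun x _ => (hφ.differentiable (by simp)).differentiableAt)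
  · simp only [fderiv_prodPoly] at h
    rw [integral_congr_ae (g := fun x => prodPoly p x * fderiv ℝ φ x (EuclideanSpace.single i 1)),
      h, integral_congr_ae (f := fun x => _ * φ x)]
    · filter_upwards [e2] with x hx
      rw [hx]
    · filter_upwards [e1] with x hx
      rw [hx]
  · simp only [fderiv_prodPoly]
    exact ((continuous_prodPoly _).mul hφ.continuous).integrable_of_hasCompactSupport hs.mul_left
  · exact ((continuous_prodPoly p).mul hc).integrable_of_hasCompactSupport hcs.mul_left
  · exact ((continuous_prodPoly p).mul hφ.continuous).integrable_of_hasCompactSupport hs.mul_left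

/-- The product Hermite function `x ↦ H_{n_1}(x_1) ⋯ H_{n_d}(x_d)`. -/
def hermiteProd {d : ℕ} (n : Fin d → ℕ) (x : EuclideanSpace ℝ (Fin d)) : ℝ :=
  ∏ j, hermiteH (n j) (x j)

lemma hermiteProd_eq {d : ℕ} (n : Fin d → ℕ) :
    hermiteProd n = prodPoly fun j => hermitePoly (n j) := by
  ext x; simp [hermiteProd, prodPoly, hermiteH_eq]

lemma memLp_hermiteProd {d : ℕ} (n : Fin d → ℕ) : MemLp (hermiteProd n) 2 (gaussW d) := by
  rw [hermiteProd_eq]; exact memLp_prodPoly _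

lemma exists_hermiteH1 {d : ℕ} (n : Fin d → ℕ) :
    ∃ u : H1w d, toL2 u = (memLp_hermiteProd n).toLp _ := by
  refine ⟨⟨WithLp.toLp 2 ((memLp_prodPoly fun j => hermitePoly (n j)).toLp _,
    WithLp.toLp 2 fun i => (memLp_prodPoly (Function.update (fun j => hermitePoly (n j)) i
      (hermitePoly (n i)).derivative)).toLp _), fun i => ?_⟩, ?_⟩
  · exact hasWeakPartial_prodPoly (fun j => hermitePoly (n j)) i
  · simp only [toL2]
    exact MemLp.toLp_congr (memLp_prodPoly _) (memLp_hermiteProd n) (by rw [hermiteProd_eq])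

/-- The `L²_ω`-norm of the product Hermite function. -/
def hermiteNorm {d : ℕ} (n : Fin d → ℕ) : ℝ := ‖(memLp_hermiteProd n).toLp _‖

/-- The eigenfunction `ψ_n` as an element of `L²_ω`, normalized so that `⟨ψ_n, ψ_n⟩ = 1`. -/
def psiL2 {d : ℕ} (n : Fin d → ℕ) : L2w d := (hermiteNorm n)⁻¹ • (memLp_hermiteProd n).toLp _

/-- The same eigenfunction `ψ_n` as an element of `H¹_ω` (see `psiH1_val`). -/
def psiH1 {d : ℕ} (n : Fin d → ℕ) : H1w d := (hermiteNorm n)⁻¹ • (exists_hermiteH1 n).choose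

lemma psiH1_val {d : ℕ} (n : Fin d → ℕ) : toL2 (psiH1 n) = psiL2 n := by
  rw [psiL2, ← (exists_hermiteH1 n).choose_spec]; rfl

/-- The eigenvalue `ρ_n = 2|n|` of `-(Δ - 2x·∇)`. -/
def rho {d : ℕ} (n : Fin d → ℕ) : ℝ := 2 * ∑ j, (n j : ℝ)

/-- `sin(√ρ t)/√ρ`, with the value `t` at `ρ = 0`. -/
def sinOver (ρ t : ℝ) : ℝ := if ρ = 0 then t else Real.sin (√ρ * t) / √ρ

/-- The free evolution `e^{t𝒳}` on `H¹_ω × L²_ω`, where `𝒳(u, v) = (v, Δu - 2x·∇u)`, through the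
spectral decomposition of `Δ - 2x·∇`. The first series is taken in `H¹_ω`, the second in `L²_ω`. -/
def freeEvolution {d : ℕ} (t : ℝ) (M : State d) : State d :=
  WithLp.toLp 2
    (∑' n : Fin d → ℕ, (inner ℝ (toL2 M.fst) (psiL2 n) * Real.cos (√(rho n) * t)
        + inner ℝ M.snd (psiL2 n) * sinOver (rho n) t) • psiH1 n,
     ∑' n : Fin d → ℕ, (-√(rho n) * inner ℝ (toL2 M.fst) (psiL2 n) * Real.sin (√(rho n) * t)
        + inner ℝ M.snd (psiL2 n) * Real.cos (√(rho n) * t)) • psiL2 n)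

open Classical in
/-- The product `f u ∈ L²_ω` of `u ∈ L²_ω` with a function `f` (such as `f ∈ L^∞`); it is `0` if
`f u` is not in `L²_ω`. -/
def mulL2 {d : ℕ} (f : EuclideanSpace ℝ (Fin d) → ℝ) (u : L2w d) : L2w d :=
  if h : MemLp (fun x => f x * u x) 2 (gaussW d) then h.toLp _ else 0

/-- The term `(-f 𝒴 + 𝒵) M = (0, -f m + σ(m))` for `M = (m, v)`. -/
def source {d : ℕ} {K : ℝ≥0} {σ : ℝ → ℝ} (hσ : LipschitzWith K σ) (hσ0 : σ 0 = 0)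
    (f : EuclideanSpace ℝ (Fin d) → ℝ) (M : State d) : State d :=
  WithLp.toLp 2 (0, -mulL2 f (toL2 M.fst) + hσ.compLp hσ0 (toL2 M.fst))

/-- `M = (m, ∂_t m) ∈ C([0,T]; H¹_ω × L²_ω)` is a mild solution on `[0,T]` of
`∂_t² m - Δm + 2x·∇m + θ m = σ(m)` with initial state `M₀`. -/
structure IsMildSolution {d : ℕ} {K : ℝ≥0} {σ : ℝ → ℝ} (hσ : LipschitzWith K σ) (hσ0 : σ 0 = 0)
    (θ : EuclideanSpace ℝ (Fin d) → ℝ → ℝ) (T : ℝ) (M₀ : State d) (M : ℝ → State d) : Prop where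
  continuousOn : ContinuousOn M (Icc 0 T)
  /-- the second component is the time derivative, in `L²_ω`, of the first -/
  hasDeriv : ∀ t ∈ Icc 0 T,
    HasDerivWithinAt (fun s => toL2 (M s).fst) (M t).snd (Icc 0 T) t
  integrable : ∀ t ∈ Icc 0 T, IntervalIntegrable
    (fun s => freeEvolution (t - s) (source hσ hσ0 (fun x => θ x s) (M s))) volume 0 t
  duhamel : ∀ t ∈ Icc 0 T, M t = freeEvolution t M₀
    + ∫ s in (0 : ℝ)..t, freeEvolution (t - s) (source hσ hσ0 (fun x => θ x s) (M s))

end GaussianWave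

end

/-!
The control acts through two kinds of motion, and alternating them reaches everything.

*Impulses.* Let `f` be bounded. The control `θ = -f/τ` on a time interval of length `τ → 0` leaves
the position `m` unchanged in the limit, because the position is differentiable in time with
derivative the velocity, and adds `f m` to the velocity; the nonlinearity `σ(m)` and the free
evolution have no time to act (`WaveGroup.norm_impulse_le`, `reach_impulse`). If `m` vanishes almost
nowhere, the products `f m` are dense in `L²_ω`, so that the velocity can be changed at will
(`reach_velocity`). A nonzero finite Hermite sum is a nonzero polynomial and so vanishes almost
nowhere (`ae_sumL2_ne_zero`).

*Free drift.* If a free trajectory stays in the span of finitely many `ψ_n`, then its position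
`m(x, t)` is a continuous function, and `θ = σ(m)/m` is a control bounded by the Lipschitz constant
of `σ` that cancels the nonlinearity. The free trajectory is then an exact solution (`reach_free`).

Given two nonzero finite Hermite sums with coefficients `a_n`, `a'_n`, and a time `τ` so short that
`sin(√ρ_n τ)/√ρ_n` vanishes for none of the finitely many frequencies, the velocity with
coefficients `(a'_n - a_n cos(√ρ_n τ)) / (sin(√ρ_n τ)/√ρ_n)` makes the free evolution lead from one
position exactly to the other. So an impulse, a free drift and a second impulse steer, in
arbitrarily short time, between any two states whose positions are nonzero finite Hermite sums
(`reach_sum`). These positions are dense in `H¹_ω` (`exists_span_near`), and the state `(ψ_0, 0)` is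
at rest for the free drift, so that any remaining time can be spent there (`reach_of_position`). If
the initial position is `0`, a short free drift makes it nonzero (`reach_of_velocity`).

The steps are only approximate, but the flow of a bounded control is Lipschitz in the initial
state, by Grönwall's inequality; the controls are therefore chosen from the last to the first, each
with a tolerance that depends on the later ones (`Reach.trans`).

The free evolution is a strongly continuous group on `H¹_ω × L²_ω` because the Hermite functions
form Hilbert bases of `L²_ω` and, up to normalization, of `H¹_ω`. Orthogonality is integration by
parts (`HasWeakPartial.integral_mul_prodPoly`), and completeness is the uniqueness theorem for
Laplace transforms (`eq_zero_of_inner_polyL2_hermite`). The Cauchy problem is solved by Picard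
iteration (`WaveGroup.exists_mildSol`).
-/

namespace GaussianWave

/-! ### Integration by parts in `L²_ω` -/

instance gaussW_isFiniteMeasure (d : ℕ) : IsFiniteMeasure (gaussW d) := by
  have h := memLp_prodPoly (d := d) fun _ => 1
  have h1 : prodPoly (d := d) (fun _ => 1) = fun _ => (1 : ℝ) := by
    ext x; simp [prodPoly]
  rw [h1, memLp_const_iff (by simp) (by simp)] at h
  exact ⟨h.resolve_left one_ne_zero⟩

lemma gaussW_ac_volume (d : ℕ) :
    gaussW d ≪ (volume : Measure (EuclideanSpace ℝ (Fin d))) :=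
  withDensity_absolutelyContinuous _ _

lemma hasFDerivAt_gauss {d : ℕ} (x : EuclideanSpace ℝ (Fin d)) :
    HasFDerivAt (fun y : EuclideanSpace ℝ (Fin d) => Real.exp (-‖y‖ ^ 2))
      (Real.exp (-‖x‖ ^ 2) • (-(2 • innerSL ℝ x) : EuclideanSpace ℝ (Fin d) →L[ℝ] ℝ)) x :=
  ((hasStrictFDerivAt_norm_sq x).hasFDerivAt.neg).exp

lemma contDiff_prodPoly {d : ℕ} (p : Fin d → Polynomial ℝ) : ContDiff ℝ ∞ (prodPoly p) := by
  unfold prodPoly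
  refine contDiff_prod fun j _ => ?_
  have h : ContDiff ℝ ∞ fun y : ℝ => (p j).eval y := by
    simpa using (p j).contDiff_aeval (𝕜 := ℝ) ∞
  exact h.comp (EuclideanSpace.proj j : EuclideanSpace ℝ (Fin d) →L[ℝ] ℝ).contDiff

lemma prodPoly_update_mul {d : ℕ} (p : Fin d → Polynomial ℝ) (i : Fin d) (q : Polynomial ℝ)
    (x : EuclideanSpace ℝ (Fin d)) :
    prodPoly (Function.update p i q) x
      = q.eval (x i) * ∏ j ∈ Finset.univ.erase i, (p j).eval (x j) := by
  rw [prodPoly, ← Finset.mul_prod_erase _ _ (Finset.mem_univ i), Function.update_self]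
  congr 1
  refine Finset.prod_congr rfl fun j hj => ?_
  rw [Function.update_of_ne (Finset.ne_of_mem_erase hj)]

/-- The polynomial factor `2x_i - ∂_i` applied to a product of one-variable polynomials. -/
lemma prodPoly_raise {d : ℕ} (p : Fin d → Polynomial ℝ) (i : Fin d)
    (x : EuclideanSpace ℝ (Fin d)) :
    prodPoly (Function.update p i (2 * Polynomial.X * p i - (p i).derivative)) x
      = 2 * x i * prodPoly p x - prodPoly (Function.update p i (p i).derivative) x := by
  have h : prodPoly p x = prodPoly (Function.update p i (p i)) x := by
    rw [Function.update_eq_self]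
  rw [h]
  simp only [prodPoly_update_mul, Polynomial.eval_sub, Polynomial.eval_mul, Polynomial.eval_X,
    Polynomial.eval_ofNat]
  ring

lemma integrable_L2w_mul {d : ℕ} (u : L2w d) {f : EuclideanSpace ℝ (Fin d) → ℝ}
    (hf : MemLp f 2 (gaussW d)) : Integrable (fun x => u x * f x) (gaussW d) :=
  MemLp.integrable_mul (Lp.memLp u) hf

lemma fderiv_cutoff {d : ℕ} {χ : EuclideanSpace ℝ (Fin d) → ℝ} (hχ : ContDiff ℝ ∞ χ)
    (p : Fin d → Polynomial ℝ) (i : Fin d) (c : ℝ) (x : EuclideanSpace ℝ (Fin d)) :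
    fderiv ℝ (fun y => χ (c • y) * (prodPoly p y * Real.exp (-‖y‖ ^ 2))) x
        (EuclideanSpace.single i 1)
      = Real.exp (-‖x‖ ^ 2) * (c * fderiv ℝ χ (c • x) (EuclideanSpace.single i 1) * prodPoly p x
        - χ (c • x)
          * prodPoly (Function.update p i (2 * Polynomial.X * p i - (p i).derivative)) x) := by
  have h1 : HasFDerivAt (fun y => χ (c • y))
      ((fderiv ℝ χ (c • x)).comp (c • ContinuousLinearMap.id ℝ _)) x :=
    ((hχ.differentiable (by simp)).differentiableAt.hasFDerivAt).comp x
      ((hasFDerivAt_id x).const_smul c)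
  have h2 := (hasFDerivAt_prodPoly p x).differentiableAt.hasFDerivAt
  have h := (h1.mul (h2.mul (hasFDerivAt_gauss x))).fderiv
  rw [show (fun y => χ (c • y) * (prodPoly p y * Real.exp (-‖y‖ ^ 2)))
    = (fun y => χ (c • y)) * (prodPoly p * fun y => Real.exp (-‖y‖ ^ 2)) from rfl, h,
    prodPoly_raise, ← fderiv_prodPoly]
  have hi : inner ℝ x (EuclideanSpace.single i (1 : ℝ)) = x i := by
    simp [EuclideanSpace.inner_single_right]
  simp [hi]
  ring

/-- Integration by parts against a polynomial: the adjoint of `∂_i` in `L²_ω` is `2x_i - ∂_i`. The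
polynomial times the weight is not compactly supported, so it is cut off by a dilated bump
function and the dilation parameter is sent to infinity. -/
lemma HasWeakPartial.integral_mul_prodPoly {d : ℕ} {i : Fin d} {u g : L2w d}
    (h : HasWeakPartial i u g) (p : Fin d → Polynomial ℝ) :
    ∫ x, g x * prodPoly p x ∂(gaussW d) = ∫ x, u x * prodPoly (Function.update p i
      (2 * Polynomial.X * p i - (p i).derivative)) x ∂(gaussW d) := by
  set P' := Function.update p i (2 * Polynomial.X * p i - (p i).derivative) with hP'
  let χ : ContDiffBump (0 : EuclideanSpace ℝ (Fin d)) := default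
  have hχ : ContDiff ℝ ∞ χ := χ.contDiff
  have hχ0 : χ 0 = 1 := χ.one_of_mem_closedBall (by simpa using χ.rIn_pos.le)
  set v : EuclideanSpace ℝ (Fin d) := EuclideanSpace.single i 1 with hv
  obtain ⟨C, hC⟩ := (compactSupport_testDeriv χ.hasCompactSupport v).exists_bound_of_continuous
    (continuous_testDeriv hχ v)
  let c : ℕ → ℝ := fun k => 1 / ((k : ℝ) + 1)
  have hc0 : ∀ k, 0 < c k := fun k => Nat.one_div_pos_of_nat
  have hc1 : ∀ k, c k ≤ 1 := fun k => by
    have : (0 : ℝ) ≤ k := k.cast_nonneg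
    exact (div_le_one (by positivity)).2 (by linarith)
  have hclim : Tendsto c atTop (𝓝 0) := tendsto_one_div_add_atTop_nhds_zero_nat
  have hcx : ∀ x : EuclideanSpace ℝ (Fin d), Tendsto (fun k => c k • x) atTop (𝓝 0) := fun x => by
    simpa using hclim.smul_const x
  have key : ∀ k, ∫ x, u x * (c k * fderiv ℝ χ (c k • x) v * prodPoly p x
      - χ (c k • x) * prodPoly P' x) ∂(gaussW d)
      = - ∫ x, g x * (χ (c k • x) * prodPoly p x) ∂(gaussW d) := by
    intro k
    have hφ : ContDiff ℝ ∞ fun y => χ (c k • y) * (prodPoly p y * Real.exp (-‖y‖ ^ 2)) := by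
      refine (hχ.comp (contDiff_const_smul _)).mul ((contDiff_prodPoly p).mul ?_)
      exact ((contDiff_norm_sq ℝ).neg).exp
    have hs : HasCompactSupport fun y => χ (c k • y) * (prodPoly p y * Real.exp (-‖y‖ ^ 2)) :=
      (χ.hasCompactSupport.comp_smul (hc0 k).ne').mul_right
    have := h _ hφ hs
    rw [integral_gaussW, integral_gaussW]
    convert this using 2
    · ext x
      rw [fderiv_cutoff hχ]
      ring
    · congr 1
      ext x
      ring
  have L1 : Tendsto (fun k => ∫ x, g x * (χ (c k • x) * prodPoly p x) ∂(gaussW d)) atTop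
      (𝓝 (∫ x, g x * prodPoly p x ∂(gaussW d))) := by
    refine tendsto_integral_of_dominated_convergence (fun x => ‖g x * prodPoly p x‖) (fun k => ?_)
      (integrable_L2w_mul g (memLp_prodPoly p)).norm (fun k => ae_of_all _ fun x => ?_)
      (ae_of_all _ fun x => ?_)
    · exact (Lp.aestronglyMeasurable g).mul (((χ.continuous.comp (continuous_const_smul _)).mul
        (continuous_prodPoly p)).aestronglyMeasurable)
    · rw [mul_left_comm, norm_mul]
      refine mul_le_of_le_one_left (norm_nonneg _) ?_
      rw [Real.norm_of_nonneg χ.nonneg]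
      exact χ.le_one
    · have := (χ.continuous.tendsto 0).comp (hcx x)
      rw [hχ0] at this
      simpa using (this.mul_const (prodPoly p x)).const_mul (g x)
  have L2 : Tendsto (fun k => ∫ x, u x * (c k * fderiv ℝ χ (c k • x) v * prodPoly p x
      - χ (c k • x) * prodPoly P' x) ∂(gaussW d)) atTop
      (𝓝 (∫ x, u x * (-prodPoly P' x) ∂(gaussW d))) := by
    refine tendsto_integral_of_dominated_convergence
      (fun x => C * ‖u x * prodPoly p x‖ + ‖u x * prodPoly P' x‖) (fun k => ?_)
      (((integrable_L2w_mul u (memLp_prodPoly p)).norm.const_mul C).add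
        (integrable_L2w_mul u (memLp_prodPoly P')).norm) (fun k => ae_of_all _ fun x => ?_)
      (ae_of_all _ fun x => ?_)
    · refine (Lp.aestronglyMeasurable u).mul (Continuous.aestronglyMeasurable ?_)
      exact ((continuous_const.mul ((continuous_testDeriv hχ v).comp
        (continuous_const_smul _))).mul (continuous_prodPoly p)).sub
        ((χ.continuous.comp (continuous_const_smul _)).mul (continuous_prodPoly P'))
    · rw [mul_sub]
      refine (norm_sub_le _ _).trans (add_le_add ?_ ?_)
      · rw [show u x * (c k * fderiv ℝ χ (c k • x) v * prodPoly p x)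
          = (c k * fderiv ℝ χ (c k • x) v) * (u x * prodPoly p x) by ring, norm_mul]
        refine mul_le_mul_of_nonneg_right ?_ (norm_nonneg _)
        rw [norm_mul, Real.norm_of_nonneg (hc0 k).le]
        exact (mul_le_of_le_one_left (norm_nonneg _) (hc1 k)).trans (hC _)
      · rw [mul_left_comm, norm_mul]
        refine mul_le_of_le_one_left (norm_nonneg _) ?_
        rw [Real.norm_of_nonneg χ.nonneg]
        exact χ.le_one
    · have t1 := (χ.continuous.tendsto 0).comp (hcx x)
      have t2 := ((continuous_testDeriv hχ v).tendsto 0).comp (hcx x)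
      rw [hχ0] at t1
      have := (((hclim.mul t2).mul_const (prodPoly p x)).sub
        (t1.mul_const (prodPoly P' x))).const_mul (u x)
      simpa using this
  simp only [key] at L2
  have := tendsto_nhds_unique L2 L1.neg
  simp only [mul_neg, integral_neg] at this
  linarith

/-! ### Hermite polynomials -/

/-- The lowering relation `H_{n+1}' = 2(n+1) H_n`. -/
lemma derivative_hermitePoly_succ (n : ℕ) :
    (hermitePoly (n + 1)).derivative = (2 * (n + 1) : ℝ) • hermitePoly n := by
  induction n with
  | zero => simp [hermitePoly, Polynomial.smul_eq_C_mul, ← Polynomial.C_ofNat]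
  | succ n ih =>
    rw [hermitePoly, Polynomial.derivative_sub, ih]
    simp only [Polynomial.derivative_mul, Polynomial.derivative_smul, ih,
      Polynomial.derivative_ofNat, Polynomial.derivative_X]
    rw [hermitePoly]
    simp only [Polynomial.smul_eq_C_mul, map_mul, map_add, map_one, map_natCast, map_ofNat]
    push_cast
    ring

/-- The Hermite polynomials are eigenfunctions of `(2x - d/dx) ∘ d/dx`. -/
lemma hermitePoly_ode (n : ℕ) :
    2 * Polynomial.X * (hermitePoly n).derivative - (hermitePoly n).derivative.derivative
      = (2 * n : ℝ) • hermitePoly n := by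
  cases n with
  | zero => simp [hermitePoly]
  | succ n =>
    rw [derivative_hermitePoly_succ, Polynomial.derivative_smul, hermitePoly]
    simp only [Polynomial.smul_eq_C_mul, map_mul, map_add, map_one, map_natCast, map_ofNat]
    push_cast
    ring

lemma natDegree_hermitePoly_le (n : ℕ) : (hermitePoly n).natDegree ≤ n := by
  induction n with
  | zero => simp [hermitePoly]
  | succ n ih =>
    have h2 : (2 : Polynomial ℝ) = Polynomial.C 2 := rfl
    rw [hermitePoly]
    refine (Polynomial.natDegree_sub_le_of_le (m := n + 1) (n := n + 1) ?_ ?_).trans (by simp)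
    · rw [mul_assoc, h2]
      refine (Polynomial.natDegree_C_mul_le _ _).trans ?_
      refine Polynomial.natDegree_mul_le.trans ?_
      rw [Polynomial.natDegree_X]; omega
    · exact (Polynomial.natDegree_derivative_le _).trans (by omega)

lemma coeff_hermitePoly (n : ℕ) : (hermitePoly n).coeff n = 2 ^ n := by
  induction n with
  | zero => simp [hermitePoly]
  | succ n ih =>
    have h2 : (2 : Polynomial ℝ) = Polynomial.C 2 := rfl
    rw [hermitePoly, Polynomial.coeff_sub, mul_assoc, h2, Polynomial.coeff_C_mul,
      Polynomial.coeff_X_mul, ih, Polynomial.coeff_eq_zero_of_natDegree_lt]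
    · ring
    · exact lt_of_le_of_lt ((Polynomial.natDegree_derivative_le _).trans
        (Nat.sub_le_sub_right (natDegree_hermitePoly_le n) 1)) (by omega)

/-- The Hermite polynomials as a sequence with one member in each degree. -/
noncomputable def hermiteSequence : Polynomial.Sequence ℝ where
  elems' := hermitePoly
  degree_eq' n := by
    have h : (hermitePoly n).coeff n ≠ 0 := by rw [coeff_hermitePoly]; positivity
    exact le_antisymm (Polynomial.degree_le_of_natDegree_le (natDegree_hermitePoly_le n))
      (Polynomial.le_degree_of_ne_zero h)

lemma hermitePoly_ne_zero (n : ℕ) : hermitePoly n ≠ 0 := hermiteSequence.ne_zero n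

/-- The Hermite polynomials as a basis of `ℝ[X]`. -/
noncomputable def hermiteBasis : Module.Basis ℕ ℝ (Polynomial ℝ) :=
  hermiteSequence.basis fun n =>
    (Polynomial.leadingCoeff_ne_zero.2 (hermiteSequence.ne_zero n)).isUnit

lemma hermiteBasis_apply (n : ℕ) : hermiteBasis n = hermitePoly n :=
  hermiteSequence.basis_eq_self _ n

/-- The element of `L²_ω` given by a product of one-variable polynomials. -/
noncomputable def polyL2 {d : ℕ} (p : Fin d → Polynomial ℝ) : L2w d := (memLp_prodPoly p).toLp _

lemma coeFn_polyL2 {d : ℕ} (p : Fin d → Polynomial ℝ) : polyL2 p =ᵐ[gaussW d] prodPoly p :=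
  (memLp_prodPoly p).coeFn_toLp

lemma inner_polyL2 {d : ℕ} (u : L2w d) (p : Fin d → Polynomial ℝ) :
    inner ℝ u (polyL2 p) = ∫ x, u x * prodPoly p x ∂(gaussW d) := by
  rw [L2.inner_def]
  refine integral_congr_ae ?_
  filter_upwards [coeFn_polyL2 p] with x hx
  rw [hx, Real.inner_apply]

lemma polyL2_update_smul {d : ℕ} (p : Fin d → Polynomial ℝ) (i : Fin d) (c : ℝ)
    (q : Polynomial ℝ) :
    polyL2 (Function.update p i (c • q)) = c • polyL2 (Function.update p i q) := by
  refine Lp.ext ?_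
  filter_upwards [coeFn_polyL2 (Function.update p i (c • q)), coeFn_polyL2 (Function.update p i q),
    Lp.coeFn_smul c (polyL2 (Function.update p i q))] with x h1 h2 h3
  rw [h1, h3, Pi.smul_apply, h2, prodPoly_update_mul, prodPoly_update_mul]
  simp [mul_assoc]

lemma polyL2_update_add {d : ℕ} (p : Fin d → Polynomial ℝ) (i : Fin d)
    (q r : Polynomial ℝ) :
    polyL2 (Function.update p i (q + r))
      = polyL2 (Function.update p i q) + polyL2 (Function.update p i r) := by
  refine Lp.ext ?_
  filter_upwards [coeFn_polyL2 (Function.update p i (q + r)), coeFn_polyL2 (Function.update p i q),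
    coeFn_polyL2 (Function.update p i r),
    Lp.coeFn_add (polyL2 (Function.update p i q)) (polyL2 (Function.update p i r))]
    with x h1 h2 h3 h4
  rw [h1, h4, Pi.add_apply, h2, h3]
  simp only [prodPoly_update_mul, Polynomial.eval_add, add_mul]

lemma HasWeakPartial.inner_polyL2 {d : ℕ} {i : Fin d} {u g : L2w d}
    (h : HasWeakPartial i u g) (p : Fin d → Polynomial ℝ) :
    inner ℝ g (polyL2 p) = inner ℝ u (polyL2 (Function.update p i
      (2 * Polynomial.X * p i - (p i).derivative))) := by
  rw [GaussianWave.inner_polyL2, GaussianWave.inner_polyL2, h.integral_mul_prodPoly]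

lemma HasWeakPartial.inner_deriv_hermite {d : ℕ} {i : Fin d} {u g : L2w d}
    (h : HasWeakPartial i u g) (n : Fin d → ℕ) :
    inner ℝ g (polyL2 (Function.update (fun j => hermitePoly (n j)) i
      (hermitePoly (n i)).derivative))
      = 2 * n i * inner ℝ u (polyL2 fun j => hermitePoly (n j)) := by
  rw [h.inner_polyL2, Function.update_idem, Function.update_self, hermitePoly_ode,
    polyL2_update_smul, inner_smul_right, Function.update_eq_self]

/-- Both `2 m_i ⟨H_n, H_m⟩` and `2 n_i ⟨H_n, H_m⟩` are equal to `⟨∂_i H_n, ∂_i H_m⟩`. -/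
lemma polyL2_hermite_orthogonal {d : ℕ} {n m : Fin d → ℕ} (hnm : n ≠ m) :
    inner ℝ (polyL2 fun j => hermitePoly (n j)) (polyL2 fun j => hermitePoly (m j)) = 0 := by
  obtain ⟨i, hi⟩ := Function.ne_iff.1 hnm
  have h1 := (hasWeakPartial_prodPoly (fun j => hermitePoly (n j)) i).inner_deriv_hermite m
  have h2 := (hasWeakPartial_prodPoly (fun j => hermitePoly (m j)) i).inner_deriv_hermite n
  rw [real_inner_comm] at h1
  have h3 := h1.symm.trans h2
  change 2 * (m i : ℝ) * inner ℝ (polyL2 fun j => hermitePoly (n j)) _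
    = 2 * (n i : ℝ) * inner ℝ (polyL2 fun j => hermitePoly (m j)) _ at h3
  rw [real_inner_comm (polyL2 fun j => hermitePoly (n j)) (polyL2 fun j => hermitePoly (m j))] at h3
  have h4 : ((m i : ℝ) - n i) * inner ℝ (polyL2 fun j => hermitePoly (n j))
    (polyL2 fun j => hermitePoly (m j)) = 0 := by linarith
  refine (mul_eq_zero.1 h4).resolve_left ?_
  exact sub_ne_zero.2 (by exact_mod_cast (Ne.symm hi))

/-! ### Completeness of the Hermite polynomials -/

/-- `polyL2` as a multilinear map. -/
noncomputable def polyL2Multilinear (d : ℕ) :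
    MultilinearMap ℝ (fun _ : Fin d => Polynomial ℝ) (L2w d) where
  toFun := polyL2
  map_update_add' p i q r := by
    convert polyL2_update_add p i q r
  map_update_smul' p i c q := by
    convert polyL2_update_smul p i c q

/-- Orthogonality to the products of Hermite polynomials extends to all products of polynomials,
by multilinearity. -/
lemma inner_polyL2_eq_zero {d : ℕ} {u : L2w d}
    (h : ∀ n : Fin d → ℕ, inner ℝ u (polyL2 fun j => hermitePoly (n j)) = 0)
    (p : Fin d → Polynomial ℝ) : inner ℝ u (polyL2 p) = 0 := by
  have : (innerSL ℝ u).toLinearMap.compMultilinearMap (polyL2Multilinear d) = 0 := by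
    refine Module.Basis.ext_multilinear (fun _ => hermiteBasis) fun n => ?_
    simp only [hermiteBasis_apply]
    exact h n
  exact DFunLike.congr_fun this p

lemma integrable_exp_neg_half_norm_sq (d : ℕ) :
    Integrable fun x : EuclideanSpace ℝ (Fin d) => Real.exp (-(1 / 2) * ‖x‖ ^ 2) := by
  have h := (GaussianFourier.integrable_cexp_neg_mul_sq_norm_add
    (V := EuclideanSpace ℝ (Fin d)) (b := (1 / 2 : ℂ)) (by norm_num) 0 0).norm
  refine h.congr (ae_of_all _ fun x => ?_)
  simp only [Complex.norm_exp]
  congr 1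
  simp [← Complex.ofReal_pow]

lemma memLp_exp_quarter (d : ℕ) :
    MemLp (fun x : EuclideanSpace ℝ (Fin d) => Real.exp (‖x‖ ^ 2 / 4)) 2 (gaussW d) := by
  rw [memLp_two_iff_integrable_sq (Continuous.aestronglyMeasurable (by fun_prop)), gaussW,
    integrable_withDensity_iff_integrable_smul' (measurable_dens d)
      (ae_of_all _ fun x => ENNReal.ofReal_lt_top)]
  refine (integrable_exp_neg_half_norm_sq d).congr (ae_of_all _ fun x => ?_)
  beta_reduce
  rw [ENNReal.toReal_ofReal (Real.exp_pos _).le, smul_eq_mul, ← Real.exp_nat_mul, ← Real.exp_add]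
  congr 1
  push_cast
  ring

/-- The Taylor polynomial of degree `< N` of `x ↦ e^{a x}`. -/
noncomputable def expPoly (a : ℝ) (N : ℕ) : Polynomial ℝ :=
  ∑ k ∈ Finset.range N, Polynomial.C (a ^ k / k.factorial) * Polynomial.X ^ k

lemma eval_expPoly (a : ℝ) (N : ℕ) (x : ℝ) :
    (expPoly a N).eval x = ∑ k ∈ Finset.range N, (a * x) ^ k / k.factorial := by
  rw [expPoly, Polynomial.eval_finsetSum]
  refine Finset.sum_congr rfl fun k _ => ?_
  simp
  ring

lemma tendsto_eval_expPoly (a x : ℝ) :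
    Tendsto (fun N => (expPoly a N).eval x) atTop (𝓝 (Real.exp (a * x))) := by
  simp only [eval_expPoly]
  rw [Real.exp_eq_exp_ℝ]
  exact (NormedSpace.expSeries_div_hasSum_exp (a * x)).tendsto_sum_nat

/-- A bound that is uniform in the degree; `e^{x²/4}` is chosen as it is still in `L²_ω`. -/
lemma abs_eval_expPoly_le (a : ℝ) (N : ℕ) (x : ℝ) :
    |(expPoly a N).eval x| ≤ Real.exp (a ^ 2 + x ^ 2 / 4) := by
  rw [eval_expPoly]
  refine (Finset.abs_sum_le_sum_abs _ _).trans ?_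
  have h : ∀ k : ℕ, |(a * x) ^ k / k.factorial| = |a * x| ^ k / k.factorial := fun k => by
    rw [abs_div, abs_pow, Nat.abs_cast]
  simp only [h]
  refine (Real.sum_le_exp_of_nonneg (abs_nonneg _) N).trans (Real.exp_le_exp.2 ?_)
  exact abs_le.2 ⟨by nlinarith [sq_nonneg (a + x / 2)], by nlinarith [sq_nonneg (a - x / 2)]⟩

lemma prod_exp_coord {d : ℕ} (t x : EuclideanSpace ℝ (Fin d)) :
    ∏ j, Real.exp (t j * x j) = Real.exp (inner ℝ t x) := by
  rw [← Real.exp_sum, PiLp.inner_apply]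
  simp [mul_comm]

lemma exp_inner_le {d : ℕ} (t x : EuclideanSpace ℝ (Fin d)) :
    Real.exp (inner ℝ t x) ≤ Real.exp (‖t‖ ^ 2) * Real.exp (‖x‖ ^ 2 / 4) := by
  rw [← Real.exp_add]
  refine Real.exp_le_exp.2 ((real_inner_le_norm t x).trans ?_)
  nlinarith [sq_nonneg (‖t‖ - ‖x‖ / 2)]

lemma integrable_L2w_mul_exp_inner {d : ℕ} (u : L2w d) (t : EuclideanSpace ℝ (Fin d)) :
    Integrable (fun x => u x * Real.exp (inner ℝ t x)) (gaussW d) := by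
  refine integrable_L2w_mul u (MemLp.mono' ((memLp_exp_quarter d).const_mul (Real.exp (‖t‖ ^ 2)))
    (Continuous.aestronglyMeasurable (by fun_prop)) (ae_of_all _ fun x => ?_))
  rw [Real.norm_of_nonneg (Real.exp_pos _).le]
  exact exp_inner_le t x

/-- A function orthogonal to all polynomials is orthogonal to all exponentials, as the Taylor
polynomials of `e^{⟨t, x⟩}`, taken coordinate by coordinate, are dominated in `L²_ω`. -/
lemma integral_mul_exp_inner_eq_zero {d : ℕ} {u : L2w d}
    (h : ∀ p : Fin d → Polynomial ℝ, inner ℝ u (polyL2 p) = 0) (t : EuclideanSpace ℝ (Fin d)) :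
    ∫ x, u x * Real.exp (inner ℝ t x) ∂(gaussW d) = 0 := by
  have L : Tendsto (fun N => ∫ x, u x * prodPoly (fun j => expPoly (t j) N) x ∂(gaussW d)) atTop
      (𝓝 (∫ x, u x * Real.exp (inner ℝ t x) ∂(gaussW d))) := by
    refine tendsto_integral_of_dominated_convergence
      (fun x => ‖u x * (Real.exp (‖t‖ ^ 2) * Real.exp (‖x‖ ^ 2 / 4))‖) (fun N => ?_)
      (integrable_L2w_mul u ((memLp_exp_quarter d).const_mul (Real.exp (‖t‖ ^ 2)))).norm
      (fun N => ae_of_all _ fun x => ?_) (ae_of_all _ fun x => ?_)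
    · exact (Lp.aestronglyMeasurable u).mul (continuous_prodPoly _).aestronglyMeasurable
    · rw [norm_mul, norm_mul]
      refine mul_le_mul_of_nonneg_left ?_ (norm_nonneg _)
      rw [← Real.exp_add, Real.norm_of_nonneg (Real.exp_pos _).le, prodPoly, Real.norm_eq_abs,
        Finset.abs_prod]
      refine (Finset.prod_le_prod (fun _ _ => abs_nonneg _)
        fun j _ => abs_eval_expPoly_le (t j) N (x j)).trans (le_of_eq ?_)
      rw [← Real.exp_sum, Finset.sum_add_distrib, ← Finset.sum_div]
      simp only [EuclideanSpace.norm_sq_eq, Real.norm_eq_abs, sq_abs]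
    · rw [← prod_exp_coord]
      exact (tendsto_finsetProd _ fun j _ => tendsto_eval_expPoly (t j) (x j)).const_mul _
  simp only [← inner_polyL2, h] at L
  exact (tendsto_nhds_unique L tendsto_const_nhds)

lemma integral_withDensity_ofReal {d : ℕ} {f : EuclideanSpace ℝ (Fin d) → ℝ} (hf : Measurable f)
    (g : EuclideanSpace ℝ (Fin d) → ℝ) :
    ∫ x, g x ∂((gaussW d).withDensity fun x => ENNReal.ofReal (f x))
      = ∫ x, max (f x) 0 * g x ∂(gaussW d) := by
  rw [integral_withDensity_eq_integral_toReal_smul hf.ennreal_ofReal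
    (ae_of_all _ fun x => ENNReal.ofReal_lt_top)]
  simp only [ENNReal.toReal_ofReal', smul_eq_mul]

lemma integrable_max_zero_mul {d : ℕ} {f : EuclideanSpace ℝ (Fin d) → ℝ} (hf : Measurable f)
    {g : EuclideanSpace ℝ (Fin d) → ℝ} (hg : Measurable g)
    (h : Integrable (fun x => f x * g x) (gaussW d)) :
    Integrable (fun x => max (f x) 0 * g x) (gaussW d) := by
  refine h.mono ((hf.max measurable_const).mul hg).aestronglyMeasurable (ae_of_all _ fun x => ?_)
  rw [norm_mul, norm_mul]
  refine mul_le_mul_of_nonneg_right ?_ (norm_nonneg _)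
  rw [Real.norm_eq_abs, abs_of_nonneg (le_max_right _ _)]
  exact max_le (le_abs_self _) (abs_nonneg _)

lemma integrable_withDensity_ofReal {d : ℕ} {f : EuclideanSpace ℝ (Fin d) → ℝ}
    (hf : Measurable f) {g : EuclideanSpace ℝ (Fin d) → ℝ} (hg : Measurable g)
    (h : Integrable (fun x => f x * g x) (gaussW d)) :
    Integrable g ((gaussW d).withDensity fun x => ENNReal.ofReal (f x)) := by
  rw [integrable_withDensity_iff_integrable_smul' hf.ennreal_ofReal
    (ae_of_all _ fun x => ENNReal.ofReal_lt_top)]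
  simp only [ENNReal.toReal_ofReal', smul_eq_mul]
  exact integrable_max_zero_mul hf hg h

/-- The products of Hermite polynomials are total in `L²_ω`. If `u` is orthogonal to them, then
the positive and negative parts of `u` are densities of finite measures with the same Laplace
transform, hence, by analytic continuation, with the same characteristic function. -/
theorem eq_zero_of_inner_polyL2_hermite {d : ℕ} {u : L2w d}
    (h : ∀ n : Fin d → ℕ, inner ℝ u (polyL2 fun j => hermitePoly (n j)) = 0) : u = 0 := by
  have hexp := integral_mul_exp_inner_eq_zero (inner_polyL2_eq_zero h)
  obtain ⟨f, hfm, hfu⟩ := (Lp.aestronglyMeasurable u).aemeasurable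
  have hint : ∀ t, Integrable (fun x => f x * Real.exp (inner ℝ t x)) (gaussW d) := fun t =>
    (integrable_L2w_mul_exp_inner u t).congr (by filter_upwards [hfu] with x hx; rw [hx])
  have hfm' : Measurable fun x => -f x := hfm.neg
  have hint' : ∀ t, Integrable (fun x => -f x * Real.exp (inner ℝ t x)) (gaussW d) := fun t =>
    (hint t).neg.congr (ae_of_all _ fun x => by simp)
  have hzero : ∀ t, ∫ x, f x * Real.exp (inner ℝ t x) ∂(gaussW d) = 0 := fun t => by
    rw [← hexp t]
    exact integral_congr_ae (by filter_upwards [hfu] with x hx; rw [hx])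
  set μ := (gaussW d).withDensity fun x => ENNReal.ofReal (f x) with hμ
  set ν := (gaussW d).withDensity fun x => ENNReal.ofReal (-f x) with hν
  have hfi : Integrable f (gaussW d) := by simpa using hint 0
  have : IsFiniteMeasure μ := isFiniteMeasure_withDensity_ofReal hfi.2
  have : IsFiniteMeasure ν := isFiniteMeasure_withDensity_ofReal hfi.neg.2
  have iμ : ∀ t : EuclideanSpace ℝ (Fin d), Integrable (fun x => Real.exp (inner ℝ t x)) μ :=
    fun t => integrable_withDensity_ofReal hfm (by fun_prop) (hint t)
  have iν : ∀ t : EuclideanSpace ℝ (Fin d), Integrable (fun x => Real.exp (inner ℝ t x)) ν :=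
    fun t => integrable_withDensity_ofReal hfm' (by fun_prop) (hint' t)
  have hlap : ∀ t, ∫ x, Real.exp (inner ℝ t x) ∂μ = ∫ x, Real.exp (inner ℝ t x) ∂ν := by
    intro t
    have e1 : ∀ x, max (f x) 0 * Real.exp (inner ℝ t x) - max (-f x) 0 * Real.exp (inner ℝ t x)
        = f x * Real.exp (inner ℝ t x) := fun x => by
      rw [← sub_mul]
      congr 1
      rcases le_total 0 (f x) with h0 | h0
      · rw [max_eq_left h0, max_eq_right (by linarith)]; ring
      · rw [max_eq_right h0, max_eq_left (by linarith)]; ring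
    rw [hμ, hν, integral_withDensity_ofReal hfm, integral_withDensity_ofReal hfm',
      ← sub_eq_zero, ← integral_sub]
    · exact (integral_congr_ae (ae_of_all _ e1)).trans (hzero t)
    · exact integrable_max_zero_mul hfm (by fun_prop) (hint t)
    · exact integrable_max_zero_mul hfm' (by fun_prop) (hint' t)
  have hμν : μ = ν := by
    refine Measure.ext_of_charFun (funext fun t => ?_)
    let X : EuclideanSpace ℝ (Fin d) → ℝ := fun x => inner ℝ t x
    have hmgf : ProbabilityTheory.mgf X μ = ProbabilityTheory.mgf X ν := by
      ext s
      simpa [ProbabilityTheory.mgf, X, inner_smul_left] using hlap (s • t)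
    have h0 : μ = 0 ↔ ν = 0 := by
      have := hlap 0
      simp only [inner_zero_left, Real.exp_zero, integral_const, smul_eq_mul, mul_one] at this
      rw [← Measure.measure_univ_eq_zero, ← Measure.measure_univ_eq_zero (μ := ν),
        ← measureReal_eq_zero_iff, ← measureReal_eq_zero_iff, this]
    have hset : ProbabilityTheory.integrableExpSet X μ = univ := by
      refine eq_univ_of_forall fun s => ?_
      simpa [ProbabilityTheory.integrableExpSet, X, inner_smul_left] using iμ (s • t)
    have hc := ProbabilityTheory.eqOn_complexMGF_of_mgf' hmgf h0
      (show Complex.I ∈ _ by rw [hset]; simp)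
    simp only [charFun_apply]
    simp only [ProbabilityTheory.complexMGF] at hc
    convert hc using 3 with x x
    · simp only [X]; rw [real_inner_comm, mul_comm]
    · simp only [X]; rw [real_inner_comm, mul_comm]
  have h2 := (withDensity_eq_iff hfm.ennreal_ofReal.aemeasurable
    hfm'.ennreal_ofReal.aemeasurable hfi.lintegral_lt_top.ne).1 hμν
  refine (Lp.eq_zero_iff_ae_eq_zero).2 ?_
  filter_upwards [hfu, h2] with x hx h3
  rw [hx, Pi.zero_apply]
  rcases le_total 0 (f x) with h0 | h0
  · rw [ENNReal.ofReal_of_nonpos (p := -f x) (by linarith), ENNReal.ofReal_eq_zero] at h3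
    exact le_antisymm h3 h0
  · rw [ENNReal.ofReal_of_nonpos h0, eq_comm, ENNReal.ofReal_eq_zero] at h3
    linarith

/-! ### The Hilbert bases of `L²_ω` and `H¹_ω` -/

lemma hermiteNorm_eq {d : ℕ} (n : Fin d → ℕ) :
    hermiteNorm n = ‖polyL2 fun j => hermitePoly (n j)‖ := by
  rw [hermiteNorm, polyL2]
  congr 1
  exact MemLp.toLp_congr _ _ (by rw [hermiteProd_eq])

lemma psiL2_eq {d : ℕ} (n : Fin d → ℕ) :
    psiL2 n = (hermiteNorm n)⁻¹ • polyL2 fun j => hermitePoly (n j) := by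
  rw [psiL2, polyL2]
  congr 1
  exact MemLp.toLp_congr _ _ (by rw [hermiteProd_eq])

lemma hermiteNorm_ne_zero {d : ℕ} (n : Fin d → ℕ) : hermiteNorm n ≠ 0 := by
  rw [hermiteNorm_eq, norm_ne_zero_iff]
  intro h
  have h1 : prodPoly (fun j => hermitePoly (n j)) =ᵐ[volume] fun _ => 0 := by
    have h2 := coeFn_polyL2 fun j => hermitePoly (n j)
    rw [h] at h2
    exact (volume_ac_gaussW d).ae_le (h2.symm.trans (Lp.coeFn_zero _ _ _))
  rw [(continuous_prodPoly _).ae_eq_iff_eq volume continuous_const] at h1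
  have h3 : ∀ j, ∃ y : ℝ, (hermitePoly (n j)).eval y ≠ 0 := fun j => by
    by_contra! h4
    exact hermitePoly_ne_zero (n j) (Polynomial.funext fun y => by simpa using h4 y)
  choose y hy using h3
  exact Finset.prod_ne_zero_iff.2 (fun j _ => hy j) (congrFun h1 (WithLp.toLp 2 y))

lemma eq_zero_of_inner_psiL2 {d : ℕ} {u : L2w d} (h : ∀ n, inner ℝ u (psiL2 n) = 0) : u = 0 := by
  refine eq_zero_of_inner_polyL2_hermite fun n => ?_
  have := h n
  rw [psiL2_eq, inner_smul_right] at this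
  exact (mul_eq_zero.1 this).resolve_left (inv_ne_zero (hermiteNorm_ne_zero n))

lemma orthonormal_psiL2 (d : ℕ) : Orthonormal ℝ (psiL2 (d := d)) := by
  refine ⟨fun n => ?_, fun n m hnm => ?_⟩
  · rw [psiL2_eq, norm_smul, norm_inv, ← hermiteNorm_eq, Real.norm_eq_abs,
      abs_of_nonneg (by rw [hermiteNorm_eq]; exact norm_nonneg _),
      inv_mul_cancel₀ (hermiteNorm_ne_zero n)]
  · change inner ℝ (psiL2 n) (psiL2 m) = 0
    rw [psiL2_eq, psiL2_eq, inner_smul_left, inner_smul_right, polyL2_hermite_orthogonal hnm]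
    simp

lemma H1w_inner_smul_right {d : ℕ} (u v : H1w d) (c : ℝ) :
    inner ℝ u (c • v) = c * inner ℝ u v :=
  inner_smul_right (𝕜 := ℝ) (E := H1w d) u v c

lemma H1w_inner_smul_left {d : ℕ} (u v : H1w d) (c : ℝ) :
    inner ℝ (c • u) v = c * inner ℝ u v :=
  real_inner_smul_left (F := H1w d) u v c

/-- The weak gradient is determined by the function: integration by parts gives its Hermite
coefficients. -/
lemma toL2_injective (d : ℕ) : Function.Injective (toL2 (d := d)) := by
  suffices H : ∀ u : H1w d, toL2 u = 0 → u = 0 by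
    intro u v h
    rw [← sub_eq_zero]
    refine H _ ?_
    have : toL2 (u - v) = toL2 u - toL2 v := rfl
    rw [this, h, sub_self]
  intro u hu
  refine Subtype.ext (WithLp.ofLp_injective 2 (Prod.ext hu (WithLp.ofLp_injective 2 ?_)))
  ext1 i
  change u.1.snd i = 0
  refine eq_zero_of_inner_polyL2_hermite fun n => ?_
  rw [(u.2 i).inner_polyL2, show u.1.fst = 0 from hu, inner_zero_left]

lemma inner_H1w {d : ℕ} (u v : H1w d) :
    inner ℝ u v = inner ℝ (toL2 u) (toL2 v) + ∑ i, inner ℝ (u.1.snd i) (v.1.snd i) := by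
  rw [Submodule.coe_inner, WithLp.prod_inner_apply, PiLp.inner_apply]
  rfl

/-- The element of `H¹_ω` given by a product of one-variable polynomials. -/
noncomputable def polyH1 {d : ℕ} (p : Fin d → Polynomial ℝ) : H1w d :=
  ⟨WithLp.toLp 2 (polyL2 p, WithLp.toLp 2 fun i => polyL2 (Function.update p i (p i).derivative)),
    fun i => hasWeakPartial_prodPoly p i⟩

lemma toL2_polyH1 {d : ℕ} (p : Fin d → Polynomial ℝ) : toL2 (polyH1 p) = polyL2 p := rfl

lemma psiH1_eq {d : ℕ} (n : Fin d → ℕ) :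
    psiH1 n = (hermiteNorm n)⁻¹ • polyH1 fun j => hermitePoly (n j) := by
  refine toL2_injective d ?_
  rw [psiH1_val, psiL2_eq]
  rfl

/-- The eigenvalue relation for `ψ_n` in weak form. -/
lemma inner_psiH1 {d : ℕ} (u : H1w d) (n : Fin d → ℕ) :
    inner ℝ u (psiH1 n) = (1 + rho n) * inner ℝ (toL2 u) (psiL2 n) := by
  have h : inner ℝ u (polyH1 fun j => hermitePoly (n j))
      = (1 + rho n) * inner ℝ (toL2 u) (polyL2 fun j => hermitePoly (n j)) := by
    rw [inner_H1w, toL2_polyH1, rho, add_mul, one_mul, Finset.mul_sum, Finset.sum_mul]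
    congr 1
    exact Finset.sum_congr rfl fun i _ => (u.2 i).inner_deriv_hermite n
  rw [psiH1_eq, psiL2_eq, H1w_inner_smul_right, inner_smul_right, h]
  ring

lemma rho_nonneg {d : ℕ} (n : Fin d → ℕ) : 0 ≤ rho n := by
  unfold rho; positivity

/-- The Hermite functions as a Hilbert basis of `L²_ω`. -/
noncomputable def basisL2 (d : ℕ) : HilbertBasis (Fin d → ℕ) ℝ (L2w d) :=
  HilbertBasis.mkOfOrthogonalEqBot (orthonormal_psiL2 d) (by
    rw [Submodule.eq_bot_iff]
    intro u hu
    refine eq_zero_of_inner_psiL2 fun n => ?_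
    rw [real_inner_comm]
    exact hu _ (Submodule.subset_span ⟨n, rfl⟩))

lemma basisL2_apply {d : ℕ} (n : Fin d → ℕ) : basisL2 d n = psiL2 n := by
  rw [basisL2, HilbertBasis.coe_mkOfOrthogonalEqBot]

lemma one_add_rho_pos {d : ℕ} (n : Fin d → ℕ) : 0 < 1 + rho n := by
  linarith [rho_nonneg n]

lemma orthonormal_psiH1 (d : ℕ) :
    Orthonormal ℝ fun n : Fin d → ℕ => (√(1 + rho n))⁻¹ • psiH1 n := by
  rw [orthonormal_iff_ite]
  intro n m
  rw [H1w_inner_smul_left, H1w_inner_smul_right, inner_psiH1, psiH1_val,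
    (orthonormal_iff_ite.1 (orthonormal_psiL2 d)) n m]
  split_ifs with h
  · subst h
    have h1 : √(1 + rho n) ≠ 0 := (Real.sqrt_pos.2 (one_add_rho_pos n)).ne'
    have h2 := Real.mul_self_sqrt (one_add_rho_pos n).le
    simp only [mul_one]
    field_simp
    nlinarith
  · simp

/-- The normalized Hermite functions as a Hilbert basis of `H¹_ω`. -/
noncomputable def basisH1 (d : ℕ) : HilbertBasis (Fin d → ℕ) ℝ (H1w d) :=
  HilbertBasis.mkOfOrthogonalEqBot (orthonormal_psiH1 d) (by
    rw [Submodule.eq_bot_iff]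
    intro u hu
    refine toL2_injective d (eq_zero_of_inner_psiL2 fun n => ?_)
    have h := hu _ (Submodule.subset_span ⟨n, rfl⟩)
    rw [real_inner_comm, H1w_inner_smul_right, inner_psiH1] at h
    have h1 : (√(1 + rho n))⁻¹ ≠ 0 := inv_ne_zero (Real.sqrt_pos.2 (one_add_rho_pos n)).ne'
    exact (mul_eq_zero.1 ((mul_eq_zero.1 h).resolve_left h1)).resolve_left (one_add_rho_pos n).ne')

lemma basisH1_apply {d : ℕ} (n : Fin d → ℕ) :
    basisH1 d n = (√(1 + rho n))⁻¹ • psiH1 n := by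
  rw [basisH1, HilbertBasis.coe_mkOfOrthogonalEqBot]

/-! ### Wave evolution from spectral data -/

lemma sqrt_mul_sinOver {ρ : ℝ} (hρ : 0 ≤ ρ) (t : ℝ) : √ρ * sinOver ρ t = Real.sin (√ρ * t) := by
  unfold sinOver
  split_ifs with h
  · simp [h]
  · exact mul_div_cancel₀ _ (Real.sqrt_ne_zero'.2 (lt_of_le_of_ne hρ (Ne.symm h)))

lemma hasDerivAt_sinOver {ρ : ℝ} (hρ : 0 ≤ ρ) (t : ℝ) :
    HasDerivAt (sinOver ρ) (Real.cos (√ρ * t)) t := by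
  unfold sinOver
  split_ifs with h
  · rw [h, Real.sqrt_zero, zero_mul, Real.cos_zero]
    exact hasDerivAt_id' t
  · have h0 : √ρ ≠ 0 := Real.sqrt_ne_zero'.2 (lt_of_le_of_ne hρ (Ne.symm h))
    have h1 := (((hasDerivAt_id t).const_mul (√ρ)).sin).div_const (√ρ)
    simpa [h0] using h1

lemma sinOver_zero (ρ : ℝ) : sinOver ρ 0 = 0 := by simp [sinOver]

lemma continuous_sinOver {ρ : ℝ} (hρ : 0 ≤ ρ) : Continuous (sinOver ρ) :=
  continuous_iff_continuousAt.2 fun t => (hasDerivAt_sinOver hρ t).continuousAt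

lemma sinOver_add {ρ : ℝ} (s t : ℝ) : sinOver ρ (s + t)
    = sinOver ρ s * Real.cos (√ρ * t) + Real.cos (√ρ * s) * sinOver ρ t := by
  unfold sinOver
  split_ifs with h
  · simp [h]
  · rw [mul_add, Real.sin_add]
    ring

lemma abs_sinOver_le {ρ : ℝ} (hρ : 0 ≤ ρ) (t : ℝ) : |sinOver ρ t| ≤ |t| := by
  unfold sinOver
  split_ifs with h
  · rfl
  · have h0 : 0 < √ρ := Real.sqrt_pos.2 (lt_of_le_of_ne hρ (Ne.symm h))
    rw [abs_div, abs_of_pos h0, div_le_iff₀ h0]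
    refine Real.abs_sin_le_abs.trans ?_
    rw [abs_mul, abs_of_pos h0, mul_comm]

lemma abs_cos_sub_one_le (x : ℝ) : |Real.cos x - 1| ≤ |x| := by
  have h := Real.abs_cos_sub_cos_le x 0
  simpa using h

/-- The energy bound for a single mode. The growth in `t` comes from the mode `ρ = 0`, where the
evolution is `(a, b) ↦ (a + bt, b)`. -/
lemma mul_cos_add_sq_le {ρ t a b : ℝ} (hρ : 0 ≤ ρ) :
    (1 + ρ) * (a * Real.cos (√ρ * t) + b * sinOver ρ t) ^ 2
      + (-√ρ * a * Real.sin (√ρ * t) + b * Real.cos (√ρ * t)) ^ 2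
      ≤ (2 * (1 + |t|)) ^ 2 * ((1 + ρ) * a ^ 2 + b ^ 2) := by
  have h1 := sqrt_mul_sinOver hρ t
  have h2 := Real.sin_sq_add_cos_sq (√ρ * t)
  have h3 := Real.sq_sqrt hρ
  have h4 : sinOver ρ t ^ 2 ≤ |t| ^ 2 := by
    rw [← sq_abs (sinOver ρ t)]
    exact pow_le_pow_left₀ (abs_nonneg _) (abs_sinOver_le hρ t) 2
  set c := Real.cos (√ρ * t)
  set σ := Real.sin (√ρ * t)
  set S := sinOver ρ t
  have h5 : ρ * S ^ 2 = σ ^ 2 := by rw [← h1, mul_pow, h3]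
  have e1 : (a * c + b * S) ^ 2 ≤ 2 * (a ^ 2 * c ^ 2) + 2 * (b ^ 2 * S ^ 2) := by
    nlinarith [sq_nonneg (a * c - b * S)]
  have e2 : (-√ρ * a * σ + b * c) ^ 2 ≤ 2 * (ρ * a ^ 2 * σ ^ 2) + 2 * (b ^ 2 * c ^ 2) := by
    have : (√ρ * a * σ) ^ 2 = ρ * a ^ 2 * σ ^ 2 := by rw [mul_pow, mul_pow, h3]
    nlinarith [sq_nonneg (√ρ * a * σ + b * c)]
  have hc : c ^ 2 ≤ 1 := by nlinarith [sq_nonneg σ]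
  have hs : σ ^ 2 ≤ 1 := by nlinarith [sq_nonneg c]
  have e3 : (1 + ρ) * (a * c + b * S) ^ 2
      ≤ (1 + ρ) * (2 * (a ^ 2 * c ^ 2) + 2 * (b ^ 2 * S ^ 2)) :=
    mul_le_mul_of_nonneg_left e1 (by linarith)
  have e4 : (1 + ρ) * (b ^ 2 * S ^ 2) ≤ b ^ 2 * (|t| ^ 2 + 1) := by
    have : (1 + ρ) * (b ^ 2 * S ^ 2) = b ^ 2 * (S ^ 2 + σ ^ 2) := by rw [← h5]; ring
    rw [this]
    exact mul_le_mul_of_nonneg_left (add_le_add h4 hs) (sq_nonneg b)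
  have e5 : (1 + ρ) * (a ^ 2 * c ^ 2) ≤ (1 + ρ) * a ^ 2 :=
    mul_le_mul_of_nonneg_left (mul_le_of_le_one_right (sq_nonneg a) hc) (by linarith)
  have e6 : ρ * a ^ 2 * σ ^ 2 ≤ ρ * a ^ 2 := mul_le_of_le_one_right (by positivity) hs
  have e7 : b ^ 2 * c ^ 2 ≤ b ^ 2 := mul_le_of_le_one_right (sq_nonneg b) hc
  have ht := abs_nonneg t
  nlinarith [mul_nonneg ht (sq_nonneg b), mul_nonneg ht (sq_nonneg a),
    mul_nonneg (mul_nonneg ht ht) (sq_nonneg b), mul_nonneg (mul_nonneg ht ht) (sq_nonneg a),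
    mul_nonneg hρ (mul_nonneg ht (sq_nonneg a)), sq_nonneg a, sq_nonneg b,
    mul_nonneg hρ (mul_nonneg (mul_nonneg ht ht) (sq_nonneg a)), mul_nonneg hρ (sq_nonneg a)]

/-- The spectral data of a wave equation: a Hilbert space `L` with a Hilbert basis `f` of
eigenvectors with eigenvalues `ρ ≥ 0`, and a form domain `H`, embedded in `L` by `j`, in which
the eigenvectors `e n` are orthogonal of squared norm `1 + ρ n`, and which
they span. -/
structure WaveSpectrum (H L ι : Type*) [NormedAddCommGroup H] [InnerProductSpace ℝ H]
    [CompleteSpace H] [NormedAddCommGroup L] [InnerProductSpace ℝ L] [CompleteSpace L] where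
  j : H →L[ℝ] L
  ρ : ι → ℝ
  e : ι → H
  f : ι → L
  bH : HilbertBasis ι ℝ H
  bL : HilbertBasis ι ℝ L
  ρ_nonneg : ∀ n, 0 ≤ ρ n
  bH_eq : ∀ n, bH n = (√(1 + ρ n))⁻¹ • e n
  bL_eq : ∀ n, bL n = f n
  inner_e : ∀ u n, inner ℝ u (e n) = (1 + ρ n) * inner ℝ (j u) (f n)

namespace WaveSpectrum

variable {H L ι : Type*} [NormedAddCommGroup H] [InnerProductSpace ℝ H]
    [CompleteSpace H] [NormedAddCommGroup L] [InnerProductSpace ℝ L] [CompleteSpace L]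
    (W : WaveSpectrum H L ι)

lemma sqrt_pos (n : ι) : 0 < √(1 + W.ρ n) := Real.sqrt_pos.2 (by linarith [W.ρ_nonneg n])

lemma sq_sqrt (n : ι) : √(1 + W.ρ n) ^ 2 = 1 + W.ρ n := Real.sq_sqrt (by linarith [W.ρ_nonneg n])

lemma inner_bH (u : H) (n : ι) :
    inner ℝ u (W.bH n) = √(1 + W.ρ n) * inner ℝ (W.j u) (W.f n) := by
  have := (W.sqrt_pos n).ne'
  rw [W.bH_eq, inner_smul_right, W.inner_e]
  nth_rw 2 [← W.sq_sqrt n]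
  field_simp

lemma ext_H {u v : H} (h : ∀ n, inner ℝ (W.j u) (W.f n) = inner ℝ (W.j v) (W.f n)) : u = v := by
  refine W.bH.repr.injective (lp.ext (funext fun n => ?_))
  rw [HilbertBasis.repr_apply_apply, HilbertBasis.repr_apply_apply, real_inner_comm,
    real_inner_comm v, W.inner_bH, W.inner_bH, h]

lemma ext_L {u v : L} (h : ∀ n, inner ℝ u (W.f n) = inner ℝ v (W.f n)) : u = v := by
  refine W.bL.repr.injective (lp.ext (funext fun n => ?_))
  rw [HilbertBasis.repr_apply_apply, HilbertBasis.repr_apply_apply, real_inner_comm,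
    real_inner_comm v, W.bL_eq, h]

lemma hasSum_normSq_L (v : L) : HasSum (fun n => inner ℝ v (W.f n) ^ 2) (‖v‖ ^ 2) := by
  have h := W.bL.hasSum_inner_mul_inner v v
  rw [real_inner_self_eq_norm_sq] at h
  refine h.congr_fun fun n => ?_
  rw [real_inner_comm v, W.bL_eq, sq]

lemma hasSum_normSq_H (u : H) :
    HasSum (fun n => (1 + W.ρ n) * inner ℝ (W.j u) (W.f n) ^ 2) (‖u‖ ^ 2) := by
  have h := W.bH.hasSum_inner_mul_inner u u
  rw [real_inner_self_eq_norm_sq] at h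
  refine h.congr_fun fun n => ?_
  rw [real_inner_comm u, W.inner_bH]
  nth_rw 1 [← W.sq_sqrt n]
  ring

lemma exists_hasSum_L {c : ι → ℝ} (hc : Summable fun n => c n ^ 2) :
    ∃ v, HasSum (fun n => c n • W.f n) v ∧ ∀ n, inner ℝ v (W.f n) = c n := by
  have hm : Memℓp c 2 := memℓp_gen (by simpa using hc)
  refine ⟨W.bL.repr.symm ⟨c, hm⟩, ?_, fun n => ?_⟩
  · have := W.bL.hasSum_repr_symm ⟨c, hm⟩
    simpa only [W.bL_eq] using this
  · rw [real_inner_comm, ← W.bL_eq, ← HilbertBasis.repr_apply_apply,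
      LinearIsometryEquiv.apply_symm_apply]

lemma exists_hasSum_H {c : ι → ℝ} (hc : Summable fun n => (1 + W.ρ n) * c n ^ 2) :
    ∃ u, HasSum (fun n => c n • W.e n) u ∧ ∀ n, inner ℝ (W.j u) (W.f n) = c n := by
  have hm : Memℓp (fun n => √(1 + W.ρ n) * c n) 2 := memℓp_gen (by
    simpa [mul_pow, W.sq_sqrt] using hc)
  refine ⟨W.bH.repr.symm ⟨_, hm⟩, ?_, fun n => ?_⟩
  · have := W.bH.hasSum_repr_symm ⟨_, hm⟩
    refine this.congr_fun fun n => ?_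
    rw [W.bH_eq, smul_smul]
    congr 1
    have := (W.sqrt_pos n).ne'
    field_simp
  · refine mul_left_cancel₀ (W.sqrt_pos n).ne' ?_
    rw [← W.inner_bH, real_inner_comm, ← HilbertBasis.repr_apply_apply,
      LinearIsometryEquiv.apply_symm_apply]

/-- The coefficient of the position. -/
noncomputable def a (M : WithLp 2 (H × L)) (n : ι) : ℝ := inner ℝ (W.j M.fst) (W.f n)

/-- The coefficient of the velocity. -/
noncomputable def b (M : WithLp 2 (H × L)) (n : ι) : ℝ := inner ℝ M.snd (W.f n)

lemma ext {M N : WithLp 2 (H × L)} (ha : ∀ n, W.a M n = W.a N n) (hb : ∀ n, W.b M n = W.b N n) :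
    M = N :=
  WithLp.ofLp_injective 2 (Prod.ext (W.ext_H ha) (W.ext_L hb))

lemma hasSum_normSq (M : WithLp 2 (H × L)) :
    HasSum (fun n => (1 + W.ρ n) * W.a M n ^ 2 + W.b M n ^ 2) (‖M‖ ^ 2) := by
  rw [WithLp.prod_norm_sq_eq_of_L2]
  exact (W.hasSum_normSq_H M.fst).add (W.hasSum_normSq_L M.snd)

/-- The wave evolution, mode by mode. -/
noncomputable def evol (t : ℝ) (M : WithLp 2 (H × L)) : WithLp 2 (H × L) :=
  WithLp.toLp 2
    (∑' n, (inner ℝ (W.j M.fst) (W.f n) * Real.cos (√(W.ρ n) * t)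
        + inner ℝ M.snd (W.f n) * sinOver (W.ρ n) t) • W.e n,
     ∑' n, (-√(W.ρ n) * inner ℝ (W.j M.fst) (W.f n) * Real.sin (√(W.ρ n) * t)
        + inner ℝ M.snd (W.f n) * Real.cos (√(W.ρ n) * t)) • W.f n)

lemma coeff_evol (t : ℝ) (M : WithLp 2 (H × L)) (n : ι) :
    W.a (W.evol t M) n = W.a M n * Real.cos (√(W.ρ n) * t) + W.b M n * sinOver (W.ρ n) t ∧
    W.b (W.evol t M) n = -√(W.ρ n) * W.a M n * Real.sin (√(W.ρ n) * t)
      + W.b M n * Real.cos (√(W.ρ n) * t) := by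
  have hs := (W.hasSum_normSq M).summable.mul_left ((2 * (1 + |t|)) ^ 2)
  have hle := fun n => mul_cos_add_sq_le (t := t) (a := W.a M n) (b := W.b M n) (W.ρ_nonneg n)
  have hρ := fun n => (show 0 ≤ 1 + W.ρ n by linarith [W.ρ_nonneg n])
  obtain ⟨u, hu, hu'⟩ := W.exists_hasSum_H (Summable.of_nonneg_of_le
    (fun n => mul_nonneg (hρ n) (sq_nonneg _))
    (fun n => (le_add_of_nonneg_right (sq_nonneg _)).trans (hle n)) hs)
  obtain ⟨v, hv, hv'⟩ := W.exists_hasSum_L (Summable.of_nonneg_of_le (fun n => sq_nonneg _)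
    (fun n => (le_add_of_nonneg_left (mul_nonneg (hρ n) (sq_nonneg _))).trans (hle n)) hs)
  constructor
  · rw [← hu' n, ← hu.tsum_eq]; rfl
  · rw [← hv' n, ← hv.tsum_eq]; rfl

lemma a_evol (t : ℝ) (M : WithLp 2 (H × L)) (n : ι) : W.a (W.evol t M) n
    = W.a M n * Real.cos (√(W.ρ n) * t) + W.b M n * sinOver (W.ρ n) t := (W.coeff_evol t M n).1

lemma b_evol (t : ℝ) (M : WithLp 2 (H × L)) (n : ι) : W.b (W.evol t M) n
    = -√(W.ρ n) * W.a M n * Real.sin (√(W.ρ n) * t) + W.b M n * Real.cos (√(W.ρ n) * t) :=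
  (W.coeff_evol t M n).2

lemma norm_evol_le (t : ℝ) (M : WithLp 2 (H × L)) : ‖W.evol t M‖ ≤ 2 * (1 + |t|) * ‖M‖ := by
  have ht : 0 ≤ 2 * (1 + |t|) := by positivity
  refine le_of_sq_le_sq ?_ (mul_nonneg ht (norm_nonneg _))
  rw [mul_pow]
  refine hasSum_le (fun n => ?_) (W.hasSum_normSq _) ((W.hasSum_normSq M).mul_left _)
  rw [a_evol, b_evol]
  exact mul_cos_add_sq_le (W.ρ_nonneg n)

lemma a_add (M N : WithLp 2 (H × L)) (n : ι) : W.a (M + N) n = W.a M n + W.a N n := by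
  simp [a, inner_add_left]

lemma b_add (M N : WithLp 2 (H × L)) (n : ι) : W.b (M + N) n = W.b M n + W.b N n := by
  simp [b, inner_add_left]

lemma a_smul (c : ℝ) (M : WithLp 2 (H × L)) (n : ι) : W.a (c • M) n = c * W.a M n := by
  simp [a, inner_smul_left]

lemma b_smul (c : ℝ) (M : WithLp 2 (H × L)) (n : ι) : W.b (c • M) n = c * W.b M n := by
  simp [b, inner_smul_left]

/-- The wave evolution as a bounded linear operator. -/
noncomputable def S (t : ℝ) : WithLp 2 (H × L) →L[ℝ] WithLp 2 (H × L) :=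
  LinearMap.mkContinuous
    { toFun := W.evol t
      map_add' := fun M N => W.ext (fun n => by simp only [a_evol, a_add, b_add]; ring)
        (fun n => by simp only [b_evol, a_add, b_add]; ring)
      map_smul' := fun c M => W.ext
        (fun n => by simp only [a_evol, a_smul, b_smul, RingHom.id_apply]; ring)
        (fun n => by simp only [b_evol, a_smul, b_smul, RingHom.id_apply]; ring) }
    (2 * (1 + |t|)) (W.norm_evol_le t)

lemma S_apply (t : ℝ) (M : WithLp 2 (H × L)) : W.S t M = W.evol t M := rfl

lemma S_zero (M : WithLp 2 (H × L)) : W.S 0 M = M :=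
  W.ext (fun n => by simp [S_apply, a_evol, sinOver_zero]) (fun n => by simp [S_apply, b_evol])

lemma S_add (s t : ℝ) (M : WithLp 2 (H × L)) : W.S (s + t) M = W.S s (W.S t M) := by
  refine W.ext (fun n => ?_) (fun n => ?_)
  · have h1 := sqrt_mul_sinOver (W.ρ_nonneg n) s
    simp only [S_apply, a_evol, b_evol, sinOver_add, mul_add, Real.cos_add]
    linear_combination W.a M n * Real.sin (√(W.ρ n) * t) * h1
  · have h1 := sqrt_mul_sinOver (W.ρ_nonneg n) t
    simp only [S_apply, a_evol, b_evol, mul_add, Real.cos_add, Real.sin_add]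
    linear_combination W.b M n * Real.sin (√(W.ρ n) * s) * h1

end WaveSpectrum

/-! ### The wave group -/

namespace WaveSpectrum

variable {H L ι : Type*} [NormedAddCommGroup H] [InnerProductSpace ℝ H]
    [CompleteSpace H] [NormedAddCommGroup L] [InnerProductSpace ℝ L] [CompleteSpace L]
    (W : WaveSpectrum H L ι)

lemma a_sub (M N : WithLp 2 (H × L)) (n : ι) : W.a (M - N) n = W.a M n - W.a N n := by
  simp [a, inner_sub_left]

lemma b_sub (M N : WithLp 2 (H × L)) (n : ι) : W.b (M - N) n = W.b M n - W.b N n := by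
  simp [b, inner_sub_left]

lemma norm_j_le (u : H) : ‖W.j u‖ ≤ ‖u‖ := by
  refine le_of_sq_le_sq ?_ (norm_nonneg _)
  refine hasSum_le (fun n => ?_) (W.hasSum_normSq_L _) (W.hasSum_normSq_H u)
  exact le_mul_of_one_le_left (sq_nonneg _) (by linarith [W.ρ_nonneg n])

/-- Strong continuity at `t = 0`, by dominated convergence of the sum over the modes. -/
lemma tendsto_S (M : WithLp 2 (H × L)) : Tendsto (fun t => W.S t M) (𝓝 0) (𝓝 M) := by
  rw [tendsto_iff_norm_sub_tendsto_zero]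
  have key : Tendsto (fun t => ‖W.S t M - M‖ ^ 2) (𝓝 0) (𝓝 0) := by
    have hf : ∀ t, ‖W.S t M - M‖ ^ 2
        = ∑' n, ((1 + W.ρ n) * W.a (W.S t M - M) n ^ 2 + W.b (W.S t M - M) n ^ 2) := fun t =>
      (W.hasSum_normSq _).tsum_eq.symm
    simp only [hf]
    suffices h : Tendsto _ _ (𝓝 (∑' _ : ι, (0 : ℝ))) by simpa only [tsum_zero] using h
    refine tendsto_tsum_of_dominated_convergence
      ((W.hasSum_normSq M).summable.mul_left (2 * (2 * 2) ^ 2 + 2)) (fun n => ?_) ?_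
    · simp only [a_sub, b_sub, S_apply, a_evol, b_evol]
      have hc := (continuous_sinOver (W.ρ_nonneg n))
      refine Continuous.tendsto' (by fun_prop) _ _ ?_
      simp [sinOver_zero]
    · have h1 : ∀ᶠ t : ℝ in 𝓝 0, |t| ≤ 1 := by
        filter_upwards [Metric.closedBall_mem_nhds (0 : ℝ) one_pos] with t ht
        simpa using ht
      filter_upwards [h1] with t ht n
      have hρ : 0 ≤ 1 + W.ρ n := by linarith [W.ρ_nonneg n]
      rw [Real.norm_of_nonneg (add_nonneg (mul_nonneg hρ (sq_nonneg _)) (sq_nonneg _))]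
      have h2 := mul_cos_add_sq_le (t := t) (a := W.a M n) (b := W.b M n) (W.ρ_nonneg n)
      rw [← a_evol, ← b_evol] at h2
      have h3 : (2 * (1 + |t|)) ^ 2 ≤ (2 * 2) ^ 2 :=
        pow_le_pow_left₀ (by positivity) (by linarith) 2
      have h4 := h2.trans (mul_le_mul_of_nonneg_right h3
        (add_nonneg (mul_nonneg hρ (sq_nonneg (W.a M n))) (sq_nonneg (W.b M n))))
      rw [a_sub, b_sub, S_apply]
      set x := W.a (W.evol t M) n
      set y := W.b (W.evol t M) n
      have e1 : (1 + W.ρ n) * (x - W.a M n) ^ 2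
          ≤ (1 + W.ρ n) * (2 * x ^ 2 + 2 * W.a M n ^ 2) :=
        mul_le_mul_of_nonneg_left (by nlinarith [sq_nonneg (x + W.a M n)]) hρ
      nlinarith [sq_nonneg (y + W.b M n)]
  have h := key.sqrt
  simpa using h

/-- In the weaker norm of `L`, every orbit has a differentiable position. -/
lemma hasDerivAt_j_S (M : WithLp 2 (H × L)) :
    HasDerivAt (fun t => W.j (W.S t M).fst) M.snd 0 := by
  rw [hasDerivAt_iff_tendsto_slope_zero, tendsto_iff_norm_sub_tendsto_zero]
  simp only [zero_add, S_zero]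
  have hcoef : ∀ t n, inner ℝ (t⁻¹ • (W.j (W.S t M).fst - W.j M.fst) - M.snd) (W.f n)
      = W.a M n * (t⁻¹ * (Real.cos (√(W.ρ n) * t) - 1))
        + W.b M n * (t⁻¹ * sinOver (W.ρ n) t - 1) := by
    intro t n
    rw [inner_sub_left, real_inner_smul_left, inner_sub_left]
    change t⁻¹ * (W.a (W.evol t M) n - W.a M n) - W.b M n = _
    rw [a_evol]
    ring
  have key : Tendsto (fun t => ‖t⁻¹ • (W.j (W.S t M).fst - W.j M.fst) - M.snd‖ ^ 2)
      (𝓝[≠] 0) (𝓝 0) := by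
    have hf : ∀ t, ‖t⁻¹ • (W.j (W.S t M).fst - W.j M.fst) - M.snd‖ ^ 2
        = ∑' n, inner ℝ (t⁻¹ • (W.j (W.S t M).fst - W.j M.fst) - M.snd) (W.f n) ^ 2 := fun t =>
      (W.hasSum_normSq_L _).tsum_eq.symm
    simp only [hf, hcoef]
    suffices h : Tendsto _ _ (𝓝 (∑' _ : ι, (0 : ℝ))) by simpa only [tsum_zero] using h
    refine tendsto_tsum_of_dominated_convergence
      ((W.hasSum_normSq M).summable.mul_left 8) (fun n => ?_) ?_
    · have h1 : HasDerivAt (fun t => Real.cos (√(W.ρ n) * t)) 0 0 := by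
        simpa using (((hasDerivAt_id (0 : ℝ)).const_mul (√(W.ρ n))).cos)
      have h2 := hasDerivAt_sinOver (W.ρ_nonneg n) 0
      rw [hasDerivAt_iff_tendsto_slope_zero] at h1 h2
      simp only [zero_add, mul_zero, Real.cos_zero, smul_eq_mul, sinOver_zero, sub_zero] at h1 h2
      simpa using ((h1.const_mul (W.a M n)).add ((h2.sub_const 1).const_mul (W.b M n))).pow 2
    · filter_upwards [self_mem_nhdsWithin] with t ht n
      have ht' : 0 < |t| := abs_pos.2 ht
      have hρ := W.ρ_nonneg n
      have b1 : |t⁻¹ * (Real.cos (√(W.ρ n) * t) - 1)| ≤ √(W.ρ n) := by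
        rw [abs_mul, abs_inv, inv_mul_le_iff₀ ht']
        refine (abs_cos_sub_one_le _).trans (le_of_eq ?_)
        rw [abs_mul, abs_of_nonneg (Real.sqrt_nonneg _), mul_comm]
      have b2 : |t⁻¹ * sinOver (W.ρ n) t - 1| ≤ 2 := by
        have : |t⁻¹ * sinOver (W.ρ n) t| ≤ 1 := by
          rw [abs_mul, abs_inv, inv_mul_le_iff₀ ht', mul_one]
          exact abs_sinOver_le hρ t
        refine (abs_sub _ _).trans ?_
        rw [abs_one]; linarith
      rw [Real.norm_of_nonneg (sq_nonneg _)]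
      set x := t⁻¹ * (Real.cos (√(W.ρ n) * t) - 1)
      set y := t⁻¹ * sinOver (W.ρ n) t - 1
      have c1 : x ^ 2 ≤ W.ρ n := by
        rw [← Real.sq_sqrt hρ, ← sq_abs x]
        exact pow_le_pow_left₀ (abs_nonneg _) b1 2
      have c2 : y ^ 2 ≤ 4 := by
        rw [← sq_abs y]
        calc |y| ^ 2 ≤ 2 ^ 2 := pow_le_pow_left₀ (abs_nonneg _) b2 2
          _ = 4 := by norm_num
      have d1 := mul_le_mul_of_nonneg_left c1 (sq_nonneg (W.a M n))
      have d2 := mul_le_mul_of_nonneg_left c2 (sq_nonneg (W.b M n))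
      nlinarith [sq_nonneg (W.a M n * x - W.b M n * y), sq_nonneg (W.a M n),
        mul_nonneg hρ (sq_nonneg (W.a M n))]
  have h := key.sqrt
  simpa using h

/-- Starting from position `0`, the position grows at most at the speed of the initial velocity. -/
lemma norm_j_S_le (t : ℝ) (g : L) : ‖W.j (W.S t (WithLp.toLp 2 (0, g))).fst‖ ≤ |t| * ‖g‖ := by
  refine le_of_sq_le_sq ?_ (by positivity)
  rw [mul_pow]
  refine hasSum_le (fun n => ?_) (W.hasSum_normSq_L _) ((W.hasSum_normSq_L g).mul_left _)
  change W.a (W.evol t _) n ^ 2 ≤ _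
  rw [a_evol, show W.a (WithLp.toLp 2 (0, g)) n = 0 by simp [a],
    show W.b (WithLp.toLp 2 (0, g)) n = inner ℝ g (W.f n) from rfl, zero_mul, zero_add, mul_pow,
    mul_comm]
  refine mul_le_mul_of_nonneg_right ?_ (sq_nonneg _)
  rw [← sq_abs (sinOver _ _)]
  exact pow_le_pow_left₀ (abs_nonneg _) (abs_sinOver_le (W.ρ_nonneg n) t) 2

end WaveSpectrum

/-- A strongly continuous group `S` on a space `X` of pairs (position, velocity) with values in
`L`, for which the position is differentiable along orbits with derivative the velocity. The map
`inj` is `g ↦ (0, g)`. -/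
structure WaveGroup (X L : Type*) [NormedAddCommGroup X] [NormedSpace ℝ X]
    [NormedAddCommGroup L] [NormedSpace ℝ L] where
  S : ℝ → X →L[ℝ] X
  pos : X →L[ℝ] L
  vel : X →L[ℝ] L
  inj : L →L[ℝ] X
  S_zero : ∀ M, S 0 M = M
  S_add : ∀ s t M, S (s + t) M = S s (S t M)
  norm_S_le : ∀ t M, ‖S t M‖ ≤ 2 * (1 + |t|) * ‖M‖
  tendsto_S : ∀ M, Tendsto (fun t => S t M) (𝓝 0) (𝓝 M)
  hasDerivAt_pos_S : ∀ M, HasDerivAt (fun t => pos (S t M)) (vel M) 0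
  norm_pos_S_inj_le : ∀ t g, ‖pos (S t (inj g))‖ ≤ |t| * ‖g‖
  norm_pos_le : ∀ M, ‖pos M‖ ≤ ‖M‖
  norm_vel_le : ∀ M, ‖vel M‖ ≤ ‖M‖
  norm_inj_le : ∀ g, ‖inj g‖ ≤ ‖g‖

/-- The wave group of a wave spectrum. -/
noncomputable def WaveSpectrum.waveGroup {H L ι : Type*} [NormedAddCommGroup H]
    [InnerProductSpace ℝ H] [CompleteSpace H] [NormedAddCommGroup L] [InnerProductSpace ℝ L]
    [CompleteSpace L] (W : WaveSpectrum H L ι) : WaveGroup (WithLp 2 (H × L)) L where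
  S := W.S
  pos := W.j.comp (WithLp.fstL 2 ℝ H L)
  vel := WithLp.sndL 2 ℝ H L
  inj := ((WithLp.prodContinuousLinearEquiv 2 ℝ H L).symm : (H × L) →L[ℝ] WithLp 2 (H × L)).comp
    (ContinuousLinearMap.inr ℝ H L)
  S_zero := W.S_zero
  S_add := W.S_add
  norm_S_le := W.norm_evol_le
  tendsto_S := W.tendsto_S
  hasDerivAt_pos_S := W.hasDerivAt_j_S
  norm_pos_S_inj_le := W.norm_j_S_le
  norm_pos_le M := (W.norm_j_le M.fst).trans (by
    refine le_of_sq_le_sq ?_ (norm_nonneg _)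
    rw [WithLp.prod_norm_sq_eq_of_L2]
    exact le_add_of_nonneg_right (sq_nonneg _))
  norm_vel_le M := by
    refine le_of_sq_le_sq ?_ (norm_nonneg _)
    rw [WithLp.prod_norm_sq_eq_of_L2]
    exact le_add_of_nonneg_left (sq_nonneg _)
  norm_inj_le g := by
    refine le_of_sq_le_sq ?_ (norm_nonneg _)
    rw [WithLp.prod_norm_sq_eq_of_L2]
    simp

/-! ### Forces and the Duhamel integral -/

/-- Grönwall's inequality in integral form. -/
lemma le_mul_exp_of_le_add_integral {u : ℝ → ℝ} (hu : Continuous u) {A B T : ℝ}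
    (hB : 0 ≤ B) (h : ∀ t ∈ Icc 0 T, u t ≤ A + B * ∫ s in (0 : ℝ)..t, u s) :
    ∀ t ∈ Icc 0 T, u t ≤ A * Real.exp (B * t) := by
  -- `t ↦ e^{-Bt} (A + B ∫₀ᵗ u)` is antitone.
  let w : ℝ → ℝ := fun t => A + B * ∫ s in (0 : ℝ)..t, u s
  have hw : ∀ t, HasDerivAt w (B * u t) t := fun t =>
    (((intervalIntegral.integral_hasDerivAt_right (hu.intervalIntegrable 0 t)
      (hu.stronglyMeasurableAtFilter _ _) hu.continuousAt).const_mul B).const_add A)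
  let v : ℝ → ℝ := fun t => w t * Real.exp (-(B * t))
  have hv : ∀ t, HasDerivAt v (B * u t * Real.exp (-(B * t))
      + w t * (Real.exp (-(B * t)) * -(B * 1))) t := fun t =>
    (hw t).mul (((hasDerivAt_id t).const_mul B).neg.exp)
  have hanti : AntitoneOn v (Icc 0 T) := by
    refine antitoneOn_of_hasDerivWithinAt_nonpos (convex_Icc 0 T)
      (fun t _ => (hv t).continuousAt.continuousWithinAt) (fun t _ => (hv t).hasDerivWithinAt)
      fun t ht => ?_
    rw [interior_Icc] at ht
    have h1 := h t ⟨ht.1.le, ht.2.le⟩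
    have h2 : B * Real.exp (-(B * t)) * (u t - w t) ≤ 0 :=
      mul_nonpos_of_nonneg_of_nonpos (by positivity) (sub_nonpos.2 h1)
    linarith
  intro t ht
  have h1 : v t ≤ v 0 := hanti ⟨le_rfl, ht.1.trans ht.2⟩ ht ht.1
  have h2 : v 0 = A := by simp [v, w]
  rw [h2] at h1
  have h3 : Real.exp (-(B * t)) * Real.exp (B * t) = 1 := by rw [← Real.exp_add]; simp
  calc u t ≤ w t := h t ht
    _ = v t * Real.exp (B * t) := by simp only [v]; rw [mul_assoc, h3, mul_one]
    _ ≤ A * Real.exp (B * t) := mul_le_mul_of_nonneg_right h1 (Real.exp_pos _).le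

/-- A strongly measurable and bounded function of time. -/
structure BoundedForce {X : Type*} [NormedAddCommGroup X] (F : ℝ → X) : Prop where
  meas : StronglyMeasurable F
  bound : ∃ B, ∀ s, ‖F s‖ ≤ B

lemma boundedForce_zero {X : Type*} [NormedAddCommGroup X] : BoundedForce fun _ : ℝ => (0 : X) :=
  ⟨stronglyMeasurable_const, 0, by simp⟩

/-- A time-dependent nonlinearity, globally Lipschitz with constant `Λ` and vanishing at `0`. -/
structure Nonlinearity {L : Type*} [NormedAddCommGroup L] (G : ℝ → L → L) (Λ : ℝ) : Prop where
  lip : ∀ s u v, ‖G s u - G s v‖ ≤ Λ * ‖u - v‖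
  zero : ∀ s, G s 0 = 0
  meas : ∀ u, StronglyMeasurable fun s => G s u
  nonneg : 0 ≤ Λ

lemma Nonlinearity.norm_le {L : Type*} [NormedAddCommGroup L] {G : ℝ → L → L} {Λ : ℝ}
    (hG : Nonlinearity G Λ) (s : ℝ) (u : L) : ‖G s u‖ ≤ Λ * ‖u‖ := by
  simpa [hG.zero] using hG.lip s u 0

lemma Nonlinearity.continuous {L : Type*} [NormedAddCommGroup L] {G : ℝ → L → L} {Λ : ℝ}
    (hG : Nonlinearity G Λ) (s : ℝ) : Continuous (G s) :=
  (LipschitzWith.of_dist_le_mul (K := ⟨Λ, hG.nonneg⟩) fun u v => by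
    rw [dist_eq_norm, dist_eq_norm]; exact hG.lip s u v).continuous

lemma Nonlinearity.stronglyMeasurable_comp {L : Type*} [NormedAddCommGroup L] {G : ℝ → L → L}
    {Λ : ℝ} (hG : Nonlinearity G Λ) {m : ℝ → L} (hm : Continuous m) :
    StronglyMeasurable fun s => G s (m s) := by
  have h := stronglyMeasurable_uncurry_of_continuous_of_stronglyMeasurable
    (u := fun r s => G s (m r)) (fun s => (hG.continuous s).comp hm) (fun r => hG.meas (m r))
  exact h.comp_measurable (measurable_id.prodMk measurable_id)

namespace WaveGroup

variable {X L : Type*} [NormedAddCommGroup X] [NormedSpace ℝ X] [NormedAddCommGroup L]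
    [NormedSpace ℝ L] (V : WaveGroup X L)

lemma continuous_orbit (M : X) : Continuous fun t => V.S t M := by
  refine continuous_iff_continuousAt.2 fun t => ?_
  have h1 : Tendsto (fun s => s - t) (𝓝 t) (𝓝 0) :=
    Continuous.tendsto' (by fun_prop) _ _ (sub_self t)
  have h2 := ((V.S t).continuous.tendsto M).comp ((V.tendsto_S M).comp h1)
  refine h2.congr fun s => ?_
  simp only [Function.comp]
  rw [← V.S_add]
  congr 2
  ring

lemma norm_S_le_of_mem {T t : ℝ} (ht : |t| ≤ T) (M : X) : ‖V.S t M‖ ≤ 2 * (1 + T) * ‖M‖ :=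
  (V.norm_S_le t M).trans (mul_le_mul_of_nonneg_right (by linarith) (norm_nonneg _))

lemma continuous_S : Continuous fun p : ℝ × X => V.S p.1 p.2 := by
  refine continuous_iff_continuousAt.2 fun ⟨t, M⟩ => ?_
  have h1 : Tendsto (fun p : ℝ × X => V.S p.1 M) (𝓝 (t, M)) (𝓝 (V.S t M)) :=
    ((V.continuous_orbit M).tendsto t).comp continuous_fst.continuousAt
  have h2 : Tendsto (fun p : ℝ × X => V.S p.1 (p.2 - M)) (𝓝 (t, M)) (𝓝 0) := by
    rw [tendsto_zero_iff_norm_tendsto_zero]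
    have h3 : Tendsto (fun p : ℝ × X => 2 * (1 + |p.1|) * ‖p.2 - M‖) (𝓝 (t, M)) (𝓝 0) :=
      Continuous.tendsto' (by fun_prop) _ _ (by simp)
    exact squeeze_zero (fun _ => norm_nonneg _) (fun p => V.norm_S_le p.1 _) h3
  refine (zero_add (V.S t M) ▸ h2.add h1).congr fun p => ?_
  rw [map_sub, sub_add_cancel]

/-- The Duhamel integral `∫₀ᵗ S(t - s) F(s) ds`. -/
noncomputable def duhamel (F : ℝ → X) (t : ℝ) : X := ∫ s in (0 : ℝ)..t, V.S (t - s) (F s)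

variable {V} {F : ℝ → X}

lemma intervalIntegrable_S (hF : BoundedForce F) {φ : ℝ → ℝ} (hφ : Continuous φ) (a b : ℝ) :
    IntervalIntegrable (fun s => V.S (φ s) (F s)) volume a b := by
  obtain ⟨B, hB⟩ := hF.bound
  have hm : StronglyMeasurable fun s => V.S (φ s) (F s) :=
    V.continuous_S.comp_stronglyMeasurable (hφ.stronglyMeasurable.prodMk hF.meas)
  have hg : Continuous fun s => 2 * (1 + |φ s|) * B := by fun_prop
  refine (hg.intervalIntegrable a b).mono_fun hm.aestronglyMeasurable (ae_of_all _ fun s => ?_)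
  refine (V.norm_S_le _ _).trans (le_trans ?_ (Real.le_norm_self _))
  exact mul_le_mul_of_nonneg_left (hB s) (by positivity)

lemma norm_duhamel_sub_le {F₁ F₂ : ℝ → X} (h₁ : BoundedForce F₁) (h₂ : BoundedForce F₂)
    {T t : ℝ} (ht : t ∈ Icc 0 T) {u : ℝ → ℝ} (hu : Continuous u)
    (h : ∀ s ∈ Icc 0 t, ‖F₁ s - F₂ s‖ ≤ u s) :
    ‖V.duhamel F₁ t - V.duhamel F₂ t‖ ≤ 2 * (1 + T) * ∫ s in (0 : ℝ)..t, u s := by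
  rw [duhamel, duhamel, ← intervalIntegral.integral_sub
    (intervalIntegrable_S h₁ (by fun_prop) _ _) (intervalIntegrable_S h₂ (by fun_prop) _ _),
    ← intervalIntegral.integral_const_mul]
  refine intervalIntegral.norm_integral_le_of_norm_le ht.1 (ae_of_all _ fun s hs => ?_)
    ((hu.const_mul _).intervalIntegrable _ _)
  rw [← map_sub]
  refine (V.norm_S_le_of_mem (T := T) ?_ _).trans
    (mul_le_mul_of_nonneg_left (h s ⟨hs.1.le, hs.2⟩) ?_)
  · rw [abs_of_nonneg (by linarith [hs.2])]; linarith [hs.1, ht.2]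
  · linarith [ht.1, ht.2]

lemma duhamel_zero (t : ℝ) : V.duhamel (fun _ => 0) t = 0 := by simp [duhamel]

lemma norm_duhamel_le (hF : BoundedForce F) {T t : ℝ} (ht : t ∈ Icc 0 T) {u : ℝ → ℝ}
    (hu : Continuous u) (h : ∀ s ∈ Icc 0 t, ‖F s‖ ≤ u s) :
    ‖V.duhamel F t‖ ≤ 2 * (1 + T) * ∫ s in (0 : ℝ)..t, u s := by
  have := norm_duhamel_sub_le (V := V) hF boundedForce_zero ht hu (by simpa using h)
  rwa [duhamel_zero, sub_zero] at this

variable [CompleteSpace X]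

lemma duhamel_eq (hF : BoundedForce F) (t : ℝ) :
    V.duhamel F t = V.S t (∫ s in (0 : ℝ)..t, V.S (-s) (F s)) := by
  rw [← ContinuousLinearMap.intervalIntegral_comp_comm _
    (intervalIntegrable_S hF continuous_neg _ _)]
  refine intervalIntegral.integral_congr fun s _ => ?_
  rw [← V.S_add, sub_eq_add_neg]

lemma continuous_duhamel (hF : BoundedForce F) : Continuous (V.duhamel F) := by
  have h1 : Continuous fun t => ∫ s in (0 : ℝ)..t, V.S (-s) (F s) :=
    intervalIntegral.continuous_primitive (fun a b => intervalIntegrable_S hF continuous_neg a b) 0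
  simp only [funext (duhamel_eq (V := V) hF)]
  exact V.continuous_S.comp (continuous_id.prodMk h1)

/-- The evolution can be restarted at any time. -/
lemma S_add_duhamel (hF : BoundedForce F) (M₀ : X) (r t : ℝ) :
    V.S (r + t) M₀ + V.duhamel F (r + t)
      = V.S t (V.S r M₀ + V.duhamel F r) + V.duhamel (fun s => F (r + s)) t := by
  have hi : ∀ a b, IntervalIntegrable (fun s => V.S (r + t - s) (F s)) volume a b := fun a b =>
    intervalIntegrable_S hF (by fun_prop) a b
  rw [map_add, ← V.S_add, add_comm t r, add_assoc]
  congr 1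
  rw [duhamel, ← intervalIntegral.integral_add_adjacent_intervals (hi 0 r) (hi r (r + t)), duhamel,
    ← ContinuousLinearMap.intervalIntegral_comp_comm _
      (intervalIntegrable_S hF (by fun_prop) _ _)]
  congr 1
  · refine intervalIntegral.integral_congr fun s _ => ?_
    rw [← V.S_add]
    congr 2
    ring
  · rw [duhamel]
    have := intervalIntegral.integral_comp_add_left (a := 0) (b := t)
      (fun s => V.S (r + t - s) (F s)) r
    rw [add_zero] at this
    rw [← this]
    refine intervalIntegral.integral_congr fun s _ => ?_
    congr 2
    ring

variable [CompleteSpace L]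

/-- The position of a mild solution is differentiable, with derivative the velocity: a force acting
on the velocity alone moves the position only to second order in time. -/
lemma hasDerivAt_pos {g : ℝ → L} (hg : BoundedForce g) (M₀ : X) (t : ℝ) :
    HasDerivAt (fun s => V.pos (V.S s M₀ + V.duhamel (fun r => V.inj (g r)) s))
      (V.vel (V.S t M₀ + V.duhamel (fun r => V.inj (g r)) t)) t := by
  obtain ⟨B, hB⟩ := hg.bound
  have hF : BoundedForce fun r => V.inj (g r) :=
    ⟨V.inj.continuous.comp_stronglyMeasurable hg.meas, B, fun s => (V.norm_inj_le _).trans (hB s)⟩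
  set M := V.S t M₀ + V.duhamel (fun r => V.inj (g r)) t with hM
  have hB0 : 0 ≤ B := (norm_nonneg _).trans (hB 0)
  have h2 : HasDerivAt (fun s => V.pos (V.duhamel (fun r => V.inj (g (t + r))) s)) 0 0 := by
    rw [hasDerivAt_iff_isLittleO_nhds_zero]
    have hle : ∀ s, ‖V.pos (V.duhamel (fun r => V.inj (g (t + r))) s)‖ ≤ B * ‖s ^ 2‖ := fun s => by
      have hF' : BoundedForce fun r => V.inj (g (t + r)) :=
        ⟨hF.meas.comp_measurable (measurable_const_add t), B,
          fun s => (V.norm_inj_le _).trans (hB _)⟩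
      rw [duhamel, ← ContinuousLinearMap.intervalIntegral_comp_comm _
        (intervalIntegrable_S hF' (by fun_prop) _ _)]
      have := intervalIntegral.norm_integral_le_of_norm_le_const (a := 0) (b := s) (C := |s| * B)
        (f := fun r => V.pos (V.S (s - r) (V.inj (g (t + r))))) fun r hr => by
          refine (V.norm_pos_S_inj_le _ _).trans (mul_le_mul ?_ (hB _) (norm_nonneg _)
            (abs_nonneg _))
          rcases le_total 0 s with h0 | h0
          · rw [uIoc_of_le h0] at hr
            rw [abs_of_nonneg h0, abs_of_nonneg (by linarith [hr.2])]; linarith [hr.1]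
          · rw [uIoc_of_ge h0] at hr
            rw [abs_of_nonpos h0, abs_of_nonpos (by linarith [hr.1])]; linarith [hr.2]
      refine this.trans (le_of_eq ?_)
      rw [sub_zero, norm_pow, Real.norm_eq_abs]; ring
    have hO : (fun s => V.pos (V.duhamel (fun r => V.inj (g (t + r))) s))
        =O[𝓝 0] fun s : ℝ => s ^ 2 :=
      Asymptotics.IsBigO.of_bound B (Eventually.of_forall hle)
    have h0 : V.duhamel (fun r => V.inj (g (t + r))) 0 = 0 := by simp [duhamel]
    simpa [h0] using hO.trans_isLittleO (Asymptotics.isLittleO_pow_id one_lt_two)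
  have h3 := (V.hasDerivAt_pos_S M).add h2
  rw [add_zero, ← sub_self t] at h3
  have h4 := h3.comp_sub_const t t
  refine h4.congr_of_eventuallyEq (Eventually.of_forall fun s => ?_)
  have h5 := S_add_duhamel (V := V) hF M₀ t (s - t)
  rw [add_sub_cancel] at h5
  simp only [Pi.add_apply]
  rw [h5, map_add]

end WaveGroup

/-! ### Mild solutions: uniqueness, stability and existence -/

namespace WaveGroup

variable {X L : Type*} [NormedAddCommGroup X] [NormedSpace ℝ X] [NormedAddCommGroup L]
    [NormedSpace ℝ L] (V : WaveGroup X L)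

/-- The force `(0, G(s, m(s)))` along a curve `M = (m, v)`. -/
def force (G : ℝ → L → L) (M : ℝ → X) (s : ℝ) : X := V.inj (G s (V.pos (M s)))

/-- A mild solution on `[0, T]` with initial value `M₀`. For convenience the curve is continuous
and bounded on the whole real line, the values outside `[0, T]` being irrelevant. -/
structure MildSol (G : ℝ → L → L) (M₀ : X) (T : ℝ) (M : ℝ → X) : Prop where
  cont : Continuous M
  bdd : ∃ B, ∀ s, ‖M s‖ ≤ B
  eq : ∀ t ∈ Icc 0 T, M t = V.S t M₀ + V.duhamel (V.force G M) t

variable {V} {G : ℝ → L → L} {Λ : ℝ} {M₀ N₀ : X} {T : ℝ} {M N : ℝ → X}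

lemma boundedForce_comp (hG : Nonlinearity G Λ) (hM : Continuous M) (hb : ∃ B, ∀ s, ‖M s‖ ≤ B) :
    BoundedForce fun s => G s (V.pos (M s)) := by
  obtain ⟨B, hB⟩ := hb
  refine ⟨hG.stronglyMeasurable_comp (V.pos.continuous.comp hM), Λ * B, fun s => ?_⟩
  exact (hG.norm_le _ _).trans (mul_le_mul_of_nonneg_left
    ((V.norm_pos_le _).trans (hB s)) hG.nonneg)

lemma boundedForce_force (hG : Nonlinearity G Λ) (hM : Continuous M)
    (hb : ∃ B, ∀ s, ‖M s‖ ≤ B) : BoundedForce (V.force G M) := by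
  obtain ⟨h, B, hB⟩ := boundedForce_comp (V := V) hG hM hb
  exact ⟨V.inj.continuous.comp_stronglyMeasurable h, B, fun s => (V.norm_inj_le _).trans (hB s)⟩

lemma norm_force_sub_le (hG : Nonlinearity G Λ) (M N : ℝ → X) (s : ℝ) :
    ‖V.force G M s - V.force G N s‖ ≤ Λ * ‖M s - N s‖ := by
  rw [force, force, ← map_sub]
  refine (V.norm_inj_le _).trans ((hG.lip _ _ _).trans ?_)
  rw [← map_sub]
  exact mul_le_mul_of_nonneg_left (V.norm_pos_le _) hG.nonneg

lemma norm_force_le (hG : Nonlinearity G Λ) (M : ℝ → X) (s : ℝ) :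
    ‖V.force G M s‖ ≤ Λ * ‖M s‖ :=
  (V.norm_inj_le _).trans ((hG.norm_le _ _).trans
    (mul_le_mul_of_nonneg_left (V.norm_pos_le _) hG.nonneg))

lemma MildSol.zero (hT : 0 ≤ T) (hM : V.MildSol G M₀ T M) : M 0 = M₀ := by
  rw [hM.eq 0 ⟨le_rfl, hT⟩, V.S_zero]
  simp [duhamel]

/-- Lipschitz dependence of mild solutions on the initial value. -/
lemma MildSol.norm_sub_le (hG : Nonlinearity G Λ) (hM : V.MildSol G M₀ T M)
    (hN : V.MildSol G N₀ T N) {t : ℝ} (ht : t ∈ Icc 0 T) :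
    ‖M t - N t‖ ≤ 2 * (1 + T) * ‖M₀ - N₀‖ * Real.exp (2 * (1 + T) * Λ * T) := by
  have hT : 0 ≤ T := ht.1.trans ht.2
  have hC : 0 ≤ 2 * (1 + T) := by positivity
  have h := le_mul_exp_of_le_add_integral (u := fun s => ‖M s - N s‖)
    (hM.cont.sub hN.cont).norm (A := 2 * (1 + T) * ‖M₀ - N₀‖) (B := 2 * (1 + T) * Λ) (T := T)
    (mul_nonneg hC hG.nonneg) (fun r hr => ?_) t ht
  · refine h.trans (mul_le_mul_of_nonneg_left (Real.exp_le_exp.2 ?_) (by positivity))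
    exact mul_le_mul_of_nonneg_left ht.2 (mul_nonneg hC hG.nonneg)
  · rw [hM.eq r hr, hN.eq r hr, add_sub_add_comm, ← map_sub]
    refine (norm_add_le _ _).trans (add_le_add (V.norm_S_le_of_mem ?_ _) ?_)
    · rw [abs_of_nonneg hr.1]; exact hr.2
    · refine (norm_duhamel_sub_le (boundedForce_force hG hM.cont hM.bdd)
        (boundedForce_force hG hN.cont hN.bdd) hr
        ((hM.cont.sub hN.cont).norm.const_mul Λ) fun s _ => norm_force_sub_le hG M N s).trans
        (le_of_eq ?_)
      rw [intervalIntegral.integral_const_mul, ← mul_assoc]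
      rfl

lemma MildSol.eqOn (hG : Nonlinearity G Λ) (hM : V.MildSol G M₀ T M)
    (hN : V.MildSol G M₀ T N) : EqOn M N (Icc 0 T) := fun t ht => by
  have := MildSol.norm_sub_le hG hM hN ht
  rw [sub_self, norm_zero, mul_zero, zero_mul] at this
  exact sub_eq_zero.1 (norm_le_zero_iff.1 this)

/-- Mild solutions restricted to a shorter interval, for nonlinearities that agree there. -/
lemma MildSol.restrict {G' : ℝ → L → L} {T' : ℝ} (hT : T' ≤ T) (hM : V.MildSol G M₀ T M)
    (h : ∀ s ∈ Icc 0 T', G s = G' s) : V.MildSol G' M₀ T' M := by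
  refine ⟨hM.cont, hM.bdd, fun t ht => ?_⟩
  rw [hM.eq t ⟨ht.1, ht.2.trans hT⟩]
  congr 1
  refine intervalIntegral.integral_congr fun s hs => ?_
  rw [uIcc_of_le ht.1] at hs
  simp only [force, h s ⟨hs.1, hs.2.trans ht.2⟩]

/-- A continuous curve on `[0, T]` satisfying the Duhamel formula extends to a mild solution. -/
lemma MildSol.of_continuousOn (hT : 0 ≤ T) (hM : ContinuousOn M (Icc 0 T))
    (h : ∀ t ∈ Icc 0 T, M t = V.S t M₀ + V.duhamel (V.force G M) t) :
    V.MildSol G M₀ T (IccExtend hT ((Icc 0 T).domRestrict M)) := by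
  obtain ⟨B, hB⟩ := isCompact_Icc.exists_bound_of_continuousOn hM
  refine ⟨(continuousOn_iff_continuous_domRestrict.1 hM).Icc_extend', ⟨B, fun s => ?_⟩,
    fun t ht => ?_⟩
  · exact hB _ (projIcc 0 T hT s).2
  · rw [IccExtend_of_mem _ _ ht, domRestrict_apply, h t ht]
    congr 1
    refine intervalIntegral.integral_congr fun s hs => ?_
    rw [uIcc_of_le ht.1] at hs
    have hs' : s ∈ Icc 0 T := ⟨hs.1, hs.2.trans ht.2⟩
    simp only [force, IccExtend_of_mem _ _ hs', domRestrict_apply]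

variable [CompleteSpace X]

/-- The fixed-point map of the mild formulation on curves on `[0, T]`. -/
noncomputable def picard (hG : Nonlinearity G Λ) (hT : 0 ≤ T) (M₀ : X) (α : C(Icc 0 T, X)) :
    C(Icc 0 T, X) where
  toFun t := V.S t M₀ + V.duhamel (V.force G (IccExtend hT α)) t
  continuous_toFun := by
    have hb : ∃ B, ∀ s, ‖IccExtend hT α s‖ ≤ B := ⟨‖α‖, fun s => α.norm_coe_le_norm _⟩
    have h := continuous_duhamel (V := V)
      (boundedForce_force (V := V) hG (α.continuous.Icc_extend' (h := hT)) hb)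
    exact ((V.continuous_orbit M₀).comp continuous_subtype_val).add (h.comp continuous_subtype_val)

/-- The usual factorial gain for iterated Volterra operators. -/
lemma norm_picard_iterate_sub_le (hG : Nonlinearity G Λ) (hT : 0 ≤ T) (M₀ : X)
    (α β : C(Icc 0 T, X)) (k : ℕ) (t : Icc 0 T) :
    ‖(picard (V := V) hG hT M₀)^[k] α t - (picard (V := V) hG hT M₀)^[k] β t‖
      ≤ (2 * (1 + T) * Λ * t) ^ k / k.factorial * dist α β := by
  have hc := fun α : C(Icc 0 T, X) => α.continuous.Icc_extend' (h := hT)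
  have hb : ∀ α : C(Icc 0 T, X), ∃ B, ∀ s, ‖IccExtend hT α s‖ ≤ B := fun α =>
    ⟨‖α‖, fun s => α.norm_coe_le_norm _⟩
  induction k generalizing t with
  | zero =>
    simpa [← dist_eq_norm] using ContinuousMap.dist_apply_le_dist t
  | succ k ih =>
    rw [Function.iterate_succ_apply', Function.iterate_succ_apply']
    set a := (picard (V := V) hG hT M₀)^[k] α
    set b := (picard (V := V) hG hT M₀)^[k] β
    have h1 : picard (V := V) hG hT M₀ a t - picard (V := V) hG hT M₀ b t
        = V.duhamel (V.force G (IccExtend hT a)) t - V.duhamel (V.force G (IccExtend hT b)) t := by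
      simp [picard]
    rw [h1]
    refine (norm_duhamel_sub_le (boundedForce_force hG (hc a) (hb a))
      (boundedForce_force hG (hc b) (hb b)) t.2
      (u := fun s => Λ * ((2 * (1 + T) * Λ * s) ^ k / k.factorial * dist α β)) (by fun_prop)
      fun s hs => ?_).trans (le_of_eq ?_)
    · refine (norm_force_sub_le hG _ _ s).trans (mul_le_mul_of_nonneg_left ?_ hG.nonneg)
      have hs' : s ∈ Icc 0 T := ⟨hs.1, hs.2.trans t.2.2⟩
      rw [IccExtend_of_mem _ _ hs', IccExtend_of_mem _ _ hs']
      exact ih ⟨s, hs'⟩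
    · have e : ∀ s : ℝ, Λ * ((2 * (1 + T) * Λ * s) ^ k / k.factorial * dist α β)
          = (Λ * (2 * (1 + T) * Λ) ^ k / k.factorial * dist α β) * s ^ k := fun s => by
        rw [mul_pow]; ring
      simp only [e]
      rw [intervalIntegral.integral_const_mul, integral_pow, Nat.factorial_succ]
      have h2 : ((k : ℝ) + 1) ≠ 0 := by positivity
      have h3 : (k.factorial : ℝ) ≠ 0 := by positivity
      rw [mul_pow (2 * (1 + T) * Λ) (t : ℝ) (k + 1)]
      push_cast
      field_simp
      ring

/-- Global existence of mild solutions: some iterate of the Picard map is a contraction. -/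
theorem exists_mildSol (hG : Nonlinearity G Λ) (hT : 0 ≤ T) (M₀ : X) :
    ∃ M, V.MildSol G M₀ T M := by
  have hC : 0 ≤ 2 * (1 + T) * Λ := mul_nonneg (by positivity) hG.nonneg
  have hlim := FloorSemiring.tendsto_pow_div_factorial_atTop (2 * (1 + T) * Λ * T)
  obtain ⟨k, hk⟩ := (hlim.eventually (gt_mem_nhds one_half_pos)).exists
  have hcon : ContractingWith (1 / 2 : ℝ≥0) (picard (V := V) hG hT M₀)^[k] := by
    refine ⟨by rw [← NNReal.coe_lt_coe]; norm_num, LipschitzWith.of_dist_le_mul fun α β => ?_⟩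
    rw [ContinuousMap.dist_le (by positivity)]
    intro t
    rw [dist_eq_norm]
    refine (norm_picard_iterate_sub_le hG hT M₀ α β k t).trans
      (mul_le_mul_of_nonneg_right ?_ dist_nonneg)
    have h1 : (2 * (1 + T) * Λ * t) ^ k ≤ (2 * (1 + T) * Λ * T) ^ k :=
      pow_le_pow_left₀ (mul_nonneg hC t.2.1) (mul_le_mul_of_nonneg_left t.2.2 hC) k
    refine ((div_le_div_of_nonneg_right h1 (by positivity)).trans hk.le).trans ?_
    norm_num
  obtain ⟨α, hα⟩ : ∃ α, Function.IsFixedPt (picard (V := V) hG hT M₀) α :=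
    ⟨_, hcon.isFixedPt_fixedPoint_iterate⟩
  refine ⟨IccExtend hT α, α.continuous.Icc_extend', ⟨‖α‖, fun s => α.norm_coe_le_norm _⟩,
    fun t ht => ?_⟩
  rw [IccExtend_of_mem _ _ ht]
  exact (DFunLike.congr_fun hα ⟨t, ht⟩).symm

/-- Mild solutions restarted at a later time. -/
lemma MildSol.shift (hG : Nonlinearity G Λ) {G' : ℝ → L → L} {r T' : ℝ} (hr : 0 ≤ r)
    (hT : r + T' ≤ T) (hM : V.MildSol G M₀ T M) (h : ∀ s, 0 < s → G (r + s) = G' s) :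
    V.MildSol G' (M r) T' fun t => M (r + t) := by
  obtain ⟨B, hB⟩ := hM.bdd
  refine ⟨hM.cont.comp (continuous_const_add r), ⟨B, fun s => hB _⟩, fun t ht => ?_⟩
  have h0 := ht.1
  have h1 := ht.2
  rw [hM.eq (r + t) ⟨by linarith, by linarith⟩, hM.eq r ⟨by linarith, by linarith⟩,
    S_add_duhamel (boundedForce_force hG hM.cont hM.bdd)]
  congr 1
  refine intervalIntegral.integral_congr_ae (ae_of_all _ fun s hs => ?_)
  rw [uIoc_of_le ht.1] at hs
  simp only [force, h s hs.1]

end WaveGroup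

/-! ### The wave group on `H¹_ω × L²_ω` and controls -/

/-- The embedding of `H¹_ω` in `L²_ω` as a bounded operator. -/
noncomputable def toL2CLM (d : ℕ) : H1w d →L[ℝ] L2w d :=
  (WithLp.fstL 2 ℝ (L2w d) (PiLp 2 fun _ : Fin d => L2w d)).comp (H1w d).subtypeL

/-- The spectral data of `-(Δ - 2x·∇)` on `L²_ω` with form domain `H¹_ω`. -/
noncomputable def gaussSpectrum (d : ℕ) : WaveSpectrum (H1w d) (L2w d) (Fin d → ℕ) where
  j := toL2CLM d
  ρ := rho
  e := psiH1
  f := psiL2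
  bH := basisH1 d
  bL := basisL2 d
  ρ_nonneg := rho_nonneg
  bH_eq := basisH1_apply
  bL_eq := basisL2_apply
  inner_e := inner_psiH1

/-- The wave group on `H¹_ω × L²_ω`. -/
noncomputable def gaussGroup (d : ℕ) : WaveGroup (State d) (L2w d) := (gaussSpectrum d).waveGroup

lemma gaussGroup_pos {d : ℕ} (M : State d) : (gaussGroup d).pos M = toL2 M.fst := rfl

lemma gaussGroup_inj {d : ℕ} (g : L2w d) : (gaussGroup d).inj g = WithLp.toLp 2 (0, g) := rfl

lemma memLp_mul_bounded {d : ℕ} {f : EuclideanSpace ℝ (Fin d) → ℝ} (hf : Measurable f) {Θ : ℝ}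
    (hb : ∀ x, |f x| ≤ Θ) (u : L2w d) : MemLp (fun x => f x * u x) 2 (gaussW d) :=
  (Lp.memLp u).of_le_mul (hf.aestronglyMeasurable.mul (Lp.aestronglyMeasurable u))
    (ae_of_all _ fun x => by
      rw [norm_mul]; exact mul_le_mul_of_nonneg_right (hb x) (norm_nonneg _))

lemma coeFn_mulL2 {d : ℕ} {f : EuclideanSpace ℝ (Fin d) → ℝ} (hf : Measurable f) {Θ : ℝ}
    (hb : ∀ x, |f x| ≤ Θ) (u : L2w d) : mulL2 f u =ᵐ[gaussW d] fun x => f x * u x := by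
  have h := memLp_mul_bounded hf hb u
  rw [mulL2, dif_pos h]
  exact h.coeFn_toLp

lemma norm_mulL2_sub_le {d : ℕ} {f : EuclideanSpace ℝ (Fin d) → ℝ} (hf : Measurable f) {Θ : ℝ}
    (hb : ∀ x, |f x| ≤ Θ) (u v : L2w d) : ‖mulL2 f u - mulL2 f v‖ ≤ Θ * ‖u - v‖ := by
  refine Lp.norm_le_mul_norm_of_ae_le_mul ?_
  filter_upwards [coeFn_mulL2 hf hb u, coeFn_mulL2 hf hb v, Lp.coeFn_sub (mulL2 f u) (mulL2 f v),
    Lp.coeFn_sub u v] with x h1 h2 h3 h4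
  rw [h3, h4, Pi.sub_apply, Pi.sub_apply, h1, h2, ← mul_sub, norm_mul]
  exact mul_le_mul_of_nonneg_right (hb x) (norm_nonneg _)

lemma mulL2_zero {d : ℕ} {f : EuclideanSpace ℝ (Fin d) → ℝ} (hf : Measurable f) {Θ : ℝ}
    (hb : ∀ x, |f x| ≤ Θ) : mulL2 f (0 : L2w d) = 0 := by
  refine Lp.ext ?_
  filter_upwards [coeFn_mulL2 hf hb (0 : L2w d), Lp.coeFn_zero ℝ 2 (gaussW d)] with x hx h0
  rw [hx, h0]; simp

/-- A bounded and measurable control, with bound `Θ`. -/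
structure IsControl {d : ℕ} (θ : EuclideanSpace ℝ (Fin d) → ℝ → ℝ) (Θ : ℝ) : Prop where
  meas : Measurable (Function.uncurry θ)
  bound : ∀ x s, |θ x s| ≤ Θ

lemma IsControl.measurable_left {d : ℕ} {θ : EuclideanSpace ℝ (Fin d) → ℝ → ℝ} {Θ : ℝ}
    (h : IsControl θ Θ) (s : ℝ) : Measurable fun x => θ x s :=
  h.meas.comp (measurable_id.prodMk measurable_const)

/-- Multiplication by a control is measurable in time, because its Hermite coefficients are. -/
lemma IsControl.stronglyMeasurable_mulL2 {d : ℕ} {θ : EuclideanSpace ℝ (Fin d) → ℝ → ℝ} {Θ : ℝ}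
    (h : IsControl θ Θ) (u : L2w d) : StronglyMeasurable fun s => mulL2 (fun x => θ x s) u := by
  have hcoef : ∀ n, StronglyMeasurable fun s =>
      inner ℝ (basisL2 d n) (mulL2 (fun x => θ x s) u) := by
    intro n
    have hf : StronglyMeasurable (Function.uncurry fun (s : ℝ) (x : EuclideanSpace ℝ (Fin d)) =>
        θ x s * u x * basisL2 d n x) :=
      ((h.meas.comp measurable_swap).stronglyMeasurable.mul
        ((Lp.stronglyMeasurable u).comp_measurable measurable_snd)).mul
        ((Lp.stronglyMeasurable (basisL2 d n)).comp_measurable measurable_snd)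
    convert hf.integral_prod_right (ν := gaussW d) using 2 with s
    rw [L2.inner_def]
    refine integral_congr_ae ?_
    filter_upwards [coeFn_mulL2 (h.measurable_left s) (fun x => h.bound x s) u] with x hx
    rw [hx, Real.inner_apply, mul_comm]
  refine stronglyMeasurable_of_tendsto (atTop : Filter (Finset (Fin d → ℕ)))
    (f := fun F s => ∑ n ∈ F, inner ℝ (basisL2 d n) (mulL2 (fun x => θ x s) u) • basisL2 d n)
    (fun F => ?_) (tendsto_pi_nhds.2 fun s => ?_)
  · exact Finset.stronglyMeasurable_fun_sum _ fun n _ => (hcoef n).smul_const _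
  · have := (basisL2 d).hasSum_repr (mulL2 (fun x => θ x s) u)
    simp only [HilbertBasis.repr_apply_apply] at this
    exact this

/-- The nonlinearity `u ↦ -θ(·, s) u + σ(u)` on `L²_ω`. -/
noncomputable def nonlin {d : ℕ} {K : ℝ≥0} {σ : ℝ → ℝ} (hσ : LipschitzWith K σ) (hσ0 : σ 0 = 0)
    (θ : EuclideanSpace ℝ (Fin d) → ℝ → ℝ) (s : ℝ) (u : L2w d) : L2w d :=
  -mulL2 (fun x => θ x s) u + hσ.compLp hσ0 u

section

variable {d : ℕ} {K : ℝ≥0} {σ : ℝ → ℝ} {hσ : LipschitzWith K σ} {hσ0 : σ 0 = 0}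
    {θ : EuclideanSpace ℝ (Fin d) → ℝ → ℝ} {Θ T : ℝ} {M₀ : State d} {M : ℝ → State d}

lemma IsControl.nonneg (h : IsControl θ Θ) : 0 ≤ Θ := (abs_nonneg _).trans (h.bound 0 0)

lemma IsControl.nonlinearity (h : IsControl θ Θ) :
    Nonlinearity (nonlin hσ hσ0 θ) (Θ + K) where
  lip s u v := by
    have h1 := norm_mulL2_sub_le (h.measurable_left s) (fun x => h.bound x s) u v
    have h2 := hσ.norm_compLp_sub_le hσ0 u v
    calc ‖nonlin hσ hσ0 θ s u - nonlin hσ hσ0 θ s v‖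
        = ‖-(mulL2 (fun x => θ x s) u - mulL2 (fun x => θ x s) v)
          + (hσ.compLp hσ0 u - hσ.compLp hσ0 v)‖ := by
          congr 1; simp only [nonlin]; abel
      _ ≤ _ := by
          refine (norm_add_le _ _).trans ?_
          rw [norm_neg, add_mul]
          exact add_le_add h1 h2
  zero s := by
    rw [nonlin, mulL2_zero (h.measurable_left s) (fun x => h.bound x s), hσ.compLp_zero hσ0]
    simp
  meas u := (h.stronglyMeasurable_mulL2 u).neg.add stronglyMeasurable_const
  nonneg := add_nonneg h.nonneg K.2

lemma WaveGroup.MildSol.isMildSolution (h : IsControl θ Θ)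
    (hM : (gaussGroup d).MildSol (nonlin hσ hσ0 θ) M₀ T M) :
    IsMildSolution hσ hσ0 θ T M₀ M := by
  have hF := WaveGroup.boundedForce_force (V := gaussGroup d)
    (h.nonlinearity (hσ := hσ) (hσ0 := hσ0)) hM.cont hM.bdd
  have hg := WaveGroup.boundedForce_comp (V := gaussGroup d)
    (h.nonlinearity (hσ := hσ) (hσ0 := hσ0)) hM.cont hM.bdd
  refine ⟨hM.cont.continuousOn, fun t ht => ?_, fun t _ => ?_, hM.eq⟩
  · have hd := (WaveGroup.hasDerivAt_pos (V := gaussGroup d) hg M₀ t).hasDerivWithinAt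
      (s := Icc 0 T)
    have e := hM.eq t ht
    change M t = (gaussGroup d).S t M₀
      + (gaussGroup d).duhamel (fun r => (gaussGroup d).inj _) t at e
    rw [← e] at hd
    refine hd.congr (fun s hs => ?_) ?_
    · rw [hM.eq s hs]; rfl
    · rw [hM.eq t ht]; rfl
  · exact WaveGroup.intervalIntegrable_S (V := gaussGroup d) hF (continuous_sub_left t) 0 t

/-- A mild solution agrees on `[0, T]` with one that is continuous and bounded on the real line; with
`WaveGroup.MildSol.eqOn` this gives uniqueness. -/
lemma IsMildSolution.exists_mildSol (hT : 0 ≤ T) (hM : IsMildSolution hσ hσ0 θ T M₀ M) :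
    ∃ N, (gaussGroup d).MildSol (nonlin hσ hσ0 θ) M₀ T N ∧ EqOn M N (Icc 0 T) :=
  ⟨_, WaveGroup.MildSol.of_continuousOn (V := gaussGroup d) hT hM.continuousOn hM.duhamel,
    fun t ht => by rw [IccExtend_of_mem _ _ ht, domRestrict_apply]⟩

end

/-! ### Reachability -/

section

variable {d : ℕ} {K : ℝ≥0} {σ : ℝ → ℝ} (hσ : LipschitzWith K σ) (hσ0 : σ 0 = 0)

/-- Some control bounded by `Θ` steers the state `A` in time `t` into the ball of radius `ε`
around `B`. -/
def Reach (A : State d) (t : ℝ) (B : State d) (ε Θ : ℝ) : Prop :=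
  ∃ θ, IsControl θ Θ ∧ ∃ M, (gaussGroup d).MildSol (nonlin hσ hσ0 θ) A t M ∧ ‖M t - B‖ < ε

/-- The Lipschitz constant of the flow in time at most `T`, for controls bounded by `Θ`. -/
noncomputable def flowConst (K : ℝ≥0) (T Θ : ℝ) : ℝ :=
  2 * (1 + T) * Real.exp (2 * (1 + T) * (Θ + K) * T)

lemma flowConst_pos (K : ℝ≥0) {T : ℝ} (hT : 0 ≤ T) (Θ : ℝ) : 0 < flowConst K T Θ := by
  unfold flowConst; positivity

lemma flowConst_mono (K : ℝ≥0) {T T' Θ Θ' : ℝ} (hT : 0 ≤ T) (hTT : T ≤ T') (hΘ : 0 ≤ Θ)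
    (hΘΘ : Θ ≤ Θ') : flowConst K T Θ ≤ flowConst K T' Θ' := by
  have hK : (0 : ℝ) ≤ K := K.2
  have hT' : 0 ≤ T' := hT.trans hTT
  have hΘ' : 0 ≤ Θ' := hΘ.trans hΘΘ
  unfold flowConst
  gcongr

variable {hσ hσ0}

lemma Reach.mono {A B : State d} {t ε ε' Θ Θ' : ℝ} (h : Reach hσ hσ0 A t B ε Θ) (hε : ε ≤ ε')
    (hΘ : Θ ≤ Θ') : Reach hσ hσ0 A t B ε' Θ' := by
  obtain ⟨θ, hθ, M, hM, hMB⟩ := h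
  exact ⟨θ, ⟨hθ.meas, fun x s => (hθ.bound x s).trans hΘ⟩, M, hM, hMB.trans_le hε⟩

/-- Concatenation of controls. -/
lemma Reach.trans {A B C : State d} {s t δ ε Θ₁ Θ₂ : ℝ} (hs : 0 ≤ s) (ht : 0 ≤ t)
    (h₁ : Reach hσ hσ0 A s B δ Θ₁) (h₂ : Reach hσ hσ0 B t C ε Θ₂) :
    Reach hσ hσ0 A (s + t) C (ε + flowConst K t Θ₂ * δ) (max Θ₁ Θ₂) := by
  obtain ⟨θ₁, hθ₁, M₁, hM₁, hB⟩ := h₁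
  obtain ⟨θ₂, hθ₂, M₂, hM₂, hC⟩ := h₂
  let θ : EuclideanSpace ℝ (Fin d) → ℝ → ℝ := fun x r => if r ≤ s then θ₁ x r else θ₂ x (r - s)
  have hθ : IsControl θ (max Θ₁ Θ₂) := by
    refine ⟨Measurable.ite (measurableSet_le measurable_snd measurable_const) hθ₁.meas ?_,
      fun x r => ?_⟩
    · exact hθ₂.meas.comp (measurable_fst.prodMk (measurable_snd.sub_const s))
    · simp only [θ]
      split_ifs
      · exact (hθ₁.bound _ _).trans (le_max_left _ _)
      · exact (hθ₂.bound _ _).trans (le_max_right _ _)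
  have hG := hθ.nonlinearity (hσ := hσ) (hσ0 := hσ0)
  obtain ⟨M, hM⟩ := WaveGroup.exists_mildSol (V := gaussGroup d) hG (add_nonneg hs ht) A
  refine ⟨θ, hθ, M, hM, ?_⟩
  have r₁ : (gaussGroup d).MildSol (nonlin hσ hσ0 θ₁) A s M :=
    hM.restrict (by linarith) fun r hr => by
      funext u
      have : (fun x => θ x r) = fun x => θ₁ x r := by
        funext x; exact if_pos hr.2
      simp only [nonlin, this]
  have r₂ : (gaussGroup d).MildSol (nonlin hσ hσ0 θ₂) (M s) t fun r => M (s + r) :=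
    hM.shift hG hs le_rfl fun r hr => by
      funext u
      have : (fun x => θ x (s + r)) = fun x => θ₂ x r := by
        funext x
        simp only [θ]
        rw [if_neg (by linarith), add_sub_cancel_left]
      simp only [nonlin, this]
  have e₁ : M s = M₁ s := r₁.eqOn hθ₁.nonlinearity hM₁ ⟨hs, le_rfl⟩
  have e₂ := r₂.norm_sub_le hθ₂.nonlinearity hM₂ ⟨ht, le_rfl⟩
  calc ‖M (s + t) - C‖ ≤ ‖M (s + t) - M₂ t‖ + ‖M₂ t - C‖ := norm_sub_le_norm_sub_add_norm_sub _ _ _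
    _ < flowConst K t Θ₂ * δ + ε := by
        refine add_lt_add_of_le_of_lt (e₂.trans ?_) hC
        rw [e₁, flowConst, mul_right_comm]
        exact mul_le_mul_of_nonneg_left hB.le (by positivity)
    _ = _ := add_comm _ _

end

/-! ### Impulses on an abstract wave group -/

section

variable {d : ℕ} {K : ℝ≥0} {σ : ℝ → ℝ} {hσ : LipschitzWith K σ} {hσ0 : σ 0 = 0}

lemma mulL2_smul_left {f : EuclideanSpace ℝ (Fin d) → ℝ} (hf : Measurable f) {Θ : ℝ}
    (hb : ∀ x, |f x| ≤ Θ) (c : ℝ) (u : L2w d) : mulL2 (fun x => c * f x) u = c • mulL2 f u := by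
  have hb' : ∀ x, |c * f x| ≤ |c| * Θ := fun x => by
    rw [abs_mul]; exact mul_le_mul_of_nonneg_left (hb x) (abs_nonneg c)
  refine Lp.ext ?_
  filter_upwards [coeFn_mulL2 (hf.const_mul c) hb' u, coeFn_mulL2 hf hb u,
    Lp.coeFn_smul c (mulL2 f u)] with x h1 h2 h3
  rw [h1, h3, Pi.smul_apply, h2, smul_eq_mul, mul_assoc]

end

/-- The abstract form of an impulse: the strong force `τ⁻¹ B m` during the short time `τ`, with a
bounded perturbation `R`, has in the limit `τ → 0` the effect `(m, v) ↦ (m, v + B m)`. -/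
lemma WaveGroup.norm_impulse_le {X L : Type*} [NormedAddCommGroup X] [NormedSpace ℝ X]
    [NormedAddCommGroup L] [NormedSpace ℝ L] [CompleteSpace X] [CompleteSpace L]
    {V : WaveGroup X L} {B R : L → L} {b k : ℝ} (hb : 0 ≤ b) (hk : 0 ≤ k)
    (hB : ∀ u v, ‖B u - B v‖ ≤ b * ‖u - v‖) (hB0 : B 0 = 0)
    (hR : ∀ u v, ‖R u - R v‖ ≤ k * ‖u - v‖) (hR0 : R 0 = 0) (M₀ : X) {ε : ℝ} (hε : 0 < ε) :
    ∃ η > 0, η ≤ 1 ∧ ∀ τ, 0 < τ → τ ≤ η → ∀ M, V.MildSol (fun _ u => τ⁻¹ • B u + R u) M₀ τ M →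
      ‖M τ - (M₀ + V.inj (B (V.pos M₀)))‖ < ε := by
  set w := V.inj (B (V.pos M₀)) with hw
  -- A bound for the solution that is uniform in `τ`.
  set r := 4 * ‖M₀‖ * Real.exp (4 * (b + k)) with hr
  have hr0 : 0 ≤ r := by positivity
  have e1 : ∀ᶠ τ in 𝓝 (0 : ℝ), ‖V.S τ M₀ - M₀‖ < ε / 4 := by
    have := (tendsto_iff_norm_sub_tendsto_zero.1 (V.tendsto_S M₀)).eventually
      (gt_mem_nhds (show (0 : ℝ) < ε / 4 by positivity))
    exact this
  have e2 : ∀ᶠ τ in 𝓝 (0 : ℝ), ‖V.S τ w - w‖ < ε / 4 := by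
    have := (tendsto_iff_norm_sub_tendsto_zero.1 (V.tendsto_S w)).eventually
      (gt_mem_nhds (show (0 : ℝ) < ε / 4 by positivity))
    exact this
  have e3 : ∀ᶠ τ in 𝓝 (0 : ℝ), 4 * ((b + k) * r * τ) < ε / 4 :=
    (Continuous.tendsto' (by fun_prop) _ _ (by simp)).eventually
      (gt_mem_nhds (show (0 : ℝ) < ε / 4 by positivity))
  obtain ⟨η, hη, H⟩ := Metric.eventually_nhds_iff_ball.1 (e1.and (e2.and e3))
  refine ⟨min (η / 2) 1, by positivity, min_le_right _ _, fun τ hτ0 hτ M hM => ?_⟩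
  have hτη : τ < η := by linarith [hτ.trans (min_le_left _ _)]
  have hτ1 : τ ≤ 1 := hτ.trans (min_le_right _ _)
  have Hs : ∀ s ∈ Icc 0 τ, ‖V.S s M₀ - M₀‖ < ε / 4 ∧ ‖V.S s w - w‖ < ε / 4 ∧
      4 * ((b + k) * r * s) < ε / 4 := fun s hs => H s (by
    rw [mem_ball_zero_iff, Real.norm_of_nonneg hs.1]; linarith [hs.2])
  have hG : Nonlinearity (fun (_ : ℝ) u => τ⁻¹ • B u + R u) (τ⁻¹ * b + k) := by
    refine ⟨fun _ u v => ?_, fun _ => by simp [hB0, hR0], fun _ => stronglyMeasurable_const,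
      by positivity⟩
    rw [add_sub_add_comm, ← smul_sub, add_mul]
    refine (norm_add_le _ _).trans (add_le_add ?_ (hR u v))
    rw [norm_smul, Real.norm_of_nonneg (by positivity), mul_assoc]
    exact mul_le_mul_of_nonneg_left (hB u v) (by positivity)
  have hF := WaveGroup.boundedForce_force (V := V) hG hM.cont hM.bdd
  have hg := WaveGroup.boundedForce_comp (V := V) hG hM.cont hM.bdd
  have hbound : ∀ s ∈ Icc 0 τ, ‖M s‖ ≤ r := by
    intro s hs
    have h1 := le_mul_exp_of_le_add_integral hM.cont.norm (A := 4 * ‖M₀‖)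
      (B := 4 * (τ⁻¹ * b + k)) (T := τ) (by positivity) (fun t ht => ?_) s hs
    · refine h1.trans (mul_le_mul_of_nonneg_left (Real.exp_le_exp.2 ?_) (by positivity))
      calc 4 * (τ⁻¹ * b + k) * s ≤ 4 * (τ⁻¹ * b + k) * τ :=
            mul_le_mul_of_nonneg_left hs.2 (by positivity)
        _ = 4 * (b + k * τ) := by field_simp
        _ ≤ 4 * (b + k) := by nlinarith
    · rw [hM.eq t ht]
      refine (norm_add_le _ _).trans (add_le_add ?_ ?_)
      · refine (V.norm_S_le_of_mem (T := 1) ?_ _).trans (le_of_eq (by norm_num))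
        rw [abs_of_nonneg ht.1]; exact ht.2.trans hτ1
      · refine (norm_duhamel_le hF ⟨ht.1, ht.2.trans hτ1⟩ (hM.cont.norm.const_mul _)
          fun s _ => norm_force_le hG M s).trans (le_of_eq ?_)
        rw [intervalIntegral.integral_const_mul]
        ring
  have hpos : ∀ s ∈ Icc 0 τ, ‖V.pos (M s) - V.pos M₀‖ ≤ r * s := by
    intro s hs
    have hd : ∀ t ∈ Icc 0 τ, HasDerivWithinAt (fun t => V.pos (M t)) (V.vel (M t)) (Icc 0 τ) t := by
      intro t ht
      have hd := (WaveGroup.hasDerivAt_pos (V := V) hg M₀ t).hasDerivWithinAt (s := Icc 0 τ)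
      have e := hM.eq t ht
      change M t = V.S t M₀ + V.duhamel (fun r => V.inj _) t at e
      rw [← e] at hd
      refine hd.congr (fun s hs => ?_) ?_
      · rw [hM.eq s hs]; rfl
      · rw [hM.eq t ht]; rfl
    have := (convex_Icc 0 τ).norm_image_sub_le_of_norm_hasDerivWithin_le hd
      (fun t ht => (V.norm_vel_le _).trans (hbound t ht)) ⟨le_rfl, hτ0.le⟩ hs
    rwa [hM.zero hτ0.le, sub_zero, Real.norm_of_nonneg hs.1] at this
  -- The difference to the limit, with the constant force `τ⁻¹ w` in between.
  have hI : IntervalIntegrable (fun s => V.S (τ - s) (V.force (fun _ u => τ⁻¹ • B u + R u) M s))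
      volume 0 τ := intervalIntegrable_S hF (by fun_prop) _ _
  have hD : V.duhamel (V.force (fun _ u => τ⁻¹ • B u + R u) M) τ - w
      = ∫ s in (0 : ℝ)..τ, (V.S (τ - s) (V.force (fun _ u => τ⁻¹ • B u + R u) M s) - τ⁻¹ • w) := by
    rw [intervalIntegral.integral_sub hI intervalIntegrable_const, intervalIntegral.integral_const,
      sub_zero, smul_smul, mul_inv_cancel₀ hτ0.ne', one_smul]
    rfl
  have hDle : ‖V.duhamel (V.force (fun _ u => τ⁻¹ • B u + R u) M) τ - w‖
      ≤ (4 * (b + k) * r + τ⁻¹ * (ε / 4)) * |τ - 0| := by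
    rw [hD]
    refine intervalIntegral.norm_integral_le_of_norm_le_const fun s hs => ?_
    rw [uIoc_of_le hτ0.le] at hs
    have hs' : s ∈ Icc 0 τ := ⟨hs.1.le, hs.2⟩
    have hs'' : τ - s ∈ Icc 0 τ := ⟨by linarith [hs.2], by linarith [hs.1]⟩
    have d1 : V.S (τ - s) (V.force (fun _ u => τ⁻¹ • B u + R u) M s) - τ⁻¹ • w
        = V.S (τ - s) (V.inj (τ⁻¹ • (B (V.pos (M s)) - B (V.pos M₀)) + R (V.pos (M s))))
          + τ⁻¹ • (V.S (τ - s) w - w) := by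
      simp only [force, hw, map_add, map_smul, map_sub, smul_sub]
      abel
    have d2 : ‖τ⁻¹ • (B (V.pos (M s)) - B (V.pos M₀)) + R (V.pos (M s))‖ ≤ (b + k) * r := by
      rw [add_mul]
      refine (norm_add_le _ _).trans (add_le_add ?_ ?_)
      · rw [norm_smul, Real.norm_of_nonneg (by positivity), inv_mul_le_iff₀ hτ0]
        refine (hB _ _).trans ?_
        have := hpos s hs'
        calc b * ‖V.pos (M s) - V.pos M₀‖ ≤ b * (r * τ) :=
              mul_le_mul_of_nonneg_left (this.trans (mul_le_mul_of_nonneg_left hs.2 hr0)) hb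
          _ = τ * (b * r) := by ring
      · have := hR (V.pos (M s)) 0
        rw [hR0, sub_zero, sub_zero] at this
        exact this.trans (mul_le_mul_of_nonneg_left ((V.norm_pos_le _).trans (hbound s hs')) hk)
    rw [d1]
    refine (norm_add_le _ _).trans (add_le_add ?_ ?_)
    · refine (V.norm_S_le_of_mem (T := 1) ?_ _).trans ?_
      · rw [abs_of_nonneg hs''.1]; linarith [hs''.2]
      · calc 2 * (1 + 1) * ‖V.inj _‖ ≤ 2 * (1 + 1) * ((b + k) * r) :=
              mul_le_mul_of_nonneg_left ((V.norm_inj_le _).trans d2) (by norm_num)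
          _ = 4 * (b + k) * r := by ring
    · rw [norm_smul, Real.norm_of_nonneg (by positivity)]
      exact mul_le_mul_of_nonneg_left (Hs _ hs'').2.1.le (by positivity)
  have hlast := Hs τ ⟨hτ0.le, le_rfl⟩
  have hsum : (4 * (b + k) * r + τ⁻¹ * (ε / 4)) * |τ - 0| = 4 * ((b + k) * r * τ) + ε / 4 := by
    rw [sub_zero, abs_of_pos hτ0]; field_simp
  rw [hM.eq τ ⟨hτ0.le, le_rfl⟩, add_sub_add_comm]
  refine (norm_add_le _ _).trans_lt ?_
  rw [hsum] at hDle
  linarith [hlast.1, hlast.2.2]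

/-! ### Steering the velocity -/

section

variable {d : ℕ} {K : ℝ≥0} {σ : ℝ → ℝ} {hσ : LipschitzWith K σ} {hσ0 : σ 0 = 0}

/-- The control `-f/τ` on a short time interval of length `τ` acts as an impulse: it adds `f m` to
the velocity and leaves the position almost unchanged. -/
lemma reach_impulse {f : EuclideanSpace ℝ (Fin d) → ℝ} (hf : Measurable f) {Θ : ℝ}
    (hb : ∀ x, |f x| ≤ Θ) (m : H1w d) (v : L2w d) {ε δ : ℝ} (hε : 0 < ε) (hδ : 0 < δ) :
    ∃ τ, 0 < τ ∧ τ ≤ δ ∧ Reach hσ hσ0 (WithLp.toLp 2 (m, v)) τ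
      (WithLp.toLp 2 (m, v + mulL2 f (toL2 m))) ε (τ⁻¹ * Θ) := by
  have hΘ : 0 ≤ Θ := (abs_nonneg _).trans (hb 0)
  obtain ⟨η, hη, -, H⟩ := WaveGroup.norm_impulse_le (V := gaussGroup d) (B := mulL2 f)
    (R := hσ.compLp hσ0) hΘ K.2 (norm_mulL2_sub_le hf hb) (mulL2_zero hf hb)
    (hσ.norm_compLp_sub_le hσ0) (hσ.compLp_zero hσ0) (WithLp.toLp 2 (m, v)) hε
  have hτ : 0 < min η δ := lt_min hη hδ
  set τ := min η δ
  have hθ : IsControl (fun (x : EuclideanSpace ℝ (Fin d)) (_ : ℝ) => -τ⁻¹ * f x) (τ⁻¹ * Θ) :=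
    ⟨(hf.comp measurable_fst).const_mul _, fun x _ => by
      rw [abs_mul, abs_neg, abs_of_pos (inv_pos.2 hτ)]
      exact mul_le_mul_of_nonneg_left (hb x) (inv_pos.2 hτ).le⟩
  refine ⟨τ, hτ, min_le_right _ _, _, hθ, ?_⟩
  · have hG := hθ.nonlinearity (hσ := hσ) (hσ0 := hσ0)
    obtain ⟨M, hM⟩ := WaveGroup.exists_mildSol (V := gaussGroup d) hG hτ.le (WithLp.toLp 2 (m, v))
    refine ⟨M, hM, ?_⟩
    have e : (nonlin hσ hσ0 fun (x : EuclideanSpace ℝ (Fin d)) (_ : ℝ) => -τ⁻¹ * f x)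
        = fun _ u => τ⁻¹ • mulL2 f u + hσ.compLp hσ0 u := by
      funext s u
      rw [nonlin, mulL2_smul_left hf hb, neg_smul, neg_neg]
    rw [e] at hM
    have := H τ hτ (min_le_left _ _) M hM
    have e' : (WithLp.toLp 2 (m, v) : State d) + (gaussGroup d).inj
        (mulL2 f ((gaussGroup d).pos (WithLp.toLp 2 (m, v))))
        = WithLp.toLp 2 (m, v + mulL2 f (toL2 m)) := by
      rw [gaussGroup_inj, gaussGroup_pos, ← WithLp.toLp_add, Prod.mk_add_mk, add_zero]
      rfl
    rw [e'] at this
    exact this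

lemma norm_sq_L2w (u : L2w d) : ‖u‖ ^ 2 = ∫ x, u x ^ 2 ∂(gaussW d) := by
  rw [← real_inner_self_eq_norm_sq, L2.inner_def]
  refine integral_congr_ae (ae_of_all _ fun x => ?_)
  simp [sq]

/-- If `m` vanishes almost nowhere, then the products of `m` with bounded functions are dense. -/
lemma exists_bounded_mul_near {m : L2w d} (hm : ∀ᵐ x ∂(gaussW d), m x ≠ 0) (w : L2w d) {ε : ℝ}
    (hε : 0 < ε) : ∃ f : EuclideanSpace ℝ (Fin d) → ℝ, Measurable f ∧
      (∃ Θ, ∀ x, |f x| ≤ Θ) ∧ ‖mulL2 f m - w‖ < ε := by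
  have hmm : Measurable m := (Lp.stronglyMeasurable m).measurable
  have hwm : Measurable w := (Lp.stronglyMeasurable w).measurable
  let f : ℕ → EuclideanSpace ℝ (Fin d) → ℝ := fun k x => if |w x / m x| ≤ k then w x / m x else 0
  have hf : ∀ k, Measurable (f k) := fun k =>
    Measurable.ite (measurableSet_le (hwm.div hmm).abs measurable_const) (hwm.div hmm)
      measurable_const
  have hb : ∀ k x, |f k x| ≤ k := fun k x => by
    simp only [f]
    split_ifs with h
    · exact h
    · simp
  have key : Tendsto (fun k => ‖mulL2 (f k) m - w‖ ^ 2) atTop (𝓝 0) := by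
    simp only [norm_sq_L2w]
    rw [← integral_zero (EuclideanSpace ℝ (Fin d)) ℝ (μ := gaussW d)]
    refine tendsto_integral_of_dominated_convergence (fun x => w x ^ 2) (fun k => ?_)
      (Lp.memLp w).integrable_sq (fun k => ?_) ?_
    · exact (Lp.aestronglyMeasurable _).pow 2
    -- The difference is `0` where the quotient is kept, and `-w` where it is truncated.
    · filter_upwards [hm, coeFn_mulL2 (hf k) (hb k) m, Lp.coeFn_sub (mulL2 (f k) m) w]
        with x h1 h2 h3
      rw [h3, Pi.sub_apply, h2, Real.norm_of_nonneg (sq_nonneg _)]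
      simp only [f]
      split_ifs with h
      · rw [div_mul_cancel₀ _ h1, sub_self]; simpa using sq_nonneg _
      · simp
    · have h2 := ae_all_iff.2 fun k => coeFn_mulL2 (hf k) (hb k) m
      have h3 := ae_all_iff.2 fun k => Lp.coeFn_sub (mulL2 (f k) m) w
      filter_upwards [hm, h2, h3] with x h1 h2 h3
      refine tendsto_const_nhds.congr' ?_
      obtain ⟨k₀, hk₀⟩ := exists_nat_ge |w x / m x|
      filter_upwards [eventually_ge_atTop k₀] with k hk
      have hk' : |w x / m x| ≤ k := hk₀.trans (by exact_mod_cast hk)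
      rw [h3, Pi.sub_apply, h2]
      simp only [f]
      rw [if_pos hk', div_mul_cancel₀ _ h1, sub_self]
      simp
  obtain ⟨k, hk⟩ := (key.eventually (gt_mem_nhds (show (0 : ℝ) < ε ^ 2 by positivity))).exists
  exact ⟨f k, hf k, ⟨k, hb k⟩, lt_of_pow_lt_pow_left₀ 2 hε.le hk⟩

/-- Any velocity can be reached, approximately and in arbitrarily short time, from a position that
vanishes almost nowhere. -/
lemma reach_velocity {m : H1w d} (hm : ∀ᵐ x ∂(gaussW d), toL2 m x ≠ 0) (v v' : L2w d) {ε δ : ℝ}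
    (hε : 0 < ε) (hδ : 0 < δ) : ∃ τ, 0 < τ ∧ τ ≤ δ ∧ ∃ Θ,
      Reach hσ hσ0 (WithLp.toLp 2 (m, v)) τ (WithLp.toLp 2 (m, v')) ε Θ := by
  obtain ⟨f, hf, ⟨Θ, hb⟩, hfm⟩ := exists_bounded_mul_near hm (v' - v) (half_pos hε)
  obtain ⟨τ, hτ, hτδ, θ, hθ, M, hM, h⟩ :=
    reach_impulse (hσ := hσ) (hσ0 := hσ0) hf hb m v (half_pos hε) hδ
  refine ⟨τ, hτ, hτδ, _, θ, hθ, M, hM, ?_⟩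
  refine (norm_sub_le_norm_sub_add_norm_sub _
    (WithLp.toLp 2 (m, v + mulL2 f (toL2 m))) _).trans_lt ?_
  have e : (WithLp.toLp 2 (m, v + mulL2 f (toL2 m)) : State d) - WithLp.toLp 2 (m, v')
      = WithLp.toLp 2 (0, mulL2 f (toL2 m) - (v' - v)) := by
    rw [← WithLp.toLp_sub, Prod.mk_sub_mk, sub_self]
    congr 2
    abel
  have e' : ‖(WithLp.toLp 2 (0, mulL2 f (toL2 m) - (v' - v)) : State d)‖
      ≤ ‖mulL2 f (toL2 m) - (v' - v)‖ := (gaussGroup d).norm_inj_le _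
  rw [e]
  linarith

end

/-- The zero set of a nonzero polynomial is a null set, by Fubini and induction on the number of
variables. -/
lemma ae_eval_mvPolynomial_ne_zero {n : ℕ} {p : MvPolynomial (Fin n) ℝ} (hp : p ≠ 0) :
    ∀ᵐ x : Fin n → ℝ, MvPolynomial.eval x p ≠ 0 := by
  induction n with
  | zero =>
    refine ae_of_all _ fun x h => hp ?_
    rw [MvPolynomial.eq_C_of_isEmpty p, MvPolynomial.eval_C] at h
    rw [MvPolynomial.eq_C_of_isEmpty p, h, map_zero]
  | succ n ih =>
    set q := MvPolynomial.finSuccEquiv ℝ n p with hq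
    have hq0 : q ≠ 0 := by simpa [hq] using hp
    have hfin : {y : ℝ | q.eval (MvPolynomial.C y) = 0}.Finite := by
      refine (q.roots.toFinset.finite_toSet.preimage
        (MvPolynomial.C_injective (Fin n) ℝ).injOn).subset fun y hy => ?_
      simpa [hq0] using hy
    have hprod : ∀ᵐ z : ℝ × (Fin n → ℝ) ∂(volume.prod volume),
        MvPolynomial.eval (Fin.cons z.1 z.2) p ≠ 0 := by
      have hms : MeasurableSet {z : ℝ × (Fin n → ℝ) |
          MvPolynomial.eval (Fin.cons z.1 z.2 : Fin (n + 1) → ℝ) p ≠ 0} := by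
        refine (Continuous.measurable ?_) (measurableSet_singleton (0 : ℝ)).compl
        refine (MvPolynomial.continuous_eval p).comp (continuous_pi fun i => ?_)
        refine Fin.cases ?_ (fun j => ?_) i
        · simpa using continuous_fst
        · simp only [Fin.cons_succ]; fun_prop
      rw [Measure.ae_prod_iff_ae_ae hms]
      have h1 : ∀ᵐ y : ℝ, y ∉ {y : ℝ | q.eval (MvPolynomial.C y) = 0} :=
        measure_eq_zero_iff_ae_notMem.1 (hfin.measure_zero volume)
      filter_upwards [h1] with y hy
      filter_upwards [ih hy] with s hs
      rw [MvPolynomial.eval_eq_eval_mv_eval']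
      rw [Polynomial.eval_map]
      rw [← Polynomial.eval₂_id, Polynomial.hom_eval₂] at hs
      simpa using hs
    have := (volume_preserving_piFinSuccAbove
      (fun _ : Fin (n + 1) => ℝ) 0).quasiMeasurePreserving.ae hprod
    filter_upwards [this] with x hx
    convert hx using 2
    simp

/-! ### Finite Hermite sums -/

/-- The normalized Hermite function `ψ_n` as a function on `ℝ^d`. -/
noncomputable def psiFun {d : ℕ} (n : Fin d → ℕ) (x : EuclideanSpace ℝ (Fin d)) : ℝ :=
  (hermiteNorm n)⁻¹ * prodPoly (fun j => hermitePoly (n j)) x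

lemma continuous_psiFun {d : ℕ} (n : Fin d → ℕ) : Continuous (psiFun n) :=
  continuous_const.mul (continuous_prodPoly _)

lemma coeFn_psiL2 {d : ℕ} (n : Fin d → ℕ) : psiL2 n =ᵐ[gaussW d] psiFun n := by
  rw [psiL2_eq]
  filter_upwards [Lp.coeFn_smul (hermiteNorm n)⁻¹ (polyL2 fun j => hermitePoly (n j)),
    coeFn_polyL2 fun j => hermitePoly (n j)] with x h1 h2
  rw [h1, Pi.smul_apply, h2, smul_eq_mul, psiFun]

/-- The finite Hermite sum with coefficients `a` as an element of `L²_ω`. -/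
noncomputable def sumL2 {d : ℕ} (F : Finset (Fin d → ℕ)) (a : (Fin d → ℕ) → ℝ) : L2w d :=
  ∑ n ∈ F, a n • psiL2 n

/-- The finite Hermite sum with coefficients `a` as an element of `H¹_ω`. -/
noncomputable def sumH1 {d : ℕ} (F : Finset (Fin d → ℕ)) (a : (Fin d → ℕ) → ℝ) : H1w d :=
  ∑ n ∈ F, a n • psiH1 n

/-- The finite Hermite sum with coefficients `a` as a function on `ℝ^d`. -/
noncomputable def sumFun {d : ℕ} (F : Finset (Fin d → ℕ)) (a : (Fin d → ℕ) → ℝ)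
    (x : EuclideanSpace ℝ (Fin d)) : ℝ := ∑ n ∈ F, a n * psiFun n x

lemma toL2_sumH1 {d : ℕ} (F : Finset (Fin d → ℕ)) (a : (Fin d → ℕ) → ℝ) :
    toL2 (sumH1 F a) = sumL2 F a := by
  change toL2CLM d (sumH1 F a) = sumL2 F a
  rw [sumH1, sumL2, map_sum]
  refine Finset.sum_congr rfl fun n _ => ?_
  rw [map_smul]
  exact congrArg _ (psiH1_val n)

lemma coeFn_sumL2 {d : ℕ} (F : Finset (Fin d → ℕ)) (a : (Fin d → ℕ) → ℝ) :
    sumL2 F a =ᵐ[gaussW d] sumFun F a := by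
  classical
  unfold sumL2 sumFun
  induction F using Finset.induction_on with
  | empty =>
    simp only [Finset.sum_empty]
    exact Lp.coeFn_zero _ _ _
  | insert n F hn ih =>
    simp only [Finset.sum_insert hn]
    filter_upwards [ih, coeFn_psiL2 n, Lp.coeFn_smul (a n) (psiL2 n),
      Lp.coeFn_add (a n • psiL2 n) (∑ n ∈ F, a n • psiL2 n)] with x h1 h2 h3 h4
    rw [h4, Pi.add_apply, h3, Pi.smul_apply, h2, h1, smul_eq_mul]

lemma inner_sumL2 {d : ℕ} (F : Finset (Fin d → ℕ)) (a : (Fin d → ℕ) → ℝ) (n : Fin d → ℕ) :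
    inner ℝ (sumL2 F a) (psiL2 n) = if n ∈ F then a n else 0 := by
  classical
  rw [sumL2, sum_inner]
  simp only [real_inner_smul_left, orthonormal_iff_ite.1 (orthonormal_psiL2 d)]
  simp

lemma sumL2_eq_zero_iff {d : ℕ} {F : Finset (Fin d → ℕ)} {a : (Fin d → ℕ) → ℝ} :
    sumL2 F a = 0 ↔ ∀ n ∈ F, a n = 0 := by
  refine ⟨fun h n hn => ?_, fun h => Finset.sum_eq_zero fun n hn => by rw [h n hn, zero_smul]⟩
  have := inner_sumL2 F a n
  rw [h, inner_zero_left, if_pos hn] at this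
  exact this.symm

lemma sumH1_eq_zero_iff {d : ℕ} {F : Finset (Fin d → ℕ)} {a : (Fin d → ℕ) → ℝ} :
    sumH1 F a = 0 ↔ ∀ n ∈ F, a n = 0 := by
  rw [← sumL2_eq_zero_iff, ← toL2_sumH1]
  exact ⟨fun h => by rw [h]; rfl, fun h => toL2_injective d h⟩

/-- A nonzero finite Hermite sum is a nonzero polynomial, hence vanishes almost nowhere. -/
lemma ae_sumL2_ne_zero {d : ℕ} {F : Finset (Fin d → ℕ)} {a : (Fin d → ℕ) → ℝ}
    (h : sumL2 F a ≠ 0) : ∀ᵐ x ∂(gaussW d), sumL2 F a x ≠ 0 := by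
  let p : MvPolynomial (Fin d) ℝ := ∑ n ∈ F, MvPolynomial.C (a n * (hermiteNorm n)⁻¹) *
    ∏ j, Polynomial.aeval (MvPolynomial.X j) (hermitePoly (n j))
  have hp : ∀ x : EuclideanSpace ℝ (Fin d), MvPolynomial.eval x p = sumFun F a x := by
    intro x
    simp only [p, map_sum, map_mul, map_prod, MvPolynomial.eval_C, sumFun, psiFun, prodPoly,
      mul_assoc]
    refine Finset.sum_congr rfl fun n _ => ?_
    congr 2
    refine Finset.prod_congr rfl fun j _ => ?_
    have := Polynomial.map_aeval_eq_aeval_map (φ := RingHom.id ℝ)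
      (ψ := (MvPolynomial.eval (x : Fin d → ℝ))) (by ext; simp) (hermitePoly (n j))
      (MvPolynomial.X j)
    simpa using this
  have hp0 : p ≠ 0 := by
    intro h0
    refine h (Lp.ext ?_)
    filter_upwards [coeFn_sumL2 F a, Lp.coeFn_zero ℝ 2 (gaussW d)] with x h1 h2
    rw [h1, h2, ← hp, h0, map_zero, Pi.zero_apply]
  have hv := (PiLp.volume_preserving_ofLp (Fin d)).quasiMeasurePreserving.ae
    (ae_eval_mvPolynomial_ne_zero hp0)
  filter_upwards [coeFn_sumL2 F a, (gaussW_ac_volume d).ae_le hv] with x h1 h2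
  rw [h1, ← hp]
  exact h2

/-- The span of finitely many Hermite functions is invariant under the free evolution. -/
lemma S_sum {d : ℕ} (F : Finset (Fin d → ℕ)) (a b : (Fin d → ℕ) → ℝ) (t : ℝ) :
    (gaussGroup d).S t (WithLp.toLp 2 (sumH1 F a, sumL2 F b)) = WithLp.toLp 2
      (sumH1 F fun n => a n * Real.cos (√(rho n) * t) + b n * sinOver (rho n) t,
       sumL2 F fun n => -√(rho n) * a n * Real.sin (√(rho n) * t)
        + b n * Real.cos (√(rho n) * t)) := by
  have ha : ∀ a b n, (gaussSpectrum d).a (WithLp.toLp 2 (sumH1 F a, sumL2 F b)) n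
      = if n ∈ F then a n else 0 := fun a b n =>
    (congrArg (inner ℝ · (psiL2 n)) (toL2_sumH1 F a)).trans (inner_sumL2 F a n)
  have hb : ∀ a b n, (gaussSpectrum d).b (WithLp.toLp 2 (sumH1 F a, sumL2 F b)) n
      = if n ∈ F then b n else 0 := fun a b n =>
    inner_sumL2 F b n
  change (gaussSpectrum d).evol t _ = _
  refine (gaussSpectrum d).ext (fun n => ?_) fun n => ?_
  · rw [WaveSpectrum.a_evol, ha, hb, ha]
    change (if n ∈ F then a n else 0) * Real.cos (√(rho n) * t)
      + (if n ∈ F then b n else 0) * sinOver (rho n) t = _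
    split_ifs <;> simp
  · rw [WaveSpectrum.b_evol, ha, hb, hb]
    change -√(rho n) * (if n ∈ F then a n else 0) * Real.sin (√(rho n) * t)
      + (if n ∈ F then b n else 0) * Real.cos (√(rho n) * t) = _
    split_ifs <;> simp

/-! ### Steering between finite Hermite sums -/

section

variable {d : ℕ} {K : ℝ≥0} {σ : ℝ → ℝ} {hσ : LipschitzWith K σ} {hσ0 : σ 0 = 0}

/-- Along a free trajectory in the span of finitely many Hermite functions, the bounded control
`θ = σ(m)/m` cancels the nonlinearity, so that the free trajectory is an exact solution. -/
lemma reach_free (F : Finset (Fin d → ℕ)) (a b : (Fin d → ℕ) → ℝ) {t ε : ℝ} (ht : 0 ≤ t)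
    (hε : 0 < ε) : Reach hσ hσ0 (WithLp.toLp 2 (sumH1 F a, sumL2 F b)) t
      ((gaussGroup d).S t (WithLp.toLp 2 (sumH1 F a, sumL2 F b))) ε K := by
  set A : State d := WithLp.toLp 2 (sumH1 F a, sumL2 F b) with hA
  let c : ℝ → (Fin d → ℕ) → ℝ := fun s n =>
    a n * Real.cos (√(rho n) * s) + b n * sinOver (rho n) s
  let θ : EuclideanSpace ℝ (Fin d) → ℝ → ℝ := fun x s => σ (sumFun F (c s) x) / sumFun F (c s) x
  have hcont : Continuous fun z : EuclideanSpace ℝ (Fin d) × ℝ => sumFun F (c z.2) z.1 := by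
    refine continuous_finsetSum _ fun n _ => ?_
    have h1 := continuous_sinOver (rho_nonneg n)
    have h2 := continuous_psiFun n
    fun_prop
  have hσle : ∀ y, |σ y| ≤ K * |y| := fun y => by
    have := hσ.dist_le_mul y 0
    rwa [hσ0, dist_zero_right, dist_zero_right] at this
  have hθ : IsControl θ K := by
    refine ⟨((hσ.continuous.comp hcont).measurable).div hcont.measurable, fun x s => ?_⟩
    simp only [θ]
    rw [abs_div]
    exact div_le_of_le_mul₀ (abs_nonneg _) K.2 (hσle _)
  have hzero : ∀ s, nonlin hσ hσ0 θ s (sumL2 F (c s)) = 0 := by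
    intro s
    rw [nonlin, neg_add_eq_zero]
    refine Lp.ext ?_
    filter_upwards [coeFn_mulL2 (hθ.measurable_left s) (fun x => hθ.bound x s) (sumL2 F (c s)),
      hσ.coeFn_compLp hσ0 (sumL2 F (c s)), coeFn_sumL2 F (c s)] with x h1 h2 h3
    rw [h1, h2, Function.comp, h3]
    simp only [θ]
    -- At a zero of `m` the quotient `σ(m)/m` is `0`, and `σ(m)` vanishes as well.
    by_cases h0 : sumFun F (c s) x = 0
    · rw [h0, hσ0, mul_zero]
    · rw [div_mul_cancel₀ _ h0]
  have hpos : ∀ s, (gaussGroup d).pos ((gaussGroup d).S s A) = sumL2 F (c s) := fun s => by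
    rw [hA, S_sum, gaussGroup_pos]
    exact toL2_sumH1 F _
  refine ⟨θ, hθ, _, WaveGroup.MildSol.of_continuousOn (V := gaussGroup d) ht
    ((gaussGroup d).continuous_orbit A).continuousOn fun s _ => ?_, ?_⟩
  · have : (gaussGroup d).force (nonlin hσ hσ0 θ) (fun t => (gaussGroup d).S t A)
        = fun _ => 0 := by
      funext r
      rw [WaveGroup.force, hpos, hzero, map_zero]
    rw [this, WaveGroup.duhamel_zero, add_zero]
  · rw [IccExtend_of_mem _ _ (⟨ht, le_rfl⟩ : t ∈ Icc 0 t), domRestrict_apply, sub_self, norm_zero]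
    exact hε

/-- Only finitely many frequencies are involved, so for a short time none of them completes half
a period. -/
lemma exists_sinOver_ne_zero (F : Finset (Fin d → ℕ)) {δ : ℝ} (hδ : 0 < δ) :
    ∃ τ, 0 < τ ∧ τ ≤ δ ∧ ∀ n ∈ F, sinOver (rho n) τ ≠ 0 := by
  have h0 : ∀ n : Fin d → ℕ,
      Tendsto (fun t => t⁻¹ * sinOver (rho n) t) (𝓝[>] 0) (𝓝 1) := fun n => by
    have := (hasDerivAt_sinOver (rho_nonneg n) 0)
    rw [hasDerivAt_iff_tendsto_slope_zero] at this
    simp only [zero_add, sinOver_zero, sub_zero, smul_eq_mul, mul_zero, Real.cos_zero] at this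
    exact this.mono_left (nhdsWithin_mono _ fun x hx => ne_of_gt hx)
  have h1 : ∀ᶠ t in 𝓝[>] (0 : ℝ), ∀ n ∈ F, sinOver (rho n) t ≠ 0 := by
    rw [Filter.eventually_all_finset]
    intro n _
    filter_upwards [(h0 n).eventually_ne one_ne_zero] with t ht h
    exact ht (by rw [h, mul_zero])
  have h2 : ∀ᶠ t in 𝓝[>] (0 : ℝ), t ∈ Ioc 0 δ := Ioc_mem_nhdsGT hδ
  obtain ⟨τ, hτ, h⟩ := (h2.and h1).exists
  exact ⟨τ, hτ.1, hτ.2, h⟩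

/-- From a nonzero finite Hermite sum to another one, in arbitrarily short time: an impulse gives
the velocity for which the free evolution passes exactly from one position to the other, and a
second impulse corrects the velocity. -/
lemma reach_sum {F : Finset (Fin d → ℕ)} {a a' : (Fin d → ℕ) → ℝ} (ha : sumH1 F a ≠ 0)
    (ha' : sumH1 F a' ≠ 0) (v v' : L2w d) {ε δ : ℝ} (hε : 0 < ε) (hδ : 0 < δ) :
    ∃ τ, 0 < τ ∧ τ ≤ δ ∧ ∃ Θ, Reach hσ hσ0 (WithLp.toLp 2 (sumH1 F a, v)) τ
      (WithLp.toLp 2 (sumH1 F a', v')) ε Θ := by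
  have hae : ∀ a, sumH1 F a ≠ 0 → ∀ᵐ x ∂(gaussW d), toL2 (sumH1 F a) x ≠ 0 := fun a ha => by
    rw [toL2_sumH1]
    refine ae_sumL2_ne_zero fun h => ha ?_
    rw [sumH1_eq_zero_iff, ← sumL2_eq_zero_iff, h]
  obtain ⟨τ, hτ, hτδ, hsin⟩ := exists_sinOver_ne_zero F (show 0 < δ / 3 by positivity)
  let r : (Fin d → ℕ) → ℝ := fun n =>
    (a' n - a n * Real.cos (√(rho n) * τ)) / sinOver (rho n) τ
  let q : (Fin d → ℕ) → ℝ := fun n =>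
    -√(rho n) * a n * Real.sin (√(rho n) * τ) + r n * Real.cos (√(rho n) * τ)
  have hS : (gaussGroup d).S τ (WithLp.toLp 2 (sumH1 F a, sumL2 F r))
      = WithLp.toLp 2 (sumH1 F a', sumL2 F q) := by
    rw [S_sum]
    congr 2
    refine Finset.sum_congr rfl fun n hn => ?_
    simp only [r]
    rw [div_mul_cancel₀ _ (hsin n hn), add_sub_cancel]
  -- The controls are chosen backwards in time: the tolerance of each depends on the bound for the
  -- later ones.
  obtain ⟨τ₂, hτ₂, hτ₂δ, Θ₂, h₂⟩ := reach_velocity (hσ := hσ) (hσ0 := hσ0) (hae a' ha')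
    (sumL2 F q) v' (show 0 < ε / 3 by positivity) (show 0 < δ / 3 by positivity)
  have hc₂ := flowConst_pos K hτ₂.le Θ₂
  have h₁ := reach_free (hσ := hσ) (hσ0 := hσ0) F a r hτ.le
    (show 0 < ε / 3 / flowConst K τ₂ Θ₂ by positivity)
  rw [hS] at h₁
  have h₁₂ := h₁.trans hτ.le hτ₂.le h₂
  rw [mul_div_cancel₀ _ hc₂.ne'] at h₁₂
  have hc₁ := flowConst_pos K (add_pos hτ hτ₂).le (max (K : ℝ) Θ₂)
  obtain ⟨τ₀, hτ₀, hτ₀δ, Θ₀, h₀⟩ := reach_velocity (hσ := hσ) (hσ0 := hσ0) (hae a ha) v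
    (sumL2 F r) (show 0 < ε / 3 / flowConst K (τ + τ₂) (max (K : ℝ) Θ₂) by positivity)
    (show 0 < δ / 3 by positivity)
  have h := h₀.trans hτ₀.le (add_pos hτ hτ₂).le h₁₂
  rw [mul_div_cancel₀ _ hc₁.ne'] at h
  exact ⟨τ₀ + (τ + τ₂), by positivity, by linarith, _, h.mono (by linarith) le_rfl⟩

lemma exists_sumH1 {u : H1w d} (hu : u ∈ Submodule.span ℝ (range (psiH1 (d := d)))) :
    ∃ F a, u = sumH1 F a := by
  obtain ⟨c, hc⟩ := Finsupp.mem_span_range_iff_exists_finsupp.1 hu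
  exact ⟨c.support, c, hc.symm⟩

lemma exists_sumL2 {u : L2w d} (hu : u ∈ Submodule.span ℝ (range (psiL2 (d := d)))) :
    ∃ F a, u = sumL2 F a := by
  obtain ⟨c, hc⟩ := Finsupp.mem_span_range_iff_exists_finsupp.1 hu
  exact ⟨c.support, c, hc.symm⟩

/-- A finite Hermite sum over a larger index set. -/
lemma exists_sumH1_of_subset {F F' : Finset (Fin d → ℕ)} (h : F ⊆ F') (a : (Fin d → ℕ) → ℝ) :
    ∃ a', sumH1 F a = sumH1 F' a' := by
  classical
  refine ⟨fun n => if n ∈ F then a n else 0, ?_⟩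
  rw [sumH1, sumH1, ← Finset.sum_subset h (fun n _ hn => by rw [if_neg hn, zero_smul])]
  exact Finset.sum_congr rfl fun n hn => by rw [if_pos hn]

/-- `reach_sum` for elements of the span, over a common index set. -/
lemma reach_span {u u' : H1w d} (hu : u ∈ Submodule.span ℝ (range (psiH1 (d := d)))) (hu0 : u ≠ 0)
    (hu' : u' ∈ Submodule.span ℝ (range (psiH1 (d := d)))) (hu'0 : u' ≠ 0) (v v' : L2w d)
    {ε δ : ℝ} (hε : 0 < ε) (hδ : 0 < δ) :
    ∃ τ, 0 < τ ∧ τ ≤ δ ∧ ∃ Θ, Reach hσ hσ0 (WithLp.toLp 2 (u, v)) τ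
      (WithLp.toLp 2 (u', v')) ε Θ := by
  classical
  obtain ⟨F₁, a₁, h₁⟩ := exists_sumH1 hu
  obtain ⟨F₂, a₂, h₂⟩ := exists_sumH1 hu'
  obtain ⟨b₁, e₁⟩ := exists_sumH1_of_subset (Finset.subset_union_left (s₁ := F₁) (s₂ := F₂)) a₁
  obtain ⟨b₂, e₂⟩ := exists_sumH1_of_subset (Finset.subset_union_right (s₁ := F₁) (s₂ := F₂)) a₂
  have e₁' := h₁.trans e₁
  have e₂' := h₂.trans e₂
  rw [e₁'] at hu0 ⊢
  rw [e₂'] at hu'0 ⊢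
  exact reach_sum hu0 hu'0 v v' hε hδ

lemma psiL2_ne_zero (n : Fin d → ℕ) : psiL2 n ≠ 0 := (orthonormal_psiL2 d).ne_zero n

lemma psiH1_ne_zero (n : Fin d → ℕ) : psiH1 n ≠ 0 := fun h => psiL2_ne_zero n (by
  rw [← psiH1_val, h]; rfl)

/-- The constant state `(ψ_0, 0)` is at rest in the free evolution. -/
lemma reach_rest {t ε : ℝ} (ht : 0 ≤ t) (hε : 0 < ε) :
    Reach hσ hσ0 (WithLp.toLp 2 (psiH1 (0 : Fin d → ℕ), 0)) t
      (WithLp.toLp 2 (psiH1 (0 : Fin d → ℕ), 0)) ε K := by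
  have h := reach_free (hσ := hσ) (hσ0 := hσ0) {(0 : Fin d → ℕ)} (fun _ => 1) (fun _ => 0) ht hε
  rw [S_sum] at h
  simpa [sumH1, sumL2, rho] using h

/-- Nonzero finite Hermite sums are dense in `H¹_ω`. -/
lemma exists_span_near (u : H1w d) {ε : ℝ} (hε : 0 < ε) :
    ∃ p ∈ Submodule.span ℝ (range (psiH1 (d := d))), p ≠ 0 ∧ ‖p - u‖ < ε := by
  have hle : Submodule.span ℝ (range (basisH1 d)) ≤ Submodule.span ℝ (range (psiH1 (d := d))) := by
    rw [Submodule.span_le]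
    rintro _ ⟨n, rfl⟩
    rw [SetLike.mem_coe, basisH1_apply]
    exact Submodule.smul_mem _ _ (Submodule.subset_span ⟨n, rfl⟩)
  have hd : u ∈ closure (Submodule.span ℝ (range (basisH1 d)) : Set (H1w d)) := by
    rw [← Submodule.topologicalClosure_coe, (basisH1 d).dense_span]
    trivial
  obtain ⟨p, hp, hpu⟩ := Metric.mem_closure_iff.1 hd (ε / 2) (half_pos hε)
  rw [dist_comm, dist_eq_norm] at hpu
  by_cases h0 : p = 0
  · -- In this case `u` is small, and a small multiple of `ψ_0` will do.
    have hψ : 0 < ‖psiH1 (0 : Fin d → ℕ)‖ := norm_pos_iff.2 (psiH1_ne_zero 0)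
    refine ⟨(ε / 4 / ‖psiH1 (0 : Fin d → ℕ)‖) • psiH1 0,
      Submodule.smul_mem _ _ (Submodule.subset_span ⟨0, rfl⟩),
      smul_ne_zero (by positivity) (psiH1_ne_zero 0), ?_⟩
    rw [h0, zero_sub, norm_neg] at hpu
    refine (norm_sub_le _ _).trans_lt ?_
    rw [norm_smul, Real.norm_of_nonneg (by positivity), div_mul_cancel₀ _ hψ.ne']
    linarith
  · exact ⟨p, hle hp, h0, by linarith⟩

/-- Approximate controllability from a position that is a nonzero finite Hermite sum. The time left
over is spent at the rest state `(ψ_0, 0)`. -/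
lemma reach_of_position {u : H1w d} (hu : u ∈ Submodule.span ℝ (range (psiH1 (d := d))))
    (hu0 : u ≠ 0) (v : L2w d) (B : State d) {T ε : ℝ} (hT : 0 < T) (hε : 0 < ε) :
    ∃ Θ, Reach hσ hσ0 (WithLp.toLp 2 (u, v)) T B ε Θ := by
  obtain ⟨p, hp, hp0, hpB⟩ := exists_span_near B.fst (show 0 < ε / 4 by positivity)
  have hψ : psiH1 (0 : Fin d → ℕ) ∈ Submodule.span ℝ (range (psiH1 (d := d))) :=
    Submodule.subset_span ⟨0, rfl⟩
  obtain ⟨τ₂, hτ₂, hτ₂T, Θ₂, h₂⟩ := reach_span (hσ := hσ) (hσ0 := hσ0) hψ (psiH1_ne_zero 0) hp hp0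
    0 B.snd (show 0 < ε / 4 by positivity) (show 0 < T / 3 by positivity)
  have hc₂ := flowConst_pos K hτ₂.le Θ₂
  have hc := flowConst_pos K hT.le (max (K : ℝ) Θ₂)
  obtain ⟨τ₁, hτ₁, hτ₁T, Θ₁, h₁⟩ := reach_span (hσ := hσ) (hσ0 := hσ0) hu hu0 hψ (psiH1_ne_zero 0)
    v 0 (show 0 < ε / 4 / flowConst K T (max (K : ℝ) Θ₂) by positivity)
    (show 0 < T / 3 by positivity)
  have hw : 0 ≤ T - τ₁ - τ₂ := by linarith
  have h₁₂ := (reach_rest (hσ := hσ) (hσ0 := hσ0) hw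
    (show 0 < ε / 4 / flowConst K τ₂ Θ₂ by positivity)).trans hw hτ₂.le h₂
  rw [mul_div_cancel₀ _ hc₂.ne'] at h₁₂
  obtain ⟨θ, hθ, M, hM, h⟩ := h₁.trans hτ₁.le (by linarith) h₁₂
  rw [show τ₁ + (T - τ₁ - τ₂ + τ₂) = T by ring] at hM h
  refine ⟨_, θ, hθ, M, hM, ?_⟩
  have hle : flowConst K (T - τ₁ - τ₂ + τ₂) (max (K : ℝ) Θ₂)
      * (ε / 4 / flowConst K T (max (K : ℝ) Θ₂)) ≤ ε / 4 := by
    rw [mul_div_assoc', div_le_iff₀ hc, mul_comm]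
    exact mul_le_mul_of_nonneg_left (flowConst_mono K (by linarith) (by linarith)
      (le_max_of_le_left K.2) le_rfl) (by positivity)
  have hB : ‖(WithLp.toLp 2 (p, B.snd) : State d) - B‖ < ε / 4 := by
    have e : ‖(WithLp.toLp 2 (p, B.snd) : State d) - B‖ ^ 2 = ‖p - B.fst‖ ^ 2 := by
      rw [WithLp.prod_norm_sq_eq_of_L2]
      simp
    rw [(sq_eq_sq₀ (norm_nonneg _) (norm_nonneg _)).1 e]
    exact hpB
  have := norm_sub_le_norm_sub_add_norm_sub (M T) (WithLp.toLp 2 (p, B.snd)) B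
  linarith

/-- Approximate controllability from position `0`, with velocity a nonzero finite Hermite sum: the
free evolution at once produces a nonzero position. -/
lemma reach_of_velocity {v : L2w d} (hv : v ∈ Submodule.span ℝ (range (psiL2 (d := d))))
    (hv0 : v ≠ 0) (B : State d) {T ε : ℝ} (hT : 0 < T) (hε : 0 < ε) :
    ∃ Θ, Reach hσ hσ0 (WithLp.toLp 2 (0, v)) T B ε Θ := by
  obtain ⟨F, b, rfl⟩ := exists_sumL2 hv
  obtain ⟨τ, hτ, hτT, hsin⟩ := exists_sinOver_ne_zero F (half_pos hT)
  let c : (Fin d → ℕ) → ℝ := fun n => 0 * Real.cos (√(rho n) * τ) + b n * sinOver (rho n) τ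
  have hc0 : sumH1 F c ≠ 0 := by
    intro h
    refine hv0 (sumL2_eq_zero_iff.2 fun n hn => ?_)
    have := sumH1_eq_zero_iff.1 h n hn
    simp only [c, zero_mul, zero_add] at this
    exact (mul_eq_zero.1 this).resolve_right (hsin n hn)
  have hc : sumH1 F c ∈ Submodule.span ℝ (range (psiH1 (d := d))) :=
    Submodule.sum_mem _ fun n _ => Submodule.smul_mem _ _ (Submodule.subset_span ⟨n, rfl⟩)
  have hT' : 0 < T - τ := by linarith
  obtain ⟨Θ, h₂⟩ := reach_of_position (hσ := hσ) (hσ0 := hσ0) hc hc0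
    (sumL2 F fun n => -√(rho n) * 0 * Real.sin (√(rho n) * τ) + b n * Real.cos (√(rho n) * τ)) B
    hT' (half_pos hε)
  have hk := flowConst_pos K hT'.le Θ
  have h₁ := reach_free (hσ := hσ) (hσ0 := hσ0) F (fun _ => 0) b hτ.le
    (show 0 < ε / 2 / flowConst K (T - τ) Θ by positivity)
  rw [S_sum] at h₁
  have h := h₁.trans hτ.le hT'.le h₂
  rw [mul_div_cancel₀ _ hk.ne', add_halves, add_sub_cancel,
    sumH1_eq_zero_iff.2 (fun n _ => rfl)] at h
  exact ⟨_, h⟩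

end

end GaussianWave

open GaussianWave in
theorem mainTheorem3 (d : ℕ) (K : ℝ≥0) (σ : ℝ → ℝ) (hσ : LipschitzWith K σ) (hσ0 : σ 0 = 0)
    (m₀ : GaussianWave.H1w d) (m₀' : GaussianWave.L2w d)
    (p : ℝ≥0∞) (hp : 2 < p)
    (hloc : ∀ B : Set (EuclideanSpace ℝ (Fin d)), IsCompact B → MemLp m₀' p (volume.restrict B))
    (hinit : (m₀ ≠ 0 ∧ m₀ ∈ Submodule.span ℝ (range (GaussianWave.psiH1 (d := d)))) ∨
      (m₀ = 0 ∧ m₀' ≠ 0 ∧ m₀' ∈ Submodule.span ℝ (range (GaussianWave.psiL2 (d := d)))))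
    (MT : GaussianWave.State d) (T ε : ℝ) (hT : 0 < T) (hε : 0 < ε) :
    ∃ θ : EuclideanSpace ℝ (Fin d) → ℝ → ℝ,
      MemLp (fun z : EuclideanSpace ℝ (Fin d) × ℝ => θ z.1 z.2) ∞
        (volume.prod (volume.restrict (Icc 0 T))) ∧
      ∃ M : ℝ → GaussianWave.State d,
        GaussianWave.IsMildSolution hσ hσ0 θ T (WithLp.toLp 2 (m₀, m₀')) M ∧
        (∀ N : ℝ → GaussianWave.State d,
          GaussianWave.IsMildSolution hσ hσ0 θ T (WithLp.toLp 2 (m₀, m₀')) N →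
            EqOn N M (Icc 0 T)) ∧
        ‖M T - MT‖ < ε := by
  obtain ⟨Θ, θ, hθ, M, hM, hMT⟩ : ∃ Θ, Reach hσ hσ0 (WithLp.toLp 2 (m₀, m₀')) T MT ε Θ := by
    rcases hinit with ⟨h0, h⟩ | ⟨rfl, h0, h⟩
    · exact reach_of_position h h0 m₀' MT hT hε
    · exact reach_of_velocity h h0 MT hT hε
  refine ⟨θ, memLp_top_of_bound hθ.meas.aestronglyMeasurable Θ
    (ae_of_all _ fun z => hθ.bound z.1 z.2), M, hM.isMildSolution hθ, fun N hN t ht => ?_, hMT⟩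
  obtain ⟨N', hN', hNN'⟩ := hN.exists_mildSol hT.le
  rw [hNN' ht]
  exact hN'.eqOn hθ.nonlinearity hM ht
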